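/- **Setting.** Let $K\ge 2$, $\sigma>0$ and $0\le\varepsilon<1/2$. A law $P$ on $\mathbb R$ with mean $m(P)$ is $\sigma$-sub-Gaussian if $\mathbb E_{X\sim P}[e^{s(X-m(P))}]\le e^{s^2\sigma^2/2}$ for all $s\in\mathbb R$. A bandit instance consists of $\sigma$-sub-Gaussian reward laws $\mathbb P_1,\dots,\mathbb P_K$, and an oblivious adversary of laws $\mathbb Q_i(t)\neq\mathbb P_i$, one for each arm $i$ and round $t$. In round $t$, independently of the other rounds, there are rewards $X_{i,t}\sim\mathbb P_i$, adversarial samples $X'_{i,t}\sim\mathbb Q_i(t)$ and a coin $D_t\sim\mathrm{Bern}(\varepsilon)$; a learner that pulls arm $i$ observes $X_{i,t}$ if $D_t=0$ and $X'_{i,t}$ if $D_t=1$, so that its observation has law $(1-\varepsilon)\mathbb P_i+\varepsilon\,\mathbb Q_i(t)$. A (possibly randomized) procedure chooses the next arm, a stopping time $\tau\in\{0,1,\dots,\infty\}$ and, if $\tau<\infty$, a returned arm $\hat a_\tau$, on the basis of its past pulls and observations. Let $U=U(\varepsilon,\sigma)$ be the unavoidable uncertainty about the mean of an arm: the infimum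 of all $u$ for which some map $T$ from laws to reals satisfies $|T((1-\varepsilon)P+\varepsilon Q)-m(P)|\le u$ for every $\sigma$-sub-Gaussian law $P$ and every law $Q$. A procedure is $\delta$-PAC if, for every instance as above and every oblivious adversary, with $\mu_i=m(\mathbb P_i)$ and $\mu_{a^\star}=\max_i\mu_i$, $$\mathbb P\big(\tau<\infty,\ \mu_{\hat a_\tau}+U<\mu_{a^\star}-U\big)\le\delta .$$ **Statement.** There is an absolute constant $c>0$ such that the following holds, where $\varepsilon\sqrt{\log(1/\varepsilon)}$ is read as $0$ for $\varepsilon=0$. (i) $U(\varepsilon,\sigma)\ge c\,\sigma\varepsilon\sqrt{\log(1/\varepsilon)}$ for all $\varepsilon\in[0,1/2)$ and $\sigma>0$. (ii) For all $K\ge2$, $\varepsilon\in[0,1/2)$, $\sigma>0$ and all means $\mu_1,\dots,\mu_K$ with a best arm $a^\star$ that satisfies $\mu_{a^\star}-U>\mu_i+U$ for every $i\ne a^\star$, and with a second-best arm $b^\star$, there are a $\sigma$-sub-Gaussian instance with these means and an oblivious adversary such that every family of procedures, the one with index $\delta\in(0,1)$ being $\delta$-PAC, satisfies on this instance and against this adversary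 $$\liminf_{\delta\to0}\frac{\mathbb E[\tau]}{\log(1/\delta)}\ \ge\ \sum_{i=1}^K\left(\frac{\sqrt2\,\sigma}{\max\{\tilde\Delta_i,\tilde\Delta_{b^\star}\}-c\,\sigma\varepsilon\sqrt{\log(1/\varepsilon)}}\right)^2,\qquad \tilde\Delta_i=\mu_{a^\star}-\mu_i .$$ By (i) and the assumption on the means, all denominators are positive. -/

import Mathlib

open MeasureTheory ProbabilityTheory Filter Topology

noncomputable section

namespace CBAI

/-- The mean of a law on the real line. -/
def mean (P : ProbabilityMeasure ℝ) : ℝ := ∫ x, x ∂(P : Measure ℝ)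

/-- A law `P` is `σ`-sub-Gaussian: if `X ∼ P` then
`𝔼[exp (s (X - 𝔼 X))] ≤ exp (s² σ² / 2)` for every real `s`. -/
def IsSubGaussian (σ : ℝ) (P : ProbabilityMeasure ℝ) : Prop :=
  HasSubgaussianMGF (fun x : ℝ => x - mean P) (Real.toNNReal (σ ^ 2)) (P : Measure ℝ)

/-- The contaminated law `(1 - ε) P + ε Q` of an observation: true law `P`, adversarial law `Q`. -/
def contaminated (ε : unitInterval) (P Q : ProbabilityMeasure ℝ) : Measure ℝ :=
  ENNReal.ofReal (1 - (ε : ℝ)) • (P : Measure ℝ) + ENNReal.ofReal (ε : ℝ) • (Q : Measure ℝ)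

/-- `U` is an achievable uncertainty at contamination level `ε` for `σ`-sub-Gaussian laws: some rule
`T` recovers the mean of the true law up to an error of at most `U` from full knowledge of the
contaminated law (that is, from infinitely many samples), whatever the true law and the adversarial
law are. -/
def AchievableUncertainty (ε : unitInterval) (σ U : ℝ) : Prop :=
  ∃ T : Measure ℝ → ℝ, ∀ P Q : ProbabilityMeasure ℝ, IsSubGaussian σ P →
    |T (contaminated ε P Q) - mean P| ≤ U

/-- The uncertainty `U = U(ε, σ)` of the contaminated problem: the smallest radius up to which the
mean of a `σ`-sub-Gaussian arm can be determined under contamination at level `ε`. -/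
def uncertainty (ε : unitInterval) (σ : ℝ) : ℝ :=
  sInf {U : ℝ | AchievableUncertainty ε σ U}

/-- The random variables of one round: the true rewards `X i` of all arms, the adversarial samples
`X' i` of all arms, and the coin `D` (`true` means that the reward is replaced). -/
abbrev Round (K : ℕ) : Type := (Fin K → ℝ) × (Fin K → ℝ) × Bool

/-- The reward that the learner observes in a round in which it pulls arm `i`. -/
def observed {K : ℕ} (r : Round K) (i : Fin K) : ℝ :=
  if r.2.2 then r.2.1 i else r.1 i

/-- The law of round `t`: `X i ∼ P i`, `X' i ∼ Q i t`, `D ∼ Bern(ε)`. Pulling arm `i` gives an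
observation with law `(1 - ε) P i + ε Q i t`. -/
def roundLaw {K : ℕ} (ε : unitInterval) (P : Fin K → ProbabilityMeasure ℝ)
    (Q : Fin K → ℕ → ProbabilityMeasure ℝ) (t : ℕ) : Measure (Round K) :=
  (Measure.pi fun i => (P i : Measure ℝ)).prod
    ((Measure.pi fun i => (Q i t : Measure ℝ)).prod (bernoulliMeasure true false ε))

/-- The law of all rounds against an oblivious adversary: the rounds are independent. -/
def envLaw {K : ℕ} (ε : unitInterval) (P : Fin K → ProbabilityMeasure ℝ)
    (Q : Fin K → ℕ → ProbabilityMeasure ℝ) : Measure (ℕ → Round K) :=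
  Measure.infinitePi (roundLaw ε P Q)

/-- The adversarial laws `Q i t` (arm `i`, round `t`) are distinct from the true law of the arm. -/
def IsAdversary {K : ℕ} (P : Fin K → ProbabilityMeasure ℝ)
    (Q : Fin K → ℕ → ProbabilityMeasure ℝ) : Prop :=
  ∀ i t, Q i t ≠ P i

/-- What the learner has seen after `t` rounds: the pulled arms and the observed rewards. -/
abbrev History (K t : ℕ) : Type := Fin t → Fin K × ℝ

/-- A (possibly randomized) sequential procedure on `K` arms. The randomization is a seed that is
drawn independently of all rewards. After `t` rounds, given the seed and the history,
`halts t` says whether the procedure stops now, `recommend t` is the arm it then returns, and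
`sample t` is the arm it pulls next if it goes on. -/
structure Procedure (K : ℕ) where
  Seed : Type
  [seedSpace : MeasurableSpace Seed]
  seedLaw : ProbabilityMeasure Seed
  sample : (t : ℕ) → Seed × History K t → Fin K
  halts : (t : ℕ) → Set (Seed × History K t)
  recommend : (t : ℕ) → Seed × History K t → Fin K
  measurable_sample : ∀ t, Measurable (sample t)
  measurableSet_halts : ∀ t, MeasurableSet (halts t)
  measurable_recommend : ∀ t, Measurable (recommend t)

attribute [instance] Procedure.seedSpace

namespace Procedure

variable {K : ℕ} (π : Procedure K)

/-- The history of the first `t` rounds that results from a seed and the variables of all rounds. -/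
def history (s : π.Seed) (ω : ℕ → Round K) : (t : ℕ) → History K t
  | 0 => Fin.elim0
  | t + 1 =>
    Fin.snoc (history s ω t)
      (π.sample t (s, history s ω t), observed (ω t) (π.sample t (s, history s ω t)))

/-- The stopping time `τ`: the first `t` at which the procedure decides to stop, and `⊤` if it
never does. -/
def stopTime (x : π.Seed × (ℕ → Round K)) : ℕ∞ :=
  ⨅ (t : ℕ) (_ : (x.1, π.history x.1 x.2 t) ∈ π.halts t), (t : ℕ∞)

/-- The joint law of the seed and of all rounds. -/
def law (ε : unitInterval) (P : Fin K → ProbabilityMeasure ℝ)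
    (Q : Fin K → ℕ → ProbabilityMeasure ℝ) : Measure (π.Seed × (ℕ → Round K)) :=
  (π.seedLaw : Measure π.Seed).prod (envLaw ε P Q)

/-- The average sample complexity `𝔼[τ]`. -/
def expectedTime (ε : unitInterval) (P : Fin K → ProbabilityMeasure ℝ)
    (Q : Fin K → ℕ → ProbabilityMeasure ℝ) : ENNReal :=
  ∫⁻ x, (π.stopTime x : ENNReal) ∂(π.law ε P Q)

/-- The event of a wrong decision: the procedure stops and, for the best arm `j`,
`mean (P â) + U < mean (P j) - U`, where `â` is the returned arm. (If this holds for some arm `j`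
then it holds for the best one.) -/
def errorEvent (U : ℝ) (P : Fin K → ProbabilityMeasure ℝ) : Set (π.Seed × (ℕ → Round K)) :=
  {x | ∃ t : ℕ, π.stopTime x = t ∧
    ∃ j : Fin K, mean (P (π.recommend t (x.1, π.history x.1 x.2 t))) + U < mean (P j) - U}

/-- The procedure is `δ`-PAC with uncertainty `U` for `σ`-sub-Gaussian bandits under contamination
at level `ε`: for every such bandit and every oblivious adversary, a wrong decision has probability
at most `δ`. -/
def IsPAC (ε : unitInterval) (σ U δ : ℝ) : Prop :=
  ∀ (P : Fin K → ProbabilityMeasure ℝ) (Q : Fin K → ℕ → ProbabilityMeasure ℝ),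
    (∀ i, IsSubGaussian σ (P i)) → IsAdversary P Q →
      π.law ε P Q (π.errorEvent U P) ≤ ENNReal.ofReal δ

end Procedure

end CBAI

end

/-! The lower bound is a change of measure between contaminated laws. Suppose an alternative
environment differs from the base one only in the best arm `a` and one other arm `i`, and `i` beats
`a` there by more than `2U`. A `δ`-PAC procedure returns `a` with probability at least `1 - δ` in
the base environment (if its expected time is finite) and at most `δ` in the alternative. Its
observations therefore carry relative entropy of at least about `log (1/δ)`: this is a lower bound
for the expected pulls of `a` and `i`, each weighted by the relative entropy between the two
contaminated laws of that arm (`Procedure.information_le`). What remains is to find an instance and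
an adversary for which such alternatives are cheap.

Lowering the best arm (`exists_lowered`). By the definition of `U` there are two sub-Gaussian laws
with means almost `2U` apart that share a contaminated law, so moving between them costs nothing. To
be able to go further down, both are scaled by `907/1000` and convolved with normal noise of
standard deviation `0.42 σ`. A free decrease of `1.81 U` survives, and a further decrease `y`, a
shift of the noise, costs `y² / (2 (0.42 σ)²)`.

Raising another arm (`exists_raised`). For `x ≥ 1.4 U`, a raise by more than `x + 0.19 U` costs only
`(x - e)² / (2σ²)` up to a factor `1 + η`, where `e = σ ε √(log (1/ε)) / 2000`. The adversary
provides the discount by one of three devices, according to the sizes of `ε` and `x`: imitating the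
other law, imitating a small atom in the tail, or sampling far in the tail. Bounds on `U` from both
sides, of order `σ ε √(log (1/ε))` for small `ε`, make the gains comparable with `U` and `e`
(`mul_sqrt_le_uncertainty`, `uncertainty_le_mul_sqrt`).

Combination (`exists_instance`). For `i` other than `a` and `b`, the raise with `x = Δᵢ` and the
free decrease of `a` together exceed `Δᵢ + 2U`; only pulls of `i` pay, which gives the `i`-th term.
The terms of `a` and `b` are equal, so the pulls of these two arms together must pay for twice that
term. For them the gap `Δ_b` is split: `b` is raised with `z = (50/71) Δ_b` and `a` is lowered by a
further `0.42 z`. Indeed `1.42 z = Δ_b`, each of the two arms costs at most about `z² / (2σ²)`, and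
`2 (50/71)² < (499/500)²` leaves room for `e`. -/

open scoped NNReal

namespace CBAI

/-! ### Upper bounds on relative entropy: data processing, products, convexity. -/

section KLBound

variable {Ω Ω' : Type*} [MeasurableSpace Ω] [MeasurableSpace Ω']

/-- `KLBound C C' k` certifies that the relative entropy of `C` with respect to `C'` is at most `k`:
there is a version `ℓ` of the log-likelihood ratio with mean at most `k` under `C`, where `C'` may
have an additional part that `C` does not see. -/
def KLBound (C C' : Measure Ω) (k : ℝ) : Prop :=
  ∃ ℓ : Ω → ℝ, Measurable ℓ ∧ Integrable ℓ C ∧ ∫ x, ℓ x ∂C ≤ k ∧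
    C.withDensity (fun x => ENNReal.ofReal (Real.exp (-ℓ x))) ≤ C'

theorem KLBound.mono {C C' : Measure Ω} {k k' : ℝ} (h : KLBound C C' k) (hk : k ≤ k') :
    KLBound C C' k' := by
  obtain ⟨ℓ, h1, h2, h3, h4⟩ := h
  exact ⟨ℓ, h1, h2, h3.trans hk, h4⟩

theorem KLBound.refl (C : Measure Ω) : KLBound C C 0 :=
  ⟨fun _ => 0, measurable_const, integrable_zero _ _ _, by simp, by simp⟩

/-- Data processing. -/
theorem KLBound.map {C C' : Measure Ω} [IsFiniteMeasure C] [IsFiniteMeasure C'] {k : ℝ}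
    (h : KLBound C C' k) {f : Ω → Ω'} (hf : Measurable f) :
    KLBound (C.map f) (C'.map f) k := by
  obtain ⟨ℓ, hℓ, hint, hk, hle⟩ := h
  set w : Ω → ENNReal := fun x => ENNReal.ofReal (Real.exp (-ℓ x)) with hw
  have hwm : Measurable w := by fun_prop
  set D := C.withDensity w with hD
  have : IsFiniteMeasure D := isFiniteMeasure_of_le C' hle
  have hDC : D ≪ C := withDensity_absolutelyContinuous _ _
  have hCD : C ≪ D := withDensity_absolutelyContinuous' hwm.aemeasurable
    (Eventually.of_forall fun x => by simp [hw, Real.exp_pos])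
  set C1 := C.map f
  set D1 := D.map f
  have hDC1 : D1 ≪ C1 := hDC.map hf
  have hCD1 : C1 ≪ D1 := hCD.map hf
  set r := D1.rnDeriv C1 with hr
  have hrm : Measurable r := Measure.measurable_rnDeriv _ _
  have hrpos : ∀ᵐ x ∂C1, 0 < r x := Measure.rnDeriv_pos' hCD1
  have hrtop : ∀ᵐ x ∂C1, r x < ⊤ := Measure.rnDeriv_lt_top _ _
  set ℓ1 : Ω' → ℝ := fun x => -Real.log (r x).toReal with hℓ1
  have hℓ1m : Measurable ℓ1 := by fun_prop
  have hexp : ∀ᵐ x ∂C1, ENNReal.ofReal (Real.exp (-ℓ1 x)) = r x := by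
    filter_upwards [hrpos, hrtop] with x h0 h1
    simp only [hℓ1, neg_neg]
    rw [Real.exp_log (ENNReal.toReal_pos h0.ne' h1.ne), ENNReal.ofReal_toReal h1.ne]
  have hexp' : ∀ᵐ x ∂C1, ENNReal.ofReal (Real.exp (ℓ1 x)) = (r x)⁻¹ := by
    filter_upwards [hrpos, hrtop] with x h0 h1
    have h2 := ENNReal.toReal_pos h0.ne' h1.ne
    simp only [hℓ1]
    rw [Real.exp_neg, Real.exp_log h2, ENNReal.ofReal_inv_of_pos h2, ENNReal.ofReal_toReal h1.ne]
  have hwd : C1.withDensity r = D1 := Measure.withDensity_rnDeriv_eq _ _ hDC1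
  -- The weight `exp (-ℓ)` turns `C` into `D`, and `exp ℓ1` is the inverse of the density of the
  -- image of `D`. With this identity, `u ≤ exp u - 1` at `u = ℓ1 ∘ f - ℓ` compares the two means
  -- without conditional expectations.
  have hlint : ∫⁻ x, ENNReal.ofReal (Real.exp (ℓ1 (f x) - ℓ x)) ∂C = C Set.univ := by
    calc ∫⁻ x, ENNReal.ofReal (Real.exp (ℓ1 (f x) - ℓ x)) ∂C
        = ∫⁻ x, w x * ENNReal.ofReal (Real.exp (ℓ1 (f x))) ∂C := by
          refine lintegral_congr fun x => ?_
          rw [hw, ← ENNReal.ofReal_mul (Real.exp_pos _).le, ← Real.exp_add]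
          congr 2; ring
      _ = ∫⁻ x, ENNReal.ofReal (Real.exp (ℓ1 (f x))) ∂D := by
          rw [hD, lintegral_withDensity_eq_lintegral_mul _ hwm (by fun_prop)]; rfl
      _ = ∫⁻ x, ENNReal.ofReal (Real.exp (ℓ1 x)) ∂D1 := by
          rw [lintegral_map (by fun_prop) hf]
      _ = ∫⁻ x, (r * fun x => ENNReal.ofReal (Real.exp (ℓ1 x))) x ∂C1 := by
          rw [← hwd, lintegral_withDensity_eq_lintegral_mul _ hrm (by fun_prop)]
      _ = ∫⁻ x, 1 ∂C1 := by
          refine lintegral_congr_ae ?_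
          filter_upwards [hrpos, hrtop, hexp'] with x h0 h1 h2
          rw [Pi.mul_apply, h2, ENNReal.mul_inv_cancel h0.ne' h1.ne]
      _ = C Set.univ := by
          rw [lintegral_one, Measure.map_apply hf MeasurableSet.univ, Set.preimage_univ]
  have hi2 : Integrable (fun x => Real.exp (ℓ1 (f x) - ℓ x)) C := by
    refine ⟨by fun_prop, ?_⟩
    rw [hasFiniteIntegral_iff_ofReal (Eventually.of_forall fun x => (Real.exp_pos _).le), hlint]
    exact measure_lt_top _ _
  have hi3 : ∫ x, Real.exp (ℓ1 (f x) - ℓ x) ∂C = C.real Set.univ := by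
    rw [integral_eq_lintegral_of_nonneg_ae (Eventually.of_forall fun x => (Real.exp_pos _).le)
      (by fun_prop), hlint]; rfl
  have hri : Integrable (fun x => (r x).toReal) C1 := Measure.integrable_toReal_rnDeriv
  have hri' : Integrable (fun x => (r (f x)).toReal) C := hri.comp_measurable hf
  have hub : ∀ x, ℓ1 (f x) ≤ ℓ x - 1 + Real.exp (ℓ1 (f x) - ℓ x) := fun x => by
    have := Real.add_one_le_exp (ℓ1 (f x) - ℓ x); linarith
  have hub_int : Integrable (fun x => ℓ x - 1 + Real.exp (ℓ1 (f x) - ℓ x)) C :=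
    (hint.sub (integrable_const 1)).add hi2
  have hℓ1i' : Integrable (fun x => ℓ1 (f x)) C := by
    refine integrable_of_le_of_le (g₁ := fun x => -(r (f x)).toReal)
      (hℓ1m.comp hf).aestronglyMeasurable
      (Eventually.of_forall fun x => ?_) (Eventually.of_forall hub) hri'.neg hub_int
    simp only [hℓ1, neg_le_neg_iff]
    exact Real.log_le_self ENNReal.toReal_nonneg
  refine ⟨ℓ1, hℓ1m, (integrable_map_measure hℓ1m.aestronglyMeasurable hf.aemeasurable).2 hℓ1i',
    ?_, ?_⟩
  · rw [integral_map hf.aemeasurable hℓ1m.aestronglyMeasurable]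
    calc ∫ x, ℓ1 (f x) ∂C ≤ ∫ x, (ℓ x - 1 + Real.exp (ℓ1 (f x) - ℓ x)) ∂C :=
          integral_mono hℓ1i' hub_int hub
      _ = ∫ x, ℓ x ∂C := by
          have e1 := integral_add (hint.sub (integrable_const 1)) hi2
          have e2 := integral_sub hint (integrable_const (1 : ℝ))
          simp only [Pi.sub_apply] at e1
          rw [e1, e2, hi3]
          simp
      _ ≤ k := hk
  · rw [withDensity_congr_ae hexp, hwd]
    exact Measure.map_mono hle hf

theorem KLBound.prod_right {C C' : Measure Ω} [IsFiniteMeasure C] [IsFiniteMeasure C'] {k : ℝ}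
    (h : KLBound C C' k) (R : Measure Ω') [IsProbabilityMeasure R] :
    KLBound (R.prod C) (R.prod C') k := by
  obtain ⟨ℓ, hℓ, hint, hk, hle⟩ := h
  refine ⟨fun x => ℓ x.2, by fun_prop, hint.comp_snd R, ?_, ?_⟩
  · rw [integral_fun_snd]; simpa using hk
  · have : IsFiniteMeasure (C.withDensity fun x => ENNReal.ofReal (Real.exp (-ℓ x))) :=
      isFiniteMeasure_of_le _ hle
    have hm : Measurable fun x => ENNReal.ofReal (Real.exp (-ℓ x)) := by fun_prop
    rw [show (R.prod C).withDensity (fun x => ENNReal.ofReal (Real.exp (-ℓ x.2))) =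
      R.prod (C.withDensity fun x => ENNReal.ofReal (Real.exp (-ℓ x))) from
        (prod_withDensity_right hm).symm]
    exact Measure.prod_mono le_rfl hle

/-- Joint convexity. -/
theorem KLBound.mix {C₁ C₂ D₁ D₂ : Measure Ω} [IsFiniteMeasure C₁] [IsFiniteMeasure C₂]
    [IsFiniteMeasure D₁] [IsFiniteMeasure D₂] {k₁ k₂ α β : ℝ} (h₁ : KLBound C₁ D₁ k₁)
    (h₂ : KLBound C₂ D₂ k₂) (hα : 0 ≤ α) (hβ : 0 ≤ β) :
    KLBound (ENNReal.ofReal α • C₁ + ENNReal.ofReal β • C₂)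
      (ENNReal.ofReal α • D₁ + ENNReal.ofReal β • D₂) (α * k₁ + β * k₂) := by
  obtain ⟨ℓ₁, hm₁, hint₁, hk₁, hle₁⟩ := h₁
  obtain ⟨ℓ₂, hm₂, hint₂, hk₂, hle₂⟩ := h₂
  -- Each component gets a label. With the label visible the log-likelihood ratio is simply that of
  -- the component; forgetting the label is an instance of data processing.
  have e₁ : Measurable fun x : Ω => (x, true) := by fun_prop
  have e₂ : Measurable fun x : Ω => (x, false) := by fun_prop
  let ℓ : Ω × Bool → ℝ := fun x => if x.2 = true then ℓ₁ x.1 else ℓ₂ x.1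
  have hℓ : Measurable ℓ := Measurable.ite (measurable_snd (measurableSet_singleton true))
    (by fun_prop) (by fun_prop)
  have key : KLBound (ENNReal.ofReal α • C₁.map (fun x => (x, true)) +
        ENNReal.ofReal β • C₂.map (fun x => (x, false)))
      (ENNReal.ofReal α • D₁.map (fun x => (x, true)) +
        ENNReal.ofReal β • D₂.map (fun x => (x, false))) (α * k₁ + β * k₂) := by
    have i₁ : Integrable ℓ (C₁.map fun x => (x, true)) :=
      (integrable_map_measure hℓ.aestronglyMeasurable e₁.aemeasurable).2 hint₁
    have i₂ : Integrable ℓ (C₂.map fun x => (x, false)) :=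
      (integrable_map_measure hℓ.aestronglyMeasurable e₂.aemeasurable).2
        (by simpa [ℓ, Function.comp_def] using hint₂)
    refine ⟨ℓ, hℓ, (i₁.smul_measure ENNReal.ofReal_ne_top).add_measure
      (i₂.smul_measure ENNReal.ofReal_ne_top), ?_, ?_⟩
    · rw [integral_add_measure (i₁.smul_measure ENNReal.ofReal_ne_top)
        (i₂.smul_measure ENNReal.ofReal_ne_top), integral_smul_measure, integral_smul_measure,
        integral_map e₁.aemeasurable hℓ.aestronglyMeasurable,
        integral_map e₂.aemeasurable hℓ.aestronglyMeasurable, ENNReal.toReal_ofReal hα,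
        ENNReal.toReal_ofReal hβ]
      simp only [ℓ, smul_eq_mul, if_true, Bool.false_eq_true, if_false]
      gcongr
    · have wm (C : Measure Ω) (ℓ' : Ω → ℝ) (b : Bool) (hb : ∀ x, ℓ (x, b) = ℓ' x) :
          (C.map fun x => (x, b)).withDensity (fun x => ENNReal.ofReal (Real.exp (-ℓ x))) =
            (C.withDensity fun x => ENNReal.ofReal (Real.exp (-ℓ' x))).map fun x => (x, b) := by
        have e : Measurable fun x : Ω => (x, b) := by fun_prop
        ext s hs
        rw [withDensity_apply _ hs, Measure.map_apply e hs, withDensity_apply _ (e hs),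
          setLIntegral_map hs (by fun_prop) e]
        simp only [hb]
      rw [withDensity_add_measure, withDensity_smul_measure, withDensity_smul_measure,
        wm C₁ ℓ₁ true (fun x => by simp [ℓ]), wm C₂ ℓ₂ false (fun x => by simp [ℓ])]
      gcongr
  have e₃ : Measurable (Prod.fst : Ω × Bool → Ω) := measurable_fst
  have (C : Measure (Ω × Bool)) [IsFiniteMeasure C] (a : ℝ) :
      IsFiniteMeasure (ENNReal.ofReal a • C) := Measure.smul_finite _ ENNReal.ofReal_ne_top
  have := key.map e₃
  have mm (C : Measure Ω) (b : Bool) : (C.map fun x => (x, b)).map Prod.fst = C := by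
    rw [Measure.map_map measurable_fst (by fun_prop)]
    exact Measure.map_id
  simpa [Measure.map_add _ _ e₃, Measure.map_smul, mm] using this

end KLBound

/-! ### The law of an observation in one round. -/

instance isProbabilityMeasure_contaminated (ε : unitInterval) (P Q : ProbabilityMeasure ℝ) :
    IsProbabilityMeasure (contaminated ε P Q) := by
  refine ⟨?_⟩
  have h0 := ε.2.1
  have h1 := ε.2.2
  simp only [contaminated, Measure.add_apply, Measure.smul_apply, measure_univ, smul_eq_mul, mul_one]
  rw [← ENNReal.ofReal_add (by linarith) h0]
  simp

section Rounds

variable {K : ℕ} (ε : unitInterval) (P : Fin K → ProbabilityMeasure ℝ)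
  (Q : Fin K → ℕ → ProbabilityMeasure ℝ)

instance isProbabilityMeasure_roundLaw (t : ℕ) : IsProbabilityMeasure (roundLaw ε P Q t) := by
  unfold roundLaw; infer_instance

instance isProbabilityMeasure_envLaw : IsProbabilityMeasure (envLaw ε P Q) := by
  unfold envLaw; infer_instance

instance isProbabilityMeasure_law (π : Procedure K) : IsProbabilityMeasure (π.law ε P Q) := by
  unfold Procedure.law; infer_instance

theorem measurable_observed (i : Fin K) : Measurable fun r : Round K => observed r i := by
  unfold observed
  exact Measurable.ite (measurable_snd.snd (measurableSet_singleton true)) (by fun_prop)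
    (by fun_prop)

theorem measurable_observed_uncurry :
    Measurable fun x : Round K × Fin K => observed x.1 x.2 :=
  measurable_from_prod_countable_left fun i => measurable_observed i

theorem lintegral_observed (t : ℕ) (i : Fin K) {g : ℝ → ENNReal} (hg : Measurable g) :
    ∫⁻ r, g (observed r i) ∂(roundLaw ε P Q t) = ∫⁻ y, g y ∂(contaminated ε (P i) (Q i t)) := by
  have hm : Measurable fun r : Round K => g (observed r i) := hg.comp (measurable_observed i)
  have hP : ∫⁻ x : Fin K → ℝ, g (x i) ∂(Measure.pi fun i => (P i : Measure ℝ)) =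
      ∫⁻ y, g y ∂(P i : Measure ℝ) :=
    (measurePreserving_eval (fun i => (P i : Measure ℝ)) i).lintegral_comp hg
  have hQ : ∫⁻ x : Fin K → ℝ, g (x i) ∂(Measure.pi fun i => (Q i t : Measure ℝ)) =
      ∫⁻ y, g y ∂(Q i t : Measure ℝ) :=
    (measurePreserving_eval (fun i => (Q i t : Measure ℝ)) i).lintegral_comp hg
  have hb (x x' : Fin K → ℝ) : ∫⁻ b, g (observed (x, x', b) i) ∂(bernoulliMeasure true false ε) =
      ENNReal.ofReal ε * g (x' i) + ENNReal.ofReal (1 - (ε : ℝ)) * g (x i) := by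
    rw [bernoulliMeasure_def, lintegral_add_measure, ← Measure.coe_nnreal_smul,
      ← Measure.coe_nnreal_smul, lintegral_smul_measure, lintegral_smul_measure,
      lintegral_dirac, lintegral_dirac]
    simp only [observed, if_true, Bool.false_eq_true, if_false, smul_eq_mul]
    congr 2 <;> (rw [← ENNReal.ofReal_coe_nnreal]; congr 1)
  rw [roundLaw, lintegral_prod _ hm.aemeasurable]
  have hi (x : Fin K → ℝ) : ∫⁻ y, g (observed (x, y) i)
        ∂((Measure.pi fun i => (Q i t : Measure ℝ)).prod (bernoulliMeasure true false ε)) =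
      ENNReal.ofReal ε * (∫⁻ y, g y ∂(Q i t : Measure ℝ)) + ENNReal.ofReal (1 - (ε : ℝ)) * g (x i) := by
    have hx : Measurable fun y : (Fin K → ℝ) × Bool => g (observed (x, y) i) :=
      hm.comp (measurable_const.prodMk measurable_id)
    rw [lintegral_prod _ hx.aemeasurable]
    simp_rw [hb]
    rw [lintegral_add_right _ measurable_const, lintegral_const_mul _ (by fun_prop), hQ]
    simp
  simp_rw [hi]
  have hgi : Measurable fun x : Fin K → ℝ => g (x i) := hg.comp (measurable_pi_apply i)
  rw [lintegral_add_left measurable_const, lintegral_const,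
    lintegral_const_mul _ hgi, hP, contaminated,
    lintegral_add_measure, lintegral_smul_measure, lintegral_smul_measure]
  simp [add_comm]

theorem map_observed (t : ℕ) (i : Fin K) :
    (roundLaw ε P Q t).map (fun r => observed r i) = contaminated ε (P i) (Q i t) := by
  refine Measure.ext_of_lintegral _ fun g hg => ?_
  rw [lintegral_map hg (measurable_observed i), lintegral_observed ε P Q t i hg]

end Rounds

/-! ### Histories, and change of measure up to a fixed round. -/

namespace Procedure

variable {K : ℕ} (π : Procedure K)

/-- The information after `t` rounds: the seed and the history. -/
def info (t : ℕ) (x : π.Seed × (ℕ → Round K)) : π.Seed × History K t :=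
  (x.1, π.history x.1 x.2 t)

/-- The information after one more round, given the variables of that round. -/
def extend (t : ℕ) (h : π.Seed × History K t) (r : Round K) : π.Seed × History K (t + 1) :=
  (h.1, Fin.snoc h.2 (π.sample t h, observed r (π.sample t h)))

theorem info_succ (t : ℕ) (x : π.Seed × (ℕ → Round K)) :
    π.info (t + 1) x = π.extend t (π.info t x) (x.2 t) := rfl

theorem measurable_snoc (t : ℕ) :
    Measurable fun p : History K t × (Fin K × ℝ) => (Fin.snoc p.1 p.2 : History K (t + 1)) := by
  refine measurable_pi_iff.2 fun i => ?_
  refine Fin.lastCases ?_ (fun j => ?_) i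
  · simpa using measurable_snd
  · have : Measurable fun p : History K t × (Fin K × ℝ) => p.1 j :=
      (measurable_pi_apply j).comp measurable_fst
    simpa using this

theorem measurable_extend (t : ℕ) :
    Measurable fun p : (π.Seed × History K t) × Round K => π.extend t p.1 p.2 := by
  have hs : Measurable fun p : (π.Seed × History K t) × Round K => π.sample t p.1 :=
    (π.measurable_sample t).comp measurable_fst
  have ho : Measurable fun p : (π.Seed × History K t) × Round K =>
      observed p.2 (π.sample t p.1) :=
    measurable_observed_uncurry.comp (measurable_snd.prodMk hs)
  exact (measurable_fst.fst).prodMk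
    ((measurable_snoc t).comp ((measurable_fst.snd).prodMk (hs.prodMk ho)))

theorem measurable_info (t : ℕ) : Measurable (π.info t) := by
  induction t with
  | zero =>
    refine measurable_fst.prodMk ?_
    exact measurable_pi_iff.2 fun i => i.elim0
  | succ t ih =>
    exact (π.measurable_extend t).comp (ih.prodMk ((measurable_pi_apply t).comp measurable_snd))

theorem history_congr (s : π.Seed) {ω ω' : ℕ → Round K} (t : ℕ) (h : ∀ j < t, ω j = ω' j) :
    π.history s ω t = π.history s ω' t := by
  induction t with
  | zero => rfl
  | succ t ih =>
    simp only [history]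
    rw [ih fun j hj => h j (by omega), h t (by omega)]

section Law

variable (ε : unitInterval) (P : Fin K → ProbabilityMeasure ℝ)
  (Q : Fin K → ℕ → ProbabilityMeasure ℝ)

theorem indepFun_history (s : π.Seed) (t : ℕ) :
    IndepFun (fun ω : ℕ → Round K => π.history s ω t) (fun ω => ω t) (envLaw ε P Q) := by
  have h0 : iIndepFun (fun (i : ℕ) (ω : ℕ → Round K) => ω i) (envLaw ε P Q) :=
    iIndepFun_infinitePi (X := fun _ r => r) fun _ => measurable_id
  have h1 := h0.indepFun_finset (Finset.range t) {t} (by simp) (fun i => measurable_pi_apply i)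
  -- The rounds before `t` are completed by an arbitrary default round; by `history_congr` the
  -- history of the first `t` rounds does not see it.
  let e : (Finset.range t → Round K) → ℕ → Round K := fun z j =>
    if h : j ∈ Finset.range t then z ⟨j, h⟩ else (fun _ => 0, fun _ => 0, false)
  have he : Measurable e := by
    refine measurable_pi_iff.2 fun j => ?_
    by_cases h : j ∈ Finset.range t
    · simp only [e, dif_pos h]
      exact measurable_pi_apply (X := fun _ : Finset.range t => Round K) ⟨j, h⟩
    · simp only [e, dif_neg h]
      exact measurable_const
  have hφ : Measurable fun z => π.history s (e z) t :=
    ((π.measurable_info t).comp (measurable_const.prodMk he)).snd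
  have hψ : Measurable fun z : (({t} : Finset ℕ) → Round K) => z ⟨t, by simp⟩ :=
    measurable_pi_apply _
  have h2 := h1.comp hφ hψ
  have e1 : (fun ω : ℕ → Round K => π.history s ω t) =
      (fun z => π.history s (e z) t) ∘ fun (ω : ℕ → Round K) (i : Finset.range t) => ω i := by
    ext1 ω
    refine π.history_congr s t fun j hj => ?_
    simp [e, hj]
  rw [e1]
  exact h2

/-- The seed is independent of all rounds and may be fixed first. For a fixed seed, the history is a
function of the rounds before `t`, hence independent of round `t`. -/
theorem map_info_prod (t : ℕ) :
    (π.law ε P Q).map (fun x => (π.info t x, x.2 t)) =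
      ((π.law ε P Q).map (π.info t)).prod (roundLaw ε P Q t) := by
  have hm : Measurable fun x : π.Seed × (ℕ → Round K) => (π.info t x, x.2 t) :=
    (π.measurable_info t).prodMk ((measurable_pi_apply t).comp measurable_snd)
  refine Measure.ext_of_lintegral _ fun F hF => ?_
  have hG : Measurable fun h => ∫⁻ r, F (h, r) ∂(roundLaw ε P Q t) := hF.lintegral_prod_right'
  rw [lintegral_map hF hm, lintegral_prod _ hF.aemeasurable, lintegral_map hG (π.measurable_info t),
    law]
  have hFm : Measurable fun x : π.Seed × (ℕ → Round K) => F (π.info t x, x.2 t) := hF.comp hm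
  have hGm : Measurable fun x : π.Seed × (ℕ → Round K) =>
      ∫⁻ r, F (π.info t x, r) ∂(roundLaw ε P Q t) := hG.comp (π.measurable_info t)
  rw [lintegral_prod _ hFm.aemeasurable, lintegral_prod _ hGm.aemeasurable]
  refine lintegral_congr fun s => ?_
  have hh : Measurable fun ω : ℕ → Round K => π.history s ω t :=
    ((π.measurable_info t).comp (measurable_const.prodMk measurable_id)).snd
  have hi := (indepFun_iff_map_prod_eq_prod_map_map hh.aemeasurable
    (measurable_pi_apply t).aemeasurable).1 (π.indepFun_history ε P Q s t)
  have he : (envLaw ε P Q).map (fun ω => ω t) = roundLaw ε P Q t := Measure.infinitePi_map_eval _ t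
  have hFs : Measurable fun p : History K t × Round K => F ((s, p.1), p.2) := by fun_prop
  calc ∫⁻ ω, F (π.info t (s, ω), ω t) ∂(envLaw ε P Q)
      = ∫⁻ p, F ((s, p.1), p.2) ∂((envLaw ε P Q).map fun ω => (π.history s ω t, ω t)) := by
        rw [lintegral_map hFs (hh.prodMk (measurable_pi_apply t))]; rfl
    _ = ∫⁻ ω, ∫⁻ r, F (π.info t (s, ω), r) ∂(roundLaw ε P Q t) ∂(envLaw ε P Q) := by
        rw [hi, he, lintegral_prod _ hFs.aemeasurable, lintegral_map hFs.lintegral_prod_right' hh]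
        rfl

theorem map_round (t : ℕ) : (π.law ε P Q).map (fun x => x.2 t) = roundLaw ε P Q t := by
  have h3 := congrArg Measure.snd (π.map_info_prod ε P Q t)
  have : IsProbabilityMeasure ((π.law ε P Q).map (π.info t)) :=
    Measure.isProbabilityMeasure_map (π.measurable_info t).aemeasurable
  rwa [Measure.snd_prod, Measure.snd_map_prodMk (π.measurable_info t)] at h3

theorem indepFun_info (t : ℕ) :
    IndepFun (π.info t) (fun x => x.2 t) (π.law ε P Q) := by
  have h2 : Measurable fun x : π.Seed × (ℕ → Round K) => x.2 t :=
    (measurable_pi_apply t).comp measurable_snd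
  rw [indepFun_iff_map_prod_eq_prod_map_map (π.measurable_info t).aemeasurable h2.aemeasurable,
    π.map_info_prod, π.map_round]

/-- The information after `t + 1` rounds arises from the one after `t` rounds by an independent
observation of the arm that is pulled. -/
theorem lintegral_info_succ (t : ℕ) {f : π.Seed × History K (t + 1) → ENNReal}
    (hf : Measurable f) :
    ∫⁻ x, f (π.info (t + 1) x) ∂(π.law ε P Q) =
      ∫⁻ x, ∫⁻ r, f (π.extend t (π.info t x) r) ∂(roundLaw ε P Q t) ∂(π.law ε P Q) := by
  have hm : Measurable fun x : π.Seed × (ℕ → Round K) => (π.info t x, x.2 t) :=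
    (π.measurable_info t).prodMk ((measurable_pi_apply t).comp measurable_snd)
  have hF : Measurable fun p : (π.Seed × History K t) × Round K => f (π.extend t p.1 p.2) :=
    hf.comp (π.measurable_extend t)
  calc ∫⁻ x, f (π.info (t + 1) x) ∂(π.law ε P Q)
      = ∫⁻ p, f (π.extend t p.1 p.2) ∂((π.law ε P Q).map fun x => (π.info t x, x.2 t)) := by
        rw [lintegral_map hF hm]; rfl
    _ = _ := by
        rw [π.map_info_prod, lintegral_prod _ hF.aemeasurable,
          lintegral_map hF.lintegral_prod_right' (π.measurable_info t)]

end Law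

/-- The likelihood ratio of a history, for log-likelihood ratios `ℓ i` of the arms. -/
noncomputable def likelihood (ℓ : Fin K → ℝ → ℝ) (t : ℕ) (h : π.Seed × History K t) : ENNReal :=
  ∏ j, ENNReal.ofReal (Real.exp (-ℓ (h.2 j).1 (h.2 j).2))

theorem likelihood_extend (ℓ : Fin K → ℝ → ℝ) (t : ℕ) (h : π.Seed × History K t) (r : Round K) :
    π.likelihood ℓ (t + 1) (π.extend t h r) = π.likelihood ℓ t h *
      ENNReal.ofReal (Real.exp (-ℓ (π.sample t h) (observed r (π.sample t h)))) := by
  simp [likelihood, extend, Fin.prod_univ_castSucc]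

theorem measurable_likelihood {ℓ : Fin K → ℝ → ℝ} (hℓ : ∀ i, Measurable (ℓ i)) (t : ℕ) :
    Measurable (π.likelihood ℓ t) := by
  have h1 : Measurable fun p : ℝ × Fin K => ℓ p.2 p.1 :=
    measurable_from_prod_countable_left fun i => hℓ i
  refine Finset.measurable_prod _ fun j _ => ?_
  have h2 : Measurable fun h : π.Seed × History K t => ℓ (h.2 j).1 (h.2 j).2 :=
    h1.comp (((measurable_pi_apply j).comp measurable_snd).snd.prodMk
      ((measurable_pi_apply j).comp measurable_snd).fst)
  exact (Real.measurable_exp.comp h2.neg).ennreal_ofReal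

/-- Change of measure up to a fixed round. -/
theorem lintegral_likelihood_mul_le (ε : unitInterval) (P P' : Fin K → ProbabilityMeasure ℝ)
    (Q Q' : Fin K → ℕ → ProbabilityMeasure ℝ) {ℓ : Fin K → ℝ → ℝ} (hℓ : ∀ i, Measurable (ℓ i))
    (hle : ∀ i t, (contaminated ε (P i) (Q i t)).withDensity
      (fun x => ENNReal.ofReal (Real.exp (-ℓ i x))) ≤ contaminated ε (P' i) (Q' i t))
    (t : ℕ) {g : π.Seed × History K t → ENNReal} (hg : Measurable g) :
    ∫⁻ x, π.likelihood ℓ t (π.info t x) * g (π.info t x) ∂(π.law ε P Q) ≤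
      ∫⁻ x, g (π.info t x) ∂(π.law ε P' Q') := by
  induction t with
  | zero =>
    have hc : ∀ x : π.Seed × (ℕ → Round K), π.info 0 x = (x.1, Fin.elim0) := fun _ => rfl
    simp only [likelihood, Finset.univ_eq_empty, Finset.prod_empty, one_mul, hc]
    have hg' : Measurable fun s : π.Seed => g (s, Fin.elim0) :=
      hg.comp (measurable_id.prodMk measurable_const)
    have hgm : Measurable fun x : π.Seed × (ℕ → Round K) => g (x.1, Fin.elim0) :=
      hg'.comp measurable_fst
    rw [law, law, lintegral_prod _ hgm.aemeasurable, lintegral_prod _ hgm.aemeasurable]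
    simp
  | succ t ih =>
    have hF : Measurable fun p : (π.Seed × History K t) × Round K => g (π.extend t p.1 p.2) :=
      hg.comp (π.measurable_extend t)
    have hL := π.measurable_likelihood hℓ (t + 1)
    rw [π.lintegral_info_succ ε P Q t (f := fun h => π.likelihood ℓ (t + 1) h * g h) (hL.mul hg),
      π.lintegral_info_succ ε P' Q' t hg]
    -- The induction hypothesis is used for `g` with the last round already integrated out under the
    -- alternative; what is left is the one-step inequality `hle` for the arm that is pulled.
    refine le_trans (lintegral_mono fun x => ?_)
      (ih (g := fun h => ∫⁻ r, g (π.extend t h r) ∂(roundLaw ε P' Q' t)) hF.lintegral_prod_right')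
    simp only [likelihood_extend, mul_assoc]
    set h := π.info t x
    set i := π.sample t h with hi
    have hgi : Measurable fun y : ℝ => g (h.1, Fin.snoc h.2 (i, y)) :=
      hg.comp (measurable_const.prodMk ((measurable_snoc t).comp
        (measurable_const.prodMk (measurable_const.prodMk measurable_id))))
    have hei : Measurable fun y : ℝ => ENNReal.ofReal (Real.exp (-ℓ i y)) := by
      have := hℓ i; fun_prop
    have e1 := lintegral_observed ε P Q t i (hei.mul hgi)
    have e2 := lintegral_observed ε P' Q' t i hgi
    simp only [Pi.mul_apply] at e1
    have hm : Measurable fun r : Round K =>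
        ENNReal.ofReal (Real.exp (-ℓ i (observed r i))) * g (π.extend t h r) :=
      (hei.mul hgi).comp (measurable_observed i)
    rw [lintegral_const_mul _ hm]
    refine mul_le_mul le_rfl ?_ zero_le zero_le
    refine (le_of_eq e1).trans (le_trans ?_ (le_of_eq e2.symm))
    have e3 := lintegral_withDensity_eq_lintegral_mul (contaminated ε (P i) (Q i t)) hei hgi
    simp only [Pi.mul_apply] at e3
    rw [← e3]
    exact lintegral_mono' (hle i t) le_rfl

end Procedure

/-! ### Stopping, expected pulls, and the information inequality. -/

theorem enat_eq_tsum_indicator (n : ℕ∞) :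
    (n : ENNReal) = ∑' t : ℕ, if (t : ℕ∞) < n then (1 : ENNReal) else 0 := by
  induction n using ENat.recTopCoe with
  | top => simp
  | coe n =>
    rw [tsum_eq_sum (s := Finset.range n) (fun t ht => by simpa using ht)]
    rw [Finset.sum_congr rfl (g := fun _ => (1 : ENNReal)) (fun t ht => by simpa using ht)]
    simp

namespace Procedure

variable {K : ℕ} (π : Procedure K)

/-- The procedure has not stopped before time `t`. -/
def notStopped : (t : ℕ) → Set (π.Seed × History K t)
  | 0 => Set.univ
  | t + 1 => {h | (h.1, Fin.init h.2) ∈ notStopped t ∧ (h.1, Fin.init h.2) ∉ π.halts t}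

theorem measurableSet_notStopped (t : ℕ) : MeasurableSet (π.notStopped t) := by
  induction t with
  | zero => exact MeasurableSet.univ
  | succ t ih =>
    have hm : Measurable fun h : π.Seed × History K (t + 1) =>
        ((h.1, Fin.init h.2) : π.Seed × History K t) := by
      refine measurable_fst.prodMk (measurable_pi_iff.2 fun j => ?_)
      exact (measurable_pi_apply (Fin.castSucc j)).comp measurable_snd
    exact (hm ih).inter (hm (π.measurableSet_halts t)).compl

theorem info_succ_mem_notStopped_iff (t : ℕ) (x : π.Seed × (ℕ → Round K)) :
    π.info (t + 1) x ∈ π.notStopped (t + 1) ↔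
      π.info t x ∈ π.notStopped t ∧ π.info t x ∉ π.halts t := by
  have h1 : ((π.info (t + 1) x).1, Fin.init (π.info (t + 1) x).2) = π.info t x := by
    simp [info_succ, extend]
  rw [← h1]; rfl

theorem info_mem_notStopped_iff (t : ℕ) (x : π.Seed × (ℕ → Round K)) :
    π.info t x ∈ π.notStopped t ↔ ∀ j < t, π.info j x ∉ π.halts j := by
  induction t with
  | zero => simp [notStopped]
  | succ t ih =>
    rw [info_succ_mem_notStopped_iff, ih]
    constructor
    · rintro ⟨h3, h4⟩ j hj
      rcases Nat.lt_succ_iff_lt_or_eq.1 hj with h | rfl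
      · exact h3 j h
      · exact h4
    · exact fun h => ⟨fun j hj => h j (by omega), h t (by omega)⟩

theorem lt_stopTime_iff (t : ℕ) (x : π.Seed × (ℕ → Round K)) :
    (t : ℕ∞) < π.stopTime x ↔ π.info t x ∈ π.notStopped t ∧ π.info t x ∉ π.halts t := by
  rw [info_mem_notStopped_iff]
  constructor
  · intro h
    have key : ∀ j ≤ t, π.info j x ∉ π.halts j := by
      intro j hj hmem
      have h1 : π.stopTime x ≤ (j : ℕ∞) := iInf₂_le (f := fun (t : ℕ) _ => (t : ℕ∞)) j hmem
      have h2 : (j : ℕ∞) ≤ t := by exact_mod_cast hj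
      exact absurd (h.trans_le (h1.trans h2)) (lt_irrefl _)
    exact ⟨fun j hj => key j hj.le, key t le_rfl⟩
  · rintro ⟨h1, h2⟩
    have : ((t + 1 : ℕ) : ℕ∞) ≤ π.stopTime x := by
      refine le_iInf₂ fun j hj => ?_
      have : t < j := by
        by_contra hc
        rcases (not_lt.1 hc).lt_or_eq with h | rfl
        · exact h1 j h hj
        · exact h2 hj
      exact_mod_cast this
    exact lt_of_lt_of_le (by exact_mod_cast Nat.lt_succ_self t) this

theorem stopTime_eq_iff (t : ℕ) (x : π.Seed × (ℕ → Round K)) :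
    π.stopTime x = t ↔ π.info t x ∈ π.notStopped t ∧ π.info t x ∈ π.halts t := by
  constructor
  · intro h
    have h1 : π.info t x ∈ π.notStopped t := by
      rw [info_mem_notStopped_iff]
      intro j hj hmem
      have h1 : π.stopTime x ≤ (j : ℕ∞) := iInf₂_le (f := fun (t : ℕ) _ => (t : ℕ∞)) j hmem
      rw [h] at h1
      exact absurd (by exact_mod_cast h1) (not_le.2 hj)
    refine ⟨h1, ?_⟩
    by_contra h2
    have := (π.lt_stopTime_iff t x).2 ⟨h1, h2⟩
    rw [h] at this
    exact lt_irrefl _ this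
  · rintro ⟨h1, h2⟩
    refine le_antisymm (iInf₂_le (f := fun (t : ℕ) _ => (t : ℕ∞)) t h2) ?_
    rw [info_mem_notStopped_iff] at h1
    refine le_iInf₂ fun j hj => ?_
    by_contra hc
    exact h1 j (by exact_mod_cast not_le.1 hc) hj

/-- The event that arm `i` is pulled in round `t`. -/
def pulls (t : ℕ) (i : Fin K) : Set (π.Seed × History K t) :=
  (π.notStopped t ∩ (π.halts t)ᶜ) ∩ π.sample t ⁻¹' {i}

theorem measurableSet_pulls (t : ℕ) (i : Fin K) : MeasurableSet (π.pulls t i) :=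
  ((π.measurableSet_notStopped t).inter (π.measurableSet_halts t).compl).inter
    (π.measurable_sample t (measurableSet_singleton i))

/-- The event that the procedure stops at time `t` and returns arm `i`. -/
def returns (t : ℕ) (i : Fin K) : Set (π.Seed × History K t) :=
  (π.notStopped t ∩ π.halts t) ∩ π.recommend t ⁻¹' {i}

theorem measurableSet_returns (t : ℕ) (i : Fin K) : MeasurableSet (π.returns t i) :=
  ((π.measurableSet_notStopped t).inter (π.measurableSet_halts t)).inter
    (π.measurable_recommend t (measurableSet_singleton i))

/-- The procedure stops before time `n` and returns arm `i`. -/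
def returnsBefore (n : ℕ) (i : Fin K) : Set (π.Seed × (ℕ → Round K)) :=
  ⋃ t ∈ Finset.range n, π.info t ⁻¹' π.returns t i

theorem measurableSet_returnsBefore (n : ℕ) (i : Fin K) : MeasurableSet (π.returnsBefore n i) :=
  Finset.measurableSet_biUnion _ fun t _ => π.measurable_info t (π.measurableSet_returns t i)

theorem stopTime_of_mem_returns {t : ℕ} {i : Fin K} {x : π.Seed × (ℕ → Round K)}
    (h : π.info t x ∈ π.returns t i) : π.stopTime x = t :=
  (π.stopTime_eq_iff t x).2 h.1

/-- The log-likelihood ratio of the observations in the first `n` rounds, up to stopping. -/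
noncomputable def logLikelihood (ℓ : Fin K → ℝ → ℝ) (n : ℕ) (x : π.Seed × (ℕ → Round K)) : ℝ :=
  ∑ t ∈ Finset.range n, ∑ i, (π.pulls t i).indicator (fun _ => (1 : ℝ)) (π.info t x) * ℓ i (observed (x.2 t) i)

theorem sum_pulls_of_lt {ℓ : Fin K → ℝ} {t : ℕ} {h : π.Seed × History K t}
    (h1 : h ∈ π.notStopped t) (h2 : h ∉ π.halts t) :
    ∑ i, (π.pulls t i).indicator (fun _ => (1 : ℝ)) h * ℓ i = ℓ (π.sample t h) := by
  rw [Finset.sum_eq_single (π.sample t h)]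
  · have hm : h ∈ π.pulls t (π.sample t h) := ⟨⟨h1, h2⟩, rfl⟩
    rw [Set.indicator_of_mem hm]; simp
  · intro i _ hi
    rw [Set.indicator_of_notMem (fun hm => hi hm.2.symm)]; simp
  · simp

/-- Histories continue formally after stopping, so `likelihood` keeps changing while `logLikelihood`
is frozen. The two agree as long as the procedure runs. -/
theorem ofReal_exp_neg_logLikelihood (ℓ : Fin K → ℝ → ℝ) (n : ℕ) (x : π.Seed × (ℕ → Round K))
    (h : π.info n x ∈ π.notStopped n) :
    ENNReal.ofReal (Real.exp (-π.logLikelihood ℓ n x)) = π.likelihood ℓ n (π.info n x) := by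
  induction n with
  | zero => simp [logLikelihood, likelihood]
  | succ n ih =>
    rw [info_mem_notStopped_iff] at h
    have h1 : π.info n x ∈ π.notStopped n :=
      (π.info_mem_notStopped_iff n x).2 fun j hj => h j (by omega)
    rw [logLikelihood, Finset.sum_range_succ, ← logLikelihood,
      π.sum_pulls_of_lt (ℓ := fun i => ℓ i (observed (x.2 n) i)) h1 (h n (by omega)), neg_add,
      Real.exp_add, ENNReal.ofReal_mul (Real.exp_pos _).le, ih h1, info_succ, likelihood_extend]

theorem logLikelihood_of_stopped (ℓ : Fin K → ℝ → ℝ) {t n : ℕ} (htn : t ≤ n)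
    (x : π.Seed × (ℕ → Round K)) (h : π.info t x ∈ π.halts t) :
    π.logLikelihood ℓ n x = π.logLikelihood ℓ t x := by
  rw [logLikelihood, logLikelihood]
  symm
  refine Finset.sum_subset (by simpa using htn) fun j _ hj => ?_
  refine Finset.sum_eq_zero fun i _ => ?_
  rw [Set.indicator_of_notMem, zero_mul]
  rintro ⟨⟨h1, h2⟩, -⟩
  rw [info_mem_notStopped_iff] at h1
  rcases (not_lt.1 (by simpa using hj) : t ≤ j).lt_or_eq with h3 | rfl
  · exact h1 t h3 h
  · exact h2 h

theorem measurable_logLikelihood {ℓ : Fin K → ℝ → ℝ} (hℓ : ∀ i, Measurable (ℓ i)) (n : ℕ) :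
    Measurable (π.logLikelihood ℓ n) := by
  refine Finset.measurable_sum _ fun t _ => Finset.measurable_sum _ fun i _ => ?_
  refine ((measurable_const.indicator (π.measurableSet_pulls t i)).comp (π.measurable_info t)).mul ?_
  exact (hℓ i).comp ((measurable_observed i).comp ((measurable_pi_apply t).comp measurable_snd))

section Law

variable (ε : unitInterval) (P P' : Fin K → ProbabilityMeasure ℝ)
  (Q Q' : Fin K → ℕ → ProbabilityMeasure ℝ)

/-- The expected number of pulls of arm `i`. -/
noncomputable def expectedPulls (i : Fin K) : ENNReal :=
  ∑' t : ℕ, π.law ε P Q (π.info t ⁻¹' π.pulls t i)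

/-- Exactly one arm is pulled in every round `t < τ`, and none afterwards. -/
theorem expectedTime_eq_sum : π.expectedTime ε P Q = ∑ i, π.expectedPulls ε P Q i := by
  have hs (t : ℕ) (x : π.Seed × (ℕ → Round K)) :
      (if (t : ℕ∞) < π.stopTime x then (1 : ENNReal) else 0) =
        ∑ i, (π.info t ⁻¹' π.pulls t i).indicator 1 x := by
    by_cases h : (t : ℕ∞) < π.stopTime x
    · rw [if_pos h, Finset.sum_eq_single (π.sample t (π.info t x))]
      · rw [Set.indicator_of_mem]
        · rfl
        · exact ⟨(π.lt_stopTime_iff t x).1 h, rfl⟩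
      · intro i _ hi
        exact Set.indicator_of_notMem (fun hm => hi hm.2.symm) _
      · simp
    · rw [if_neg h, Finset.sum_eq_zero]
      intro i _
      exact Set.indicator_of_notMem (fun hm => h ((π.lt_stopTime_iff t x).2 hm.1)) _
  have hm (t : ℕ) (i : Fin K) : MeasurableSet (π.info t ⁻¹' π.pulls t i) :=
    π.measurable_info t (π.measurableSet_pulls t i)
  have hm' (t : ℕ) (i : Fin K) : Measurable ((π.info t ⁻¹' π.pulls t i).indicator
      (1 : π.Seed × (ℕ → Round K) → ENNReal)) := measurable_one.indicator (hm t i)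
  simp_rw [expectedTime, enat_eq_tsum_indicator, hs]
  rw [lintegral_tsum fun t => (Finset.measurable_sum _ fun i _ => hm' t i).aemeasurable]
  simp_rw [lintegral_finsetSum _ fun i _ => hm' _ i, lintegral_indicator_one (hm _ _)]
  rw [Summable.tsum_finsetSum fun _ _ => ENNReal.summable]
  rfl

theorem ae_stopTime_ne_top (h : π.expectedTime ε P Q ≠ ⊤) :
    ∀ᵐ x ∂(π.law ε P Q), π.stopTime x ≠ ⊤ := by
  have hm : Measurable fun x : π.Seed × (ℕ → Round K) => (π.stopTime x : ENNReal) := by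
    simp_rw [enat_eq_tsum_indicator]
    refine Measurable.tsum fun t => Measurable.ite ?_ measurable_const measurable_const
    convert! π.measurable_info t
      ((π.measurableSet_notStopped t).inter (π.measurableSet_halts t).compl) using 1
    exact Set.ext fun x => π.lt_stopTime_iff t x
  filter_upwards [ae_lt_top hm h] with x hx hc
  simp [hc] at hx

theorem sum_measure_stop_add (n : ℕ) :
    ∑ t ∈ Finset.range n, π.law ε P Q (π.info t ⁻¹' (π.notStopped t ∩ π.halts t)) +
      π.law ε P Q (π.info n ⁻¹' π.notStopped n) = 1 := by
  induction n with
  | zero =>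
    have : π.info 0 ⁻¹' π.notStopped 0 = Set.univ := rfl
    simp [this]
  | succ n ih =>
    have h1 : π.info (n + 1) ⁻¹' π.notStopped (n + 1) =
        (π.info n ⁻¹' π.notStopped n) \ (π.info n ⁻¹' π.halts n) :=
      Set.ext fun x => π.info_succ_mem_notStopped_iff n x
    rw [Finset.sum_range_succ, add_assoc, h1, Set.preimage_inter,
      measure_inter_add_sdiff _ (π.measurable_info n (π.measurableSet_halts n)), ih]

variable {P P' Q Q'} {ℓ : Fin K → ℝ → ℝ}

theorem lintegral_likelihood_indicator_le (hℓ : ∀ i, Measurable (ℓ i))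
    (hle : ∀ i t, (contaminated ε (P i) (Q i t)).withDensity
      (fun x => ENNReal.ofReal (Real.exp (-ℓ i x))) ≤ contaminated ε (P' i) (Q' i t))
    (t : ℕ) {s : Set (π.Seed × History K t)} (hs : MeasurableSet s) :
    ∫⁻ x, π.likelihood ℓ t (π.info t x) * s.indicator 1 (π.info t x) ∂(π.law ε P Q) ≤
      π.law ε P' Q' (π.info t ⁻¹' s) := by
  refine (π.lintegral_likelihood_mul_le ε P P' Q Q' hℓ hle t (measurable_one.indicator hs)).trans ?_
  rw [← lintegral_indicator_one (π.measurable_info t hs)]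
  exact le_rfl

/-- The space is split according to the value of `τ` before `n`, with one more piece for `τ ≥ n`. On
each piece the stopped likelihood ratio is one at a fixed round, where the change of measure
applies; the masses of the pieces under the alternative add up to one. -/
theorem lintegral_exp_neg_logLikelihood_le (hℓ : ∀ i, Measurable (ℓ i))
    (hle : ∀ i t, (contaminated ε (P i) (Q i t)).withDensity
      (fun x => ENNReal.ofReal (Real.exp (-ℓ i x))) ≤ contaminated ε (P' i) (Q' i t))
    (n : ℕ) :
    ∫⁻ x, ENNReal.ofReal (Real.exp (-π.logLikelihood ℓ n x)) ∂(π.law ε P Q) ≤ 1 := by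
  have hms (t : ℕ) : MeasurableSet (π.notStopped t ∩ π.halts t) :=
    (π.measurableSet_notStopped t).inter (π.measurableSet_halts t)
  have hb : ∀ x, ENNReal.ofReal (Real.exp (-π.logLikelihood ℓ n x)) ≤
      ∑ t ∈ Finset.range n, π.likelihood ℓ t (π.info t x) *
          (π.notStopped t ∩ π.halts t).indicator 1 (π.info t x) +
        π.likelihood ℓ n (π.info n x) * (π.notStopped n).indicator 1 (π.info n x) := by
    intro x
    by_cases h : π.info n x ∈ π.notStopped n
    · rw [π.ofReal_exp_neg_logLikelihood ℓ n x h, Set.indicator_of_mem h]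
      simp
    · have h0 : ∃ j < n, π.info j x ∈ π.halts j := by
        by_contra hc
        push Not at hc
        exact h ((π.info_mem_notStopped_iff n x).2 hc)
      classical
      let t := Nat.find h0
      have ht := Nat.find_spec h0
      have h1 : π.info t x ∈ π.notStopped t := (π.info_mem_notStopped_iff t x).2 fun j hj hmem =>
        Nat.find_min h0 hj ⟨hj.trans ht.1, hmem⟩
      rw [π.logLikelihood_of_stopped ℓ ht.1.le x ht.2, π.ofReal_exp_neg_logLikelihood ℓ t x h1]
      refine le_trans ?_ le_self_add
      refine le_trans ?_ (Finset.single_le_sum (fun _ _ => zero_le) (Finset.mem_range.2 ht.1))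
      have hm : π.info t x ∈ π.notStopped t ∩ π.halts t := ⟨h1, ht.2⟩
      change _ ≤ π.likelihood ℓ t (π.info t x) *
        (π.notStopped t ∩ π.halts t).indicator 1 (π.info t x)
      rw [Set.indicator_of_mem hm]
      simp
  have hL (t : ℕ) : Measurable fun x => π.likelihood ℓ t (π.info t x) :=
    (π.measurable_likelihood hℓ t).comp (π.measurable_info t)
  have hI (t : ℕ) {s : Set (π.Seed × History K t)} (hs : MeasurableSet s) :
      Measurable fun x => π.likelihood ℓ t (π.info t x) * s.indicator 1 (π.info t x) :=
    (hL t).mul ((measurable_one.indicator hs).comp (π.measurable_info t))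
  have hle' (t : ℕ) {s : Set (π.Seed × History K t)} (hs : MeasurableSet s) :=
    π.lintegral_likelihood_indicator_le ε hℓ hle t hs
  calc ∫⁻ x, ENNReal.ofReal (Real.exp (-π.logLikelihood ℓ n x)) ∂(π.law ε P Q)
      ≤ ∑ t ∈ Finset.range n, π.law ε P' Q' (π.info t ⁻¹' (π.notStopped t ∩ π.halts t)) +
          π.law ε P' Q' (π.info n ⁻¹' π.notStopped n) := by
        refine (lintegral_mono hb).trans ?_
        rw [lintegral_add_right _ (hI n (π.measurableSet_notStopped n)),
          lintegral_finsetSum _ fun t _ => hI t (hms t)]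
        exact add_le_add (Finset.sum_le_sum fun t _ => hle' t (hms t))
          (hle' n (π.measurableSet_notStopped n))
    _ = 1 := π.sum_measure_stop_add ε P' Q' n

theorem lintegral_exp_neg_logLikelihood_returnsBefore_le (hℓ : ∀ i, Measurable (ℓ i))
    (hle : ∀ i t, (contaminated ε (P i) (Q i t)).withDensity
      (fun x => ENNReal.ofReal (Real.exp (-ℓ i x))) ≤ contaminated ε (P' i) (Q' i t))
    (n : ℕ) (a : Fin K) :
    ∫⁻ x, ENNReal.ofReal (Real.exp (-π.logLikelihood ℓ n x)) *
      (π.returnsBefore n a).indicator 1 x ∂(π.law ε P Q) ≤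
        π.law ε P' Q' (π.returnsBefore n a) := by
  have hb : ∀ x, ENNReal.ofReal (Real.exp (-π.logLikelihood ℓ n x)) *
      (π.returnsBefore n a).indicator 1 x ≤
      ∑ t ∈ Finset.range n, π.likelihood ℓ t (π.info t x) *
          (π.returns t a).indicator 1 (π.info t x) := by
    intro x
    by_cases h : x ∈ π.returnsBefore n a
    · obtain ⟨t, ht, hx⟩ := Set.mem_iUnion₂.1 h
      have ht' : t < n := Finset.mem_range.1 ht
      have hx' : π.info t x ∈ π.returns t a := hx
      rw [π.logLikelihood_of_stopped ℓ ht'.le x hx'.1.2,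
        π.ofReal_exp_neg_logLikelihood ℓ t x hx'.1.1, Set.indicator_of_mem h]
      refine le_trans ?_ (Finset.single_le_sum (fun _ _ => zero_le) ht)
      rw [Set.indicator_of_mem hx']
      simp
    · rw [Set.indicator_of_notMem h]
      simp
  have hI (t : ℕ) : Measurable fun x => π.likelihood ℓ t (π.info t x) *
      (π.returns t a).indicator 1 (π.info t x) :=
    ((π.measurable_likelihood hℓ t).comp (π.measurable_info t)).mul
      ((measurable_one.indicator (π.measurableSet_returns t a)).comp (π.measurable_info t))
  refine (lintegral_mono hb).trans ?_
  rw [lintegral_finsetSum _ fun t _ => hI t, returnsBefore, measure_biUnion_finset]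
  · exact Finset.sum_le_sum fun t _ =>
      π.lintegral_likelihood_indicator_le ε hℓ hle t (π.measurableSet_returns t a)
  · intro s _ t _ hst
    refine Set.disjoint_left.2 fun x hs ht => hst ?_
    have h1 := π.stopTime_of_mem_returns hs
    have h2 := π.stopTime_of_mem_returns ht
    exact_mod_cast h1.symm.trans h2
  · exact fun t _ => π.measurable_info t (π.measurableSet_returns t a)

/-- This is the summand of Wald's identity: whether arm `i` is pulled in round `t` is decided by
earlier information, which is independent of round `t`. -/
theorem integrable_logLikelihood_term (hℓ : ∀ i, Measurable (ℓ i))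
    (hint : ∀ i t, Integrable (ℓ i) (contaminated ε (P i) (Q i t))) (t : ℕ) (i : Fin K) :
    Integrable (fun x => (π.pulls t i).indicator (fun _ => (1 : ℝ)) (π.info t x) *
        ℓ i (observed (x.2 t) i)) (π.law ε P Q) ∧
      ∫ x, (π.pulls t i).indicator (fun _ => (1 : ℝ)) (π.info t x) * ℓ i (observed (x.2 t) i)
        ∂(π.law ε P Q) =
      (π.law ε P Q).real (π.info t ⁻¹' π.pulls t i) * ∫ y, ℓ i y ∂(contaminated ε (P i) (Q i t)) := by
  have hφ : Measurable ((π.pulls t i).indicator fun _ => (1 : ℝ)) :=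
    measurable_const.indicator (π.measurableSet_pulls t i)
  have hψ : Measurable fun r : Round K => ℓ i (observed r i) := (hℓ i).comp (measurable_observed i)
  have h2 : Measurable fun x : π.Seed × (ℕ → Round K) => x.2 t :=
    (measurable_pi_apply t).comp measurable_snd
  have hind : IndepFun (fun x => (π.pulls t i).indicator (fun _ => (1 : ℝ)) (π.info t x))
      (fun x => ℓ i (observed (x.2 t) i)) (π.law ε P Q) := (π.indepFun_info ε P Q t).comp hφ hψ
  have hmap : (π.law ε P Q).map (fun x => observed (x.2 t) i) = contaminated ε (P i) (Q i t) := by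
    rw [← map_observed ε P Q t i, ← π.map_round ε P Q t, Measure.map_map (measurable_observed i) h2]
    rfl
  have ho : Measurable fun x : π.Seed × (ℕ → Round K) => observed (x.2 t) i :=
    (measurable_observed i).comp h2
  have hi1 : Integrable (fun x => (π.pulls t i).indicator (fun _ => (1 : ℝ)) (π.info t x))
      (π.law ε P Q) := by
    have : (fun x => (π.pulls t i).indicator (fun _ => (1 : ℝ)) (π.info t x)) =
        (π.info t ⁻¹' π.pulls t i).indicator fun _ => (1 : ℝ) := rfl
    rw [this]
    exact (integrable_const 1).indicator (π.measurable_info t (π.measurableSet_pulls t i))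
  have hi2 : Integrable (fun x => ℓ i (observed (x.2 t) i)) (π.law ε P Q) := by
    have := hint i t
    rw [← hmap] at this
    exact (integrable_map_measure (hℓ i).aestronglyMeasurable ho.aemeasurable).1 this
  refine ⟨hind.integrable_mul hi1 hi2, ?_⟩
  rw [hind.integral_fun_mul_eq_mul_integral hi1.aestronglyMeasurable hi2.aestronglyMeasurable]
  congr 1
  · have : (fun x => (π.pulls t i).indicator (fun _ => (1 : ℝ)) (π.info t x)) =
        (π.info t ⁻¹' π.pulls t i).indicator 1 := rfl
    rw [this, integral_indicator_one (π.measurable_info t (π.measurableSet_pulls t i))]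
  · rw [← hmap, integral_map ho.aemeasurable (hℓ i).aestronglyMeasurable]

/-- The information that is needed to tell two environments apart, before a fixed round. -/
theorem mul_measure_returnsBefore_sub_one_le {k : Fin K → ℝ} (hℓ : ∀ i, Measurable (ℓ i))
    (hint : ∀ i t, Integrable (ℓ i) (contaminated ε (P i) (Q i t)))
    (hk : ∀ i t, ∫ x, ℓ i x ∂(contaminated ε (P i) (Q i t)) ≤ k i)
    (hle : ∀ i t, (contaminated ε (P i) (Q i t)).withDensity
      (fun x => ENNReal.ofReal (Real.exp (-ℓ i x))) ≤ contaminated ε (P' i) (Q' i t))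
    {δ : ℝ} (hδ : 0 < δ) (a : Fin K) (n : ℕ)
    (ha : π.law ε P' Q' (π.returnsBefore n a) ≤ ENNReal.ofReal δ) :
    Real.log (1 / δ) * (π.law ε P Q).real (π.returnsBefore n a) - 1 ≤
      ∑ i, (∑ t ∈ Finset.range n, (π.law ε P Q).real (π.info t ⁻¹' π.pulls t i)) * k i := by
  set μ := π.law ε P Q
  set A := π.returnsBefore n a
  have hA : MeasurableSet A := π.measurableSet_returnsBefore n a
  set L := π.logLikelihood ℓ n
  have hLm : Measurable L := π.measurable_logLikelihood hℓ n
  have hterm := π.integrable_logLikelihood_term ε hℓ hint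
  have hLi : Integrable L μ :=
    integrable_finsetSum _ fun t _ => integrable_finsetSum _ fun i _ => (hterm t i).1
  have hLk : ∫ x, L x ∂μ ≤ ∑ i, (∑ t ∈ Finset.range n, μ.real (π.info t ⁻¹' π.pulls t i)) * k i := by
    have : ∫ x, L x ∂μ = ∑ t ∈ Finset.range n, ∑ i, μ.real (π.info t ⁻¹' π.pulls t i) *
        ∫ y, ℓ i y ∂(contaminated ε (P i) (Q i t)) := by
      simp only [L, logLikelihood]
      rw [integral_finsetSum _ fun t _ => integrable_finsetSum _ fun i _ => (hterm t i).1]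
      refine Finset.sum_congr rfl fun t _ => ?_
      rw [integral_finsetSum _ fun i _ => (hterm t i).1]
      exact Finset.sum_congr rfl fun i _ => (hterm t i).2
    rw [this, Finset.sum_comm]
    refine Finset.sum_le_sum fun i _ => ?_
    rw [Finset.sum_mul]
    exact Finset.sum_le_sum fun t _ => mul_le_mul_of_nonneg_left (hk i t) measureReal_nonneg
  set lam := Real.log (1 / δ)
  have hlam : Real.exp lam = 1 / δ := Real.exp_log (by positivity)
  -- A variational bound: `exp f` has mean at most 2, because its part on `A` contributes at most
  -- `(1/δ) · δ` after the change of measure and the rest at most 1. Then `f ≤ exp f - 1` bounds the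
  -- mean of `f` by 1.
  set f : π.Seed × (ℕ → Round K) → ℝ := fun x => lam * A.indicator (fun _ => (1 : ℝ)) x - L x
  have hAi : Integrable (A.indicator fun _ => (1 : ℝ)) μ := (integrable_const 1).indicator hA
  have hfi : Integrable f μ := (hAi.const_mul lam).sub hLi
  have hfint : ∫ x, f x ∂μ = lam * μ.real A - ∫ x, L x ∂μ := by
    rw [integral_sub (hAi.const_mul lam) hLi, integral_const_mul]
    congr 2
    exact integral_indicator_one hA
  have hexp : ∫⁻ x, ENNReal.ofReal (Real.exp (f x)) ∂μ ≤ 2 := by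
    have hpt : ∀ x, ENNReal.ofReal (Real.exp (f x)) ≤
        ENNReal.ofReal (1 / δ) * (ENNReal.ofReal (Real.exp (-L x)) * A.indicator 1 x) +
          ENNReal.ofReal (Real.exp (-L x)) := by
      intro x
      by_cases hx : x ∈ A
      · refine le_trans (le_of_eq ?_) le_self_add
        simp only [f, Set.indicator_of_mem hx, mul_one, Pi.one_apply]
        rw [sub_eq_add_neg, Real.exp_add, hlam, ENNReal.ofReal_mul (by positivity)]
      · refine le_trans (le_of_eq ?_) le_add_self
        simp [f, Set.indicator_of_notMem hx]
    have hm1 : Measurable fun x => ENNReal.ofReal (Real.exp (-L x)) := by fun_prop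
    have hm2 : Measurable fun x => ENNReal.ofReal (Real.exp (-L x)) * A.indicator 1 x :=
      hm1.mul (measurable_one.indicator hA)
    refine (lintegral_mono hpt).trans ?_
    rw [lintegral_add_right _ hm1, lintegral_const_mul _ hm2]
    have h1 := (π.lintegral_exp_neg_logLikelihood_returnsBefore_le ε hℓ hle n a).trans ha
    have h2 := π.lintegral_exp_neg_logLikelihood_le ε hℓ hle n
    calc _ ≤ ENNReal.ofReal (1 / δ) * ENNReal.ofReal δ + 1 := by gcongr
      _ = 2 := by
        rw [← ENNReal.ofReal_mul (by positivity), one_div_mul_cancel hδ.ne', ENNReal.ofReal_one,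
          one_add_one_eq_two]
  have hfm : Measurable f := (measurable_const.mul (measurable_const.indicator hA)).sub hLm
  have hei : Integrable (fun x => Real.exp (f x)) μ := by
    refine ⟨by fun_prop, ?_⟩
    rw [hasFiniteIntegral_iff_ofReal (Eventually.of_forall fun x => (Real.exp_pos _).le)]
    exact hexp.trans_lt (by simp)
  have hei2 : ∫ x, Real.exp (f x) ∂μ ≤ 2 := by
    rw [integral_eq_lintegral_of_nonneg_ae (Eventually.of_forall fun x => (Real.exp_pos _).le)
      (by fun_prop)]
    exact ENNReal.toReal_le_of_le_ofReal (by norm_num) (by simpa using hexp)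
  have hfin : ∫ x, f x ∂μ ≤ 1 := by
    have h1 : ∫ x, f x ∂μ ≤ ∫ x, (Real.exp (f x) - 1) ∂μ :=
      integral_mono hfi (hei.sub (integrable_const 1)) fun x => by
        have := Real.add_one_le_exp (f x)
        simp only; linarith
    rw [integral_sub hei (integrable_const 1)] at h1
    simp only [integral_const, probReal_univ, smul_eq_mul, mul_one] at h1
    linarith
  linarith

/-- The information that is needed to tell two environments apart: if arm `a` is the only right
answer in the first environment, and a wrong one in the second, then the observations of a
`δ`-correct procedure carry information of order `log (1 / δ)`. -/
theorem information_le {U : ℝ} {k : Fin K → ℝ}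
    (hKL : ∀ i, ∃ ℓ : ℝ → ℝ, Measurable ℓ ∧ ∀ t,
      Integrable ℓ (contaminated ε (P i) (Q i t)) ∧
      ∫ x, ℓ x ∂(contaminated ε (P i) (Q i t)) ≤ k i ∧
      (contaminated ε (P i) (Q i t)).withDensity (fun x => ENNReal.ofReal (Real.exp (-ℓ x))) ≤
        contaminated ε (P' i) (Q' i t))
    {δ : ℝ} (hδ : 0 < δ) (hδ1 : δ < 1) {a : Fin K}
    (hbase : π.law ε P Q (π.errorEvent U P) ≤ ENNReal.ofReal δ)
    (halt : π.law ε P' Q' (π.errorEvent U P') ≤ ENNReal.ofReal δ)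
    (ha : ∀ i, i ≠ a → ∃ j, mean (P i) + U < mean (P j) - U)
    (ha' : ∃ j, mean (P' a) + U < mean (P' j) - U)
    (hT : π.expectedTime ε P Q ≠ ⊤) :
    (1 - δ) * Real.log (1 / δ) - 1 ≤ ∑ i, (π.expectedPulls ε P Q i).toReal * k i := by
  choose ℓ hℓ h using hKL
  set μ := π.law ε P Q
  have hfin : ∀ i, π.expectedPulls ε P Q i ≠ ⊤ := by
    rw [expectedTime_eq_sum] at hT
    exact fun i => (ENNReal.sum_ne_top.1 hT) i (Finset.mem_univ i)
  have hbd : ∀ n, Real.log (1 / δ) * μ.real (π.returnsBefore n a) - 1 ≤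
      ∑ i, (∑ t ∈ Finset.range n, μ.real (π.info t ⁻¹' π.pulls t i)) * k i := by
    intro n
    refine π.mul_measure_returnsBefore_sub_one_le ε hℓ (fun i t => (h i t).1)
      (fun i t => (h i t).2.1) (fun i t => (h i t).2.2) hδ a n ((measure_mono ?_).trans halt)
    intro x hx
    obtain ⟨t, -, hx⟩ := Set.mem_iUnion₂.1 hx
    refine ⟨t, π.stopTime_of_mem_returns hx, ?_⟩
    have h1 : π.recommend t (π.info t x) = a := hx.2
    change ∃ j, mean (P' (π.recommend t (π.info t x))) + U < mean (P' j) - U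
    rwa [h1]
  have hlim1 : Tendsto (fun n => μ.real (π.returnsBefore n a)) atTop
      (𝓝 (μ.real (⋃ n, π.returnsBefore n a))) := by
    have hmono : Monotone fun n => π.returnsBefore n a := fun m n hmn =>
      Set.biUnion_subset_biUnion_left fun t ht =>
        Finset.mem_coe.2 (Finset.range_mono hmn (Finset.mem_coe.1 ht))
    exact (ENNReal.tendsto_toReal (measure_ne_top _ _)).comp (tendsto_measure_iUnion_atTop hmono)
  have hlim2 : ∀ i, Tendsto (fun n => ∑ t ∈ Finset.range n, μ.real (π.info t ⁻¹' π.pulls t i)) atTop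
      (𝓝 (π.expectedPulls ε P Q i).toReal) := by
    intro i
    have h1 := (ENNReal.tendsto_toReal (hfin i)).comp
      (ENNReal.tendsto_nat_tsum fun t => μ (π.info t ⁻¹' π.pulls t i))
    refine h1.congr fun n => ?_
    simp only [Function.comp]
    rw [ENNReal.toReal_sum fun _ _ => measure_ne_top _ _]
    rfl
  have hfinal := le_of_tendsto_of_tendsto' ((hlim1.const_mul (Real.log (1 / δ))).sub_const 1)
    (tendsto_finsetSum _ fun i _ => (hlim2 i).mul_const (k i)) hbd
  refine le_trans ?_ hfinal
  have hlog : 0 ≤ Real.log (1 / δ) := Real.log_nonneg (by rw [le_div_iff₀ hδ]; linarith)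
  have hprob : 1 - δ ≤ μ.real (⋃ n, π.returnsBefore n a) := by
    have hsub : ∀ᵐ x ∂μ, x ∈ (π.errorEvent U P) ∪ (⋃ n, π.returnsBefore n a) := by
      filter_upwards [π.ae_stopTime_ne_top ε P Q hT] with x hx
      obtain ⟨t, ht⟩ := ENat.ne_top_iff_exists.1 hx
      have h1 := (π.stopTime_eq_iff t x).1 ht.symm
      by_cases hr : π.recommend t (π.info t x) = a
      -- A stop at time `t` counts as a stop before `t + 1`.
      · exact Or.inr (Set.mem_iUnion.2 ⟨t + 1, Set.mem_iUnion₂.2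
          ⟨t, Finset.mem_range.2 (Nat.lt_succ_self t), h1, hr⟩⟩)
      · exact Or.inl ⟨t, ht.symm, ha _ hr⟩
    have h1 : (1 : ENNReal) ≤ ENNReal.ofReal δ + μ (⋃ n, π.returnsBefore n a) := by
      calc (1 : ENNReal) = μ Set.univ := measure_univ.symm
        _ ≤ μ ((π.errorEvent U P) ∪ (⋃ n, π.returnsBefore n a)) :=
          measure_mono_ae (hsub.mono fun x hx _ => hx)
        _ ≤ _ := (measure_union_le _ _).trans (by gcongr)
    have h2 := ENNReal.toReal_mono (by finiteness) h1
    rw [ENNReal.toReal_add (by finiteness) (by finiteness), ENNReal.toReal_ofReal hδ.le] at h2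
    simp only [ENNReal.toReal_one] at h2
    simp only [Measure.real]
    linarith
  nlinarith

end Law

end Procedure

/-! ### Mixtures, affine images and Gaussian smoothings of sub-Gaussian laws. -/

section Laws

/-- The normal law as a `ProbabilityMeasure`. -/
noncomputable def gauss (m : ℝ) (v : ℝ≥0) : ProbabilityMeasure ℝ :=
  ⟨gaussianReal m v, inferInstance⟩

/-- The point mass as a `ProbabilityMeasure`. -/
noncomputable def point (x : ℝ) : ProbabilityMeasure ℝ := ⟨Measure.dirac x, inferInstance⟩

/-- The mixture `(1 - p) P + p Q` as a `ProbabilityMeasure`. -/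
noncomputable def mixture (p : unitInterval) (P Q : ProbabilityMeasure ℝ) : ProbabilityMeasure ℝ :=
  ⟨contaminated p P Q, inferInstance⟩

/-- The law of `r X + G` with `X ∼ P` and an independent normal variable `G`. -/
noncomputable def smooth (r m : ℝ) (v : ℝ≥0) (P : ProbabilityMeasure ℝ) : ProbabilityMeasure ℝ :=
  ⟨((P : Measure ℝ).map fun x => r * x) ∗ gaussianReal m v, by
    have : IsProbabilityMeasure ((P : Measure ℝ).map fun x => r * x) :=
      Measure.isProbabilityMeasure_map (by fun_prop)
    infer_instance⟩

/-- The law of `σ X + m` with `X ∼ P`. -/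
noncomputable def affine (σ m : ℝ) (P : ProbabilityMeasure ℝ) : ProbabilityMeasure ℝ :=
  ⟨(P : Measure ℝ).map fun x => σ * x + m, Measure.isProbabilityMeasure_map (by fun_prop)⟩

theorem integral_contaminated {ε : unitInterval} {P Q : ProbabilityMeasure ℝ} {f : ℝ → ℝ}
    (hP : Integrable f (P : Measure ℝ)) (hQ : Integrable f (Q : Measure ℝ)) :
    ∫ x, f x ∂(contaminated ε P Q) =
      (1 - ε) * ∫ x, f x ∂(P : Measure ℝ) + ε * ∫ x, f x ∂(Q : Measure ℝ) := by
  rw [contaminated, integral_add_measure (hP.smul_measure ENNReal.ofReal_ne_top)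
    (hQ.smul_measure ENNReal.ofReal_ne_top), integral_smul_measure, integral_smul_measure,
    ENNReal.toReal_ofReal (sub_nonneg.2 ε.2.2), ENNReal.toReal_ofReal ε.2.1, smul_eq_mul,
    smul_eq_mul]

theorem integrable_contaminated {ε : unitInterval} {P Q : ProbabilityMeasure ℝ} {f : ℝ → ℝ}
    (hP : Integrable f (P : Measure ℝ)) (hQ : Integrable f (Q : Measure ℝ)) :
    Integrable f (contaminated ε P Q) :=
  (hP.smul_measure ENNReal.ofReal_ne_top).add_measure (hQ.smul_measure ENNReal.ofReal_ne_top)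

theorem mean_mixture {p : unitInterval} {P Q : ProbabilityMeasure ℝ}
    (hP : Integrable (fun x => x) (P : Measure ℝ)) (hQ : Integrable (fun x => x) (Q : Measure ℝ)) :
    mean (mixture p P Q) = (1 - p) * mean P + p * mean Q :=
  integral_contaminated hP hQ

theorem integrable_id_gauss (m : ℝ) (v : ℝ≥0) : Integrable (fun x => x) (gauss m v : Measure ℝ) :=
  (memLp_id_gaussianReal (μ := m) (v := v) 1).integrable (by norm_num)

theorem integrable_id_point (x : ℝ) : Integrable (fun x => x) (point x : Measure ℝ) :=
  integrable_dirac (by simp)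

@[simp] theorem mean_gauss (m : ℝ) (v : ℝ≥0) : mean (gauss m v) = m :=
  integral_id_gaussianReal

@[simp] theorem mean_point (x : ℝ) : mean (point x) = x :=
  integral_dirac _ x

theorem integral_exp_gauss (m : ℝ) (v : ℝ≥0) (t : ℝ) :
    ∫ x, Real.exp (t * x) ∂(gauss m v : Measure ℝ) = Real.exp (m * t + v * t ^ 2 / 2) :=
  congrFun (mgf_fun_id_gaussianReal (μ := m) (v := v)) t

theorem integrable_exp_gauss (m : ℝ) (v : ℝ≥0) (t : ℝ) :
    Integrable (fun x => Real.exp (t * x)) (gauss m v : Measure ℝ) :=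
  integrable_exp_mul_gaussianReal t

/-- The uncentred form is the one that behaves well under mixtures and convolutions. -/
theorem isSubGaussian_iff {σ : ℝ} {P : ProbabilityMeasure ℝ} :
    IsSubGaussian σ P ↔ ∀ t : ℝ, Integrable (fun x => Real.exp (t * x)) (P : Measure ℝ) ∧
      ∫ x, Real.exp (t * x) ∂(P : Measure ℝ) ≤ Real.exp (t * mean P + σ ^ 2 * t ^ 2 / 2) := by
  have h1 (t x : ℝ) : Real.exp (t * (x - mean P)) = Real.exp (-(t * mean P)) * Real.exp (t * x) := by
    rw [← Real.exp_add]; congr 1; ring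
  have h2 (t x : ℝ) : Real.exp (t * x) = Real.exp (t * mean P) * Real.exp (t * (x - mean P)) := by
    rw [← Real.exp_add]; congr 1; ring
  have hc : ((Real.toNNReal (σ ^ 2) : ℝ≥0) : ℝ) = σ ^ 2 := Real.coe_toNNReal _ (sq_nonneg σ)
  constructor
  · intro h t
    have hi := h.integrable_exp_mul t
    have hm := h.mgf_le t
    rw [mgf, hc] at hm
    refine ⟨?_, ?_⟩
    · rw [funext (h2 t)]
      exact hi.const_mul _
    · rw [integral_congr_ae (Eventually.of_forall (h2 t)), integral_const_mul, Real.exp_add]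
      gcongr
  · intro h
    refine ⟨fun t => ?_, fun t => ?_⟩
    · simp_rw [h1 t]
      exact (h t).1.const_mul _
    · rw [mgf, hc]
      simp_rw [h1 t]
      rw [integral_const_mul]
      calc _ ≤ Real.exp (-(t * mean P)) * Real.exp (t * mean P + σ ^ 2 * t ^ 2 / 2) := by
            gcongr; exact (h t).2
        _ = _ := by rw [← Real.exp_add]; congr 1; ring

theorem IsSubGaussian.integrable_id {σ : ℝ} {P : ProbabilityMeasure ℝ} (h : IsSubGaussian σ P) :
    Integrable (fun x => x) (P : Measure ℝ) := by
  have h1 := (HasSubgaussianMGF.integrable h).add (integrable_const (mean P))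
  exact h1.congr (Eventually.of_forall fun x => by simp)

theorem isSubGaussian_gauss {σ m : ℝ} {v : ℝ≥0} (hv : (v : ℝ) ≤ σ ^ 2) :
    IsSubGaussian σ (gauss m v) := by
  refine isSubGaussian_iff.2 fun t => ⟨integrable_exp_gauss m v t, ?_⟩
  rw [integral_exp_gauss, mean_gauss, mul_comm m t]
  gcongr

theorem isSubGaussian_point (σ x : ℝ) : IsSubGaussian σ (point x) := by
  refine isSubGaussian_iff.2 fun t => ⟨integrable_dirac (by simp), ?_⟩
  rw [mean_point]
  refine (integral_dirac (fun x => Real.exp (t * x)) x).le.trans ?_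
  gcongr
  have := mul_nonneg (sq_nonneg σ) (sq_nonneg t)
  linarith

theorem mean_affine {σ m : ℝ} {P : ProbabilityMeasure ℝ}
    (hP : Integrable (fun x => x) (P : Measure ℝ)) : mean (affine σ m P) = σ * mean P + m := by
  have : mean (affine σ m P) = ∫ x, (σ * x + m) ∂(P : Measure ℝ) :=
    integral_map (by fun_prop) (by fun_prop)
  rw [this, integral_add (hP.const_mul σ) (integrable_const m), integral_const_mul]
  simp [mean]

theorem IsSubGaussian.affine {P : ProbabilityMeasure ℝ} (hP : IsSubGaussian 1 P) (σ m : ℝ) :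
    IsSubGaussian σ (affine σ m P) := by
  refine isSubGaussian_iff.2 fun t => ?_
  obtain ⟨h1, h2⟩ := isSubGaussian_iff.1 hP (t * σ)
  have hf (x : ℝ) : Real.exp (t * (σ * x + m)) = Real.exp (t * m) * Real.exp (t * σ * x) := by
    rw [← Real.exp_add]; congr 1; ring
  refine ⟨(integrable_map_measure (by fun_prop) (by fun_prop)).2 ?_, ?_⟩
  · simp only [Function.comp_def, hf]
    exact h1.const_mul _
  · have : ∫ x, Real.exp (t * x) ∂(CBAI.affine σ m P : Measure ℝ) =
        ∫ x, Real.exp (t * (σ * x + m)) ∂(P : Measure ℝ) :=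
      integral_map (by fun_prop) (by fun_prop)
    rw [this, mean_affine hP.integrable_id]
    simp_rw [hf]
    rw [integral_const_mul]
    calc _ ≤ Real.exp (t * m) * Real.exp (t * σ * mean P + 1 ^ 2 * (t * σ) ^ 2 / 2) := by gcongr
      _ = _ := by rw [← Real.exp_add]; congr 1; ring

theorem contaminated_affine (ε : unitInterval) (σ m : ℝ) (P Q : ProbabilityMeasure ℝ) :
    contaminated ε (affine σ m P) (affine σ m Q) =
      (contaminated ε P Q).map fun x => σ * x + m := by
  simp only [contaminated, affine, ProbabilityMeasure.coe_mk]
  rw [Measure.map_add _ _ (by fun_prop), Measure.map_smul, Measure.map_smul]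

theorem affine_injective {σ : ℝ} (hσ : σ ≠ 0) (m : ℝ) : Function.Injective (affine σ m) := by
  intro P Q h
  have h1 : (P : Measure ℝ).map (fun x => σ * x + m) = (Q : Measure ℝ).map (fun x => σ * x + m) :=
    congrArg (fun R : ProbabilityMeasure ℝ => (R : Measure ℝ)) h
  have h2 : ((P : Measure ℝ).map fun x => σ * x + m).map (fun y => (y - m) / σ) =
      ((Q : Measure ℝ).map fun x => σ * x + m).map fun y => (y - m) / σ := by rw [h1]
  have hid : ((fun y => (y - m) / σ) ∘ fun x => σ * x + m) = id := by
    ext x; simp; field_simp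
  rw [Measure.map_map (by fun_prop) (by fun_prop), Measure.map_map (by fun_prop) (by fun_prop),
    hid, Measure.map_id, Measure.map_id] at h2
  exact Subtype.ext h2

theorem smooth_coe (r m : ℝ) (v : ℝ≥0) (P : ProbabilityMeasure ℝ) :
    (smooth r m v P : Measure ℝ) =
      ((P : Measure ℝ).prod (gaussianReal m v)).map fun x => r * x.1 + x.2 := by
  have h : ((P : Measure ℝ).prod (gaussianReal m v)).map (Prod.map (fun x => r * x) id) =
      ((P : Measure ℝ).map fun x => r * x).prod (gaussianReal m v) := by
    rw [← Measure.map_prod_map _ _ (by fun_prop) measurable_id, Measure.map_id]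
  rw [smooth, ProbabilityMeasure.coe_mk, Measure.conv, ← h, Measure.map_map (by fun_prop)
    (by fun_prop)]
  rfl

theorem integrable_exp_smooth {σ r m : ℝ} {v : ℝ≥0} {P : ProbabilityMeasure ℝ}
    (hP : IsSubGaussian σ P) (t : ℝ) :
    Integrable (fun x => Real.exp (t * x)) (smooth r m v P : Measure ℝ) ∧
      ∫ x, Real.exp (t * x) ∂(smooth r m v P : Measure ℝ) =
        (∫ x, Real.exp (t * r * x) ∂(P : Measure ℝ)) * Real.exp (m * t + v * t ^ 2 / 2) := by
  have hf (x : ℝ × ℝ) : Real.exp (t * (r * x.1 + x.2)) =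
      Real.exp (t * r * x.1) * Real.exp (t * x.2) := by
    rw [← Real.exp_add]; congr 1; ring
  rw [smooth_coe]
  constructor
  · refine (integrable_map_measure (by fun_prop) (by fun_prop)).2 ?_
    simp only [Function.comp_def, hf]
    exact (isSubGaussian_iff.1 hP (t * r)).1.mul_prod (integrable_exp_gauss m v t)
  · rw [integral_map (by fun_prop) (by fun_prop)]
    simp_rw [hf]
    rw [integral_prod_mul (fun x => Real.exp (t * r * x)) fun x => Real.exp (t * x)]
    congr 1
    exact integral_exp_gauss m v t

theorem mean_smooth {r m : ℝ} {v : ℝ≥0} {P : ProbabilityMeasure ℝ}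
    (hP : Integrable (fun x => x) (P : Measure ℝ)) : mean (smooth r m v P) = r * mean P + m := by
  have h1 : Integrable (fun x : ℝ × ℝ => r * x.1) ((P : Measure ℝ).prod (gaussianReal m v)) :=
    (hP.const_mul r).comp_fst _
  have h2 : Integrable (fun x : ℝ × ℝ => x.2) ((P : Measure ℝ).prod (gaussianReal m v)) :=
    (integrable_id_gauss m v).comp_snd _
  rw [mean, smooth_coe, integral_map (by fun_prop) (by fun_prop), integral_add h1 h2,
    integral_fun_fst (fun x => r * x), integral_fun_snd (fun x => x), integral_const_mul,
    integral_id_gaussianReal]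
  simp [mean]

theorem IsSubGaussian.smooth {σ r m : ℝ} {v : ℝ≥0} {P : ProbabilityMeasure ℝ}
    (hP : IsSubGaussian σ P) (hv : r ^ 2 * σ ^ 2 + v ≤ σ ^ 2) : IsSubGaussian σ (smooth r m v P) := by
  refine isSubGaussian_iff.2 fun t => ?_
  obtain ⟨h1, h2⟩ := integrable_exp_smooth (r := r) (m := m) (v := v) hP t
  refine ⟨h1, ?_⟩
  rw [h2, mean_smooth hP.integrable_id]
  calc _ ≤ Real.exp (t * r * mean P + σ ^ 2 * (t * r) ^ 2 / 2) * Real.exp (m * t + v * t ^ 2 / 2) := by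
        gcongr; exact (isSubGaussian_iff.1 hP (t * r)).2
    _ ≤ _ := by
        rw [← Real.exp_add]
        refine Real.exp_le_exp.2 ?_
        nlinarith [mul_le_mul_of_nonneg_right hv (sq_nonneg t)]

/-- Smoothing is linear in the law. Hence pairs with a common contaminated law still have one after
the same smoothing. -/
theorem contaminated_smooth (ε : unitInterval) (r m : ℝ) (v : ℝ≥0) (P Q : ProbabilityMeasure ℝ) :
    contaminated ε (smooth r m v P) (smooth r m v Q) =
      ((contaminated ε P Q).map fun x => r * x) ∗ gaussianReal m v := by
  have h (P : ProbabilityMeasure ℝ) (a : ℝ) : IsFiniteMeasure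
      (ENNReal.ofReal a • (P : Measure ℝ).map fun x => r * x) := by
    have : IsProbabilityMeasure ((P : Measure ℝ).map fun x => r * x) :=
      Measure.isProbabilityMeasure_map (by fun_prop)
    exact Measure.smul_finite _ ENNReal.ofReal_ne_top
  simp only [contaminated, smooth, ProbabilityMeasure.coe_mk]
  rw [Measure.map_add _ _ (by fun_prop), Measure.map_smul, Measure.map_smul, Measure.add_conv,
    Measure.conv_smul_left, Measure.conv_smul_left]

end Laws

/-! ### Relative entropy between normal laws, also under contamination. -/

section GaussianKL

theorem gaussianReal_withDensity_exp (d : ℝ) :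
    (gaussianReal 0 1).withDensity (fun x => ENNReal.ofReal (Real.exp (d * x - d ^ 2 / 2))) =
      gaussianReal d 1 := by
  rw [gaussianReal_of_var_ne_zero _ one_ne_zero, gaussianReal_of_var_ne_zero _ one_ne_zero,
    ← withDensity_mul _ (measurable_gaussianPDF _ _) (by fun_prop)]
  congr 1
  ext x
  simp only [Pi.mul_apply, gaussianPDF]
  rw [← ENNReal.ofReal_mul (gaussianPDFReal_nonneg _ _ _)]
  congr 1
  simp only [gaussianPDFReal]
  rw [mul_assoc, ← Real.exp_add]
  congr 2
  simp
  ring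

theorem gaussianReal_map_affine (σ m d : ℝ) :
    (gaussianReal d 1).map (fun x => σ * x + m) =
      gaussianReal (σ * d + m) (Real.toNNReal (σ ^ 2)) := by
  have : (fun x : ℝ => σ * x + m) = (fun x => x + m) ∘ fun x => σ * x := rfl
  rw [this, ← Measure.map_map (by fun_prop) (by fun_prop), gaussianReal_map_const_mul,
    gaussianReal_map_add_const]
  congr 1
  ext
  simp [Real.coe_toNNReal _ (sq_nonneg σ)]

theorem KLBound.gaussian_one (d : ℝ) : KLBound (gaussianReal 0 1) (gaussianReal d 1) (d ^ 2 / 2) := by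
  have h0 := integrable_id_gauss 0 1
  have h1 : Integrable (fun x : ℝ => d * x) (gaussianReal 0 1) := h0.const_mul d
  refine ⟨fun x => d ^ 2 / 2 - d * x, by fun_prop, (integrable_const _).sub h1, ?_, ?_⟩
  · rw [integral_sub (integrable_const _) h1, integral_const_mul, integral_id_gaussianReal]
    simp
  · have := gaussianReal_withDensity_exp d
    simp only [neg_sub]
    exact this.le

theorem KLBound.gaussian (m d : ℝ) {v : ℝ≥0} (hv : v ≠ 0) :
    KLBound (gaussianReal m v) (gaussianReal d v) ((d - m) ^ 2 / (2 * v)) := by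
  set s := Real.sqrt v with hs
  have hs2 : s ^ 2 = v := Real.sq_sqrt v.2
  have hs0 : s ≠ 0 := (Real.sqrt_pos.2 (NNReal.coe_pos.2 (pos_iff_ne_zero.2 hv))).ne'
  have h := (KLBound.gaussian_one ((d - m) / s)).map (f := fun x => s * x + m) (by fun_prop)
  rw [gaussianReal_map_affine, gaussianReal_map_affine, hs2, Real.toNNReal_coe,
    mul_div_cancel₀ _ hs0, mul_zero, zero_add, sub_add_cancel, div_pow, hs2] at h
  convert h using 1
  field_simp

theorem KLBound.conv_gaussian (R : Measure ℝ) [IsProbabilityMeasure R] (m d : ℝ) {v : ℝ≥0}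
    (hv : v ≠ 0) :
    KLBound (R ∗ gaussianReal m v) (R ∗ gaussianReal d v) ((d - m) ^ 2 / (2 * v)) :=
  ((KLBound.gaussian m d hv).prod_right R).map (by fun_prop)

/-- A contamination far in the tail brings a normal law closer to a shifted normal law. -/
theorem KLBound.contaminated_gaussian (ε : unitInterval) (hε : (ε : ℝ) < 1) (M d : ℝ) :
    KLBound (contaminated ε (gauss 0 1) (gauss M 1)) (gaussianReal d 1)
      (d ^ 2 / 2 - d * (ε * M) + ε ^ 2 * (Real.exp (M ^ 2) - 1)) := by
  have hε0 : (0 : ℝ) ≤ ε := ε.2.1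
  set C := contaminated ε (gauss 0 1) (gauss M 1) with hC
  set g : ℝ → ℝ := fun x => 1 - ε + ε * Real.exp (M * x - M ^ 2 / 2) with hg
  have hgpos : ∀ x, 1 - (ε : ℝ) ≤ g x := fun x => by
    have := mul_nonneg hε0 (Real.exp_pos (M * x - M ^ 2 / 2)).le
    simp only [hg]; linarith
  have hgpos' : ∀ x, 0 < g x := fun x => by have := hgpos x; linarith
  have hgm : Measurable g := by fun_prop
  have hCd : C = (gaussianReal 0 1).withDensity fun x => ENNReal.ofReal (g x) := by
    have e : (fun x => ENNReal.ofReal (g x)) = (fun _ => ENNReal.ofReal (1 - (ε : ℝ))) +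
        (ENNReal.ofReal (ε : ℝ) • fun x => ENNReal.ofReal (Real.exp (M * x - M ^ 2 / 2))) := by
      ext x
      simp only [hg, Pi.add_apply, Pi.smul_apply, smul_eq_mul]
      rw [ENNReal.ofReal_add (by linarith) (mul_nonneg hε0 (Real.exp_pos _).le),
        ENNReal.ofReal_mul hε0]
    rw [e, withDensity_add_left measurable_const, withDensity_const,
      withDensity_smul _ (by fun_prop), gaussianReal_withDensity_exp]
    rfl
  have hexp (x : ℝ) : Real.exp (M * x - M ^ 2 / 2) = Real.exp (-(M ^ 2 / 2)) * Real.exp (M * x) := by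
    rw [← Real.exp_add]; congr 1; ring
  have hie (m : ℝ) : Integrable (fun x => Real.exp (M * x - M ^ 2 / 2)) (gauss m 1 : Measure ℝ) := by
    simp_rw [hexp]
    exact (integrable_exp_gauss m 1 M).const_mul _
  have hie' (m : ℝ) : ∫ x, Real.exp (M * x - M ^ 2 / 2) ∂(gauss m 1 : Measure ℝ) =
      Real.exp (m * M) := by
    simp_rw [hexp]
    rw [integral_const_mul, integral_exp_gauss, ← Real.exp_add]
    congr 1; simp
  have hI0 := integrable_id_gauss 0 1
  have hI1 := integrable_id_gauss M 1
  have hIC : Integrable (fun x => x) C := integrable_contaminated hI0 hI1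
  have hmC : ∫ x, x ∂C = ε * M := by
    have := integral_contaminated (ε := ε) hI0 hI1
    rw [hC, this]
    have e0 : ∫ x, x ∂(gauss 0 1 : Measure ℝ) = 0 := mean_gauss 0 1
    have e1 : ∫ x, x ∂(gauss M 1 : Measure ℝ) = M := mean_gauss M 1
    rw [e0, e1]; ring
  have hgi : Integrable g C := (integrable_const (1 - (ε : ℝ))).add
    ((integrable_contaminated (hie 0) (hie M)).const_mul (ε : ℝ))
  have hgC : ∫ x, (g x - 1) ∂C = ε ^ 2 * (Real.exp (M ^ 2) - 1) := by
    have e1 : ∫ x, (g x - 1) ∂C = ∫ x, (ε * Real.exp (M * x - M ^ 2 / 2) - ε) ∂C :=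
      integral_congr_ae (Eventually.of_forall fun x => by simp only [hg]; ring)
    rw [e1, integral_sub ((integrable_contaminated (hie 0) (hie M)).const_mul (ε : ℝ))
      (integrable_const _), integral_const_mul, integral_contaminated (hie 0) (hie M), hie' 0,
      hie' M]
    simp
    ring_nf
  have hli : Integrable (fun x => Real.log (g x)) C := by
    refine integrable_of_le_of_le (g₁ := fun _ => Real.log (1 - ε)) (g₂ := fun x => g x - 1)
      hgm.log.aestronglyMeasurable (Eventually.of_forall fun x => ?_)
      (Eventually.of_forall fun x => ?_) (integrable_const _) (hgi.sub (integrable_const 1))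
    · exact Real.log_le_log (by linarith) (hgpos x)
    · exact Real.log_le_sub_one_of_pos (hgpos' x)
  have hlin : Integrable (fun x => d ^ 2 / 2 - d * x) C := (integrable_const _).sub (hIC.const_mul d)
  refine ⟨fun x => Real.log (g x) + (d ^ 2 / 2 - d * x), by fun_prop, hli.add hlin, ?_, ?_⟩
  · rw [integral_add hli hlin]
    have e1 : ∫ x, Real.log (g x) ∂C ≤ ∫ x, (g x - 1) ∂C :=
      integral_mono hli (hgi.sub (integrable_const 1)) fun x =>
        Real.log_le_sub_one_of_pos (hgpos' x)
    have e2 : ∫ x, (d ^ 2 / 2 - d * x) ∂C = d ^ 2 / 2 - d * (ε * M) := by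
      rw [integral_sub (integrable_const _) (hIC.const_mul d), integral_const_mul, hmC]
      simp
    rw [e2]
    linarith
  · rw [hCd, ← withDensity_mul _ (by fun_prop) (by fun_prop), ← gaussianReal_withDensity_exp d]
    refine le_of_eq (congrArg _ (funext fun x => ?_))
    simp only [Pi.mul_apply]
    rw [← ENNReal.ofReal_mul (hgpos' x).le, neg_add, Real.exp_add, Real.exp_neg,
      Real.exp_log (hgpos' x), ← mul_assoc, mul_inv_cancel₀ (hgpos' x).ne', one_mul, neg_sub]

end GaussianKL

/-! ### The uncertainty as half the largest gap between compatible means, and an upper bound. -/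

section Uncertainty

variable {ε : unitInterval} {σ : ℝ}

/-- The rule returns the midpoint of the range of all means that are compatible with the
contaminated law. -/
theorem achievable_of_mean_sub_le {u : ℝ}
    (h : ∀ P Q P' Q' : ProbabilityMeasure ℝ, IsSubGaussian σ P → IsSubGaussian σ P' →
      contaminated ε P Q = contaminated ε P' Q' → mean P' - mean P ≤ 2 * u) :
    AchievableUncertainty ε σ u := by
  let S : Measure ℝ → Set ℝ := fun C =>
    {m | ∃ P Q : ProbabilityMeasure ℝ, IsSubGaussian σ P ∧ contaminated ε P Q = C ∧ mean P = m}
  refine ⟨fun C => (sInf (S C) + sSup (S C)) / 2, fun P Q hP => ?_⟩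
  have hmem : mean P ∈ S (contaminated ε P Q) := ⟨P, Q, hP, rfl, rfl⟩
  set C := contaminated ε P Q
  have hd : ∀ m ∈ S C, ∀ m' ∈ S C, m' - m ≤ 2 * u := by
    rintro _ ⟨P₁, Q₁, h₁, e₁, rfl⟩ _ ⟨P₂, Q₂, h₂, e₂, rfl⟩
    exact h P₁ Q₁ P₂ Q₂ h₁ h₂ (e₁.trans e₂.symm)
  have hb : BddBelow (S C) := ⟨mean P - 2 * u, fun m hm => by have := hd m hm _ hmem; linarith⟩
  have ha : BddAbove (S C) := ⟨mean P + 2 * u, fun m hm => by have := hd _ hmem m hm; linarith⟩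
  have h1 : sInf (S C) ≤ mean P := csInf_le hb hmem
  have h2 : mean P ≤ sSup (S C) := le_csSup ha hmem
  have h3 : sSup (S C) ≤ sInf (S C) + 2 * u := by
    refine csSup_le ⟨_, hmem⟩ fun m' hm' => ?_
    have : m' - 2 * u ≤ sInf (S C) := le_csInf ⟨_, hmem⟩ fun m hm => by
      have := hd m hm m' hm'; linarith
    linarith
  rw [abs_le]
  constructor <;> simp only <;> linarith

theorem mean_sub_le_of_achievable {u : ℝ} (h : AchievableUncertainty ε σ u)
    {P Q P' Q' : ProbabilityMeasure ℝ} (hP : IsSubGaussian σ P) (hP' : IsSubGaussian σ P')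
    (hC : contaminated ε P Q = contaminated ε P' Q') : mean P' - mean P ≤ 2 * u := by
  obtain ⟨T, hT⟩ := h
  have h1 := abs_le.1 (hT P Q hP)
  have h2 := abs_le.1 (hT P' Q' hP')
  rw [hC] at h1
  linarith [h1.1, h1.2, h2.1, h2.2]

theorem nonneg_of_achievable {u : ℝ} (h : AchievableUncertainty ε σ u) : 0 ≤ u := by
  have := mean_sub_le_of_achievable h (isSubGaussian_point σ 0) (isSubGaussian_point σ 0)
    (Q := point 0) (Q' := point 0) rfl
  linarith

theorem uncertainty_nonneg : 0 ≤ uncertainty ε σ :=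
  Real.sInf_nonneg fun _ h => nonneg_of_achievable h

theorem uncertainty_le {u : ℝ} (h : AchievableUncertainty ε σ u) : uncertainty ε σ ≤ u :=
  csInf_le ⟨0, fun _ h => nonneg_of_achievable h⟩ h

/-- Two sub-Gaussian laws that are compatible with one contaminated law have similar means. -/
theorem mean_sub_le_of_contaminated_eq (hε : (ε : ℝ) < 1 / 2) {w s : ℝ} (hw : 0 ≤ w) (hs : 0 < s)
    {P Q P' Q' : ProbabilityMeasure ℝ} (hP : IsSubGaussian σ P) (hP' : IsSubGaussian σ P')
    (hC : contaminated ε P Q = contaminated ε P' Q') :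
    (1 - 2 * ε) * (mean P' - mean P) ≤
      2 * (ε * w) + 2 * ((1 - ε) * (Real.exp (-(s * w) - 1 + s ^ 2 * σ ^ 2 / 2) / s)) := by
  have hε0 : (0 : ℝ) ≤ ε := ε.2.1
  set m := mean P with hm
  set m' := mean P' with hm'
  set T := Real.exp (-(s * w) - 1 + s ^ 2 * σ ^ 2 / 2) / s with hT
  have hT0 : 0 < T := by positivity
  by_cases hcase : m' + w < m - w
  · have h1 : (1 - 2 * ε) * (m' - m) ≤ 0 :=
      mul_nonpos_of_nonneg_of_nonpos (by linarith) (by linarith)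
    have h2 : 0 ≤ (ε : ℝ) * w := mul_nonneg hε0 hw
    have h3 : 0 ≤ (1 - (ε : ℝ)) * T := mul_nonneg (by linarith) hT0.le
    linarith
  push Not at hcase
  -- The test function is the identity clipped to `[m - w, m' + w]`. Clipping limits the influence
  -- of the adversaries and changes the relevant one-sided mean of a true law by at most the
  -- exponential tail bound `T`; equating the two contaminated expectations gives the claim.
  set f : ℝ → ℝ := fun x => max (m - w) (min (m' + w) x) with hf
  have hfm : Measurable f := by fun_prop
  have hfl : ∀ x, m - w ≤ f x := fun x => le_max_left _ _
  have hfu : ∀ x, f x ≤ m' + w := fun x => max_le hcase (min_le_left _ _)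
  have hfi (R : ProbabilityMeasure ℝ) : Integrable f (R : Measure ℝ) :=
    integrable_of_le_of_le hfm.aestronglyMeasurable (Eventually.of_forall hfl)
      (Eventually.of_forall hfu) (integrable_const _) (integrable_const _)
  have hQ : ∫ x, f x ∂(Q : Measure ℝ) ≤ m' + w := by
    have := integral_mono (hfi Q) (integrable_const (m' + w)) hfu
    simpa using this
  have hQ' : m - w ≤ ∫ x, f x ∂(Q' : Measure ℝ) := by
    have := integral_mono (integrable_const (m - w)) (hfi Q') hfl
    simpa using this
  have heq := integral_contaminated (ε := ε) (hfi P) (hfi Q)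
  rw [hC, integral_contaminated (hfi P') (hfi Q')] at heq
  -- The exponential touches the line `z` at `z = 1/s`, so the positive part is bounded by the
  -- moment generating function without any loss of constants there.
  have hpos : ∀ z : ℝ, max z 0 ≤ Real.exp (s * z - 1) / s := by
    intro z
    rw [le_div_iff₀ hs]
    rcases le_total z 0 with h | h
    · rw [max_eq_right h, zero_mul]; positivity
    · rw [max_eq_left h]
      have := Real.add_one_le_exp (s * z - 1)
      linarith
  have htail (R : ProbabilityMeasure ℝ) (hR : IsSubGaussian σ R) (r : ℝ) (hr : r ^ 2 = s ^ 2) :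
      Integrable (fun x => Real.exp (r * (x - mean R) - s * w - 1) / s) (R : Measure ℝ) ∧
      ∫ x, Real.exp (r * (x - mean R) - s * w - 1) / s ∂(R : Measure ℝ) ≤ T := by
    obtain ⟨h1, h2⟩ := isSubGaussian_iff.1 hR r
    have e (x : ℝ) : Real.exp (r * (x - mean R) - s * w - 1) / s =
        Real.exp (-(r * mean R) - s * w - 1) / s * Real.exp (r * x) := by
      rw [div_mul_eq_mul_div, ← Real.exp_add]
      congr 2; ring
    refine ⟨?_, ?_⟩
    · rw [funext e]; exact h1.const_mul _
    · rw [integral_congr_ae (Eventually.of_forall e), integral_const_mul]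
      calc _ ≤ Real.exp (-(r * mean R) - s * w - 1) / s *
            Real.exp (r * mean R + σ ^ 2 * r ^ 2 / 2) := by gcongr
        _ = T := by
            rw [hT, div_mul_eq_mul_div, ← Real.exp_add, hr]
            congr 2; ring
  have hP'f : m' - T ≤ ∫ x, f x ∂(P' : Measure ℝ) := by
    obtain ⟨h1, h2⟩ := htail P' hP' s rfl
    have h3 : ∫ x, (x - Real.exp (s * (x - m') - s * w - 1) / s) ∂(P' : Measure ℝ) ≤
        ∫ x, f x ∂(P' : Measure ℝ) := by
      refine integral_mono (hP'.integrable_id.sub h1) (hfi P') fun x => ?_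
      have h4 := hpos (x - (m' + w))
      have h5 : s * (x - (m' + w)) - 1 = s * (x - m') - s * w - 1 := by ring
      rw [h5] at h4
      have h6 : min (m' + w) x ≤ f x := le_max_right _ _
      have h7 : x - max (x - (m' + w)) 0 ≤ min (m' + w) x :=
        le_min (by have := le_max_left (x - (m' + w)) 0; linarith)
          (by have := le_max_right (x - (m' + w)) 0; linarith)
      simp only; linarith
    rw [integral_sub hP'.integrable_id h1] at h3
    have h4 : ∫ x, x ∂(P' : Measure ℝ) = m' := rfl
    linarith
  have hPf : ∫ x, f x ∂(P : Measure ℝ) ≤ m + T := by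
    obtain ⟨h1, h2⟩ := htail P hP (-s) (by ring)
    have h3 : ∫ x, f x ∂(P : Measure ℝ) ≤
        ∫ x, (x + Real.exp (-s * (x - m) - s * w - 1) / s) ∂(P : Measure ℝ) := by
      refine integral_mono (hfi P) (hP.integrable_id.add h1) fun x => ?_
      have h4 := hpos (m - w - x)
      have h5 : s * (m - w - x) - 1 = -s * (x - m) - s * w - 1 := by ring
      rw [h5] at h4
      have h6 : f x ≤ x + max (m - w - x) 0 :=
        max_le (by have := le_max_left (m - w - x) 0; linarith)
          ((min_le_right _ _).trans (by have := le_max_right (m - w - x) 0; linarith))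
      simp only; linarith
    rw [integral_add hP.integrable_id h1] at h3
    have h4 : ∫ x, x ∂(P : Measure ℝ) = m := rfl
    linarith
  have e1 : (1 - (ε : ℝ)) * (m' - T - (m + T)) ≤
      (1 - ε) * (∫ x, f x ∂(P' : Measure ℝ) - ∫ x, f x ∂(P : Measure ℝ)) :=
    mul_le_mul_of_nonneg_left (by linarith) (by linarith)
  have e2 : (ε : ℝ) * (∫ x, f x ∂(Q : Measure ℝ) - ∫ x, f x ∂(Q' : Measure ℝ)) ≤
      ε * (m' + w - (m - w)) := mul_le_mul_of_nonneg_left (by linarith) hε0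
  nlinarith

theorem achievable_of_le (hε : (ε : ℝ) < 1 / 2) {w s u : ℝ} (hw : 0 ≤ w) (hs : 0 < s)
    (hu : ε * w + (1 - ε) * (Real.exp (-(s * w) - 1 + s ^ 2 * σ ^ 2 / 2) / s) ≤
      (1 - 2 * ε) * u) : AchievableUncertainty ε σ u := by
  refine achievable_of_mean_sub_le fun P Q P' Q' hP hP' hC => ?_
  have h1 := mean_sub_le_of_contaminated_eq hε hw hs hP hP' hC
  have h2 : 0 < 1 - 2 * (ε : ℝ) := by linarith
  exact le_of_mul_le_mul_left (by linarith) h2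

/-- Without this, the infimum could be the default value 0 of an empty set, and lower bounds on the
uncertainty would fail. -/
theorem exists_achievable (hε : (ε : ℝ) < 1 / 2) : ∃ u, AchievableUncertainty ε σ u := by
  have h2 : 0 < 1 - 2 * (ε : ℝ) := by linarith
  refine ⟨(ε * 0 + (1 - ε) * (Real.exp (-(1 * 0) - 1 + 1 ^ 2 * σ ^ 2 / 2) / 1)) / (1 - 2 * ε),
    achievable_of_le (w := 0) (s := 1) hε le_rfl one_pos (le_of_eq ?_)⟩
  rw [mul_div_cancel₀ _ h2.ne']

theorem mean_sub_le_uncertainty (hε : (ε : ℝ) < 1 / 2) {P Q P' Q' : ProbabilityMeasure ℝ}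
    (hP : IsSubGaussian σ P) (hP' : IsSubGaussian σ P')
    (hC : contaminated ε P Q = contaminated ε P' Q') :
    mean P' - mean P ≤ 2 * uncertainty ε σ := by
  have : (mean P' - mean P) / 2 ≤ uncertainty ε σ :=
    le_csInf (exists_achievable hε) fun u hu => by
      have := mean_sub_le_of_achievable hu hP hP' hC
      linarith
  linarith

/-- There are laws that nearly attain the uncertainty. -/
theorem exists_mean_sub_ge (θ : ℝ) (hθ : θ < 1) :
    ∃ P Q P' Q' : ProbabilityMeasure ℝ, IsSubGaussian σ P ∧ IsSubGaussian σ P' ∧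
      contaminated ε P Q = contaminated ε P' Q' ∧
      2 * (θ * uncertainty ε σ) ≤ mean P - mean P' := by
  rcases uncertainty_nonneg (ε := ε) (σ := σ) |>.eq_or_lt with h0 | h0
  · refine ⟨point 0, point 0, point 0, point 0, isSubGaussian_point σ 0, isSubGaussian_point σ 0,
      rfl, ?_⟩
    rw [← h0]; simp
  · by_contra hc
    push Not at hc
    -- If no pair had such a gap, the midpoint rule would achieve a radius below the infimum.
    have : AchievableUncertainty ε σ (θ * uncertainty ε σ) :=
      achievable_of_mean_sub_le fun P Q P' Q' hP hP' hC => (hc P' Q' P Q hP' hP hC.symm).le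
    have := uncertainty_le this
    nlinarith

theorem uncertainty_of_eq_zero (hε : (ε : ℝ) = 0) : uncertainty ε σ = 0 := by
  refine le_antisymm (uncertainty_le (achievable_of_mean_sub_le fun P Q P' Q' _ _ hC => ?_))
    uncertainty_nonneg
  have h1 : (P : Measure ℝ) = P' := by simpa [contaminated, hε] using hC
  simp [mean, h1]

/-- An upper bound on the uncertainty, of the right order for small `ε`. -/
theorem uncertainty_le_mul_sqrt (hε0 : (0 : ℝ) < ε) (hε : (ε : ℝ) ≤ 1 / 4) (hσ : 0 < σ) :
    uncertainty ε σ ≤ σ * (ε / (1 - 2 * ε) * Real.sqrt (2 * Real.log ((1 - ε) / ε))) := by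
  have h1 : 0 < 1 - 2 * (ε : ℝ) := by linarith
  have hq : 3 ≤ (1 - (ε : ℝ)) / ε := by rw [le_div_iff₀ hε0]; linarith
  have hlog : 1 ≤ Real.log ((1 - (ε : ℝ)) / ε) := by
    rw [Real.le_log_iff_exp_le (by linarith)]
    have := Real.exp_one_lt_d9
    linarith
  set Λ := Real.sqrt (2 * Real.log ((1 - ε) / ε)) with hΛ
  have hΛ2 : Λ ^ 2 = 2 * Real.log ((1 - ε) / ε) := Real.sq_sqrt (by linarith)
  have hΛ1 : 1 ≤ Λ := Real.one_le_sqrt.2 (by linarith)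
  -- With this choice the exponent is `-Λ²/2 = -log ((1 - ε)/ε)`. The tail term becomes `σ ε / Λ`,
  -- which is exactly what `ε w` lacks to `σ ε Λ`.
  refine uncertainty_le (achievable_of_le (w := σ * (Λ - 1 / Λ)) (s := Λ / σ) (by linarith)
    (mul_nonneg hσ.le ?_) (by positivity) (le_of_eq ?_))
  · rw [sub_nonneg, div_le_iff₀ (by linarith)]; nlinarith
  · have e1 : -(Λ / σ * (σ * (Λ - 1 / Λ))) - 1 + (Λ / σ) ^ 2 * σ ^ 2 / 2 =
        -Real.log ((1 - ε) / ε) := by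
      have : Λ ≠ 0 := by linarith
      field_simp
      linarith
    rw [e1, Real.exp_neg, Real.exp_log (by linarith)]
    have h2 : 1 - (ε : ℝ) ≠ 0 := by linarith
    have : Λ ≠ 0 := by linarith
    have h3 : 1 - 2 * (ε : ℝ) ≠ 0 := h1.ne'
    rw [show (1 - 2 * (ε : ℝ)) * (σ * (ε / (1 - 2 * ε) * Λ)) = σ * ε * Λ by field_simp]
    field_simp
    ring

end Uncertainty

/-! ### Small atoms in the tail, and a lower bound on the uncertainty. -/

section Spike

theorem exp_sub_one_sub_le {τ y t : ℝ} (hτ : 0 < τ) :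
    Real.exp (t * y - τ * t ^ 2 / 2) - 1 - t * y ≤
      Real.exp (y ^ 2 / (2 * τ)) * (t * y) ^ 2 := by
  set z := t * y with hz
  have hB : 1 ≤ Real.exp (y ^ 2 / (2 * τ)) := Real.one_le_exp (by positivity)
  have h1 : Real.exp (z - τ * t ^ 2 / 2) ≤ Real.exp z :=
    Real.exp_le_exp.2 (by have : 0 ≤ τ * t ^ 2 / 2 := by positivity
                          linarith)
  -- For `z ≤ 1` the quadratic Taylor bound suffices. For `z > 1`, completing the square gives `t y
  -- - τ t²/2 ≤ y²/(2τ)`, and the factor `z² > 1` is free.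
  by_cases h : z ≤ 1
  · have h2 : Real.exp z - 1 - z ≤ z ^ 2 := by
      by_cases h' : -1 ≤ z
      · exact (abs_le.1 (Real.abs_exp_sub_one_sub_id_le (abs_le.2 ⟨h', h⟩))).2
      · have : Real.exp z ≤ 1 := Real.exp_le_one_iff.2 (by linarith)
        nlinarith
    nlinarith [sq_nonneg z]
  · push Not at h
    have h3 : Real.exp (z - τ * t ^ 2 / 2) ≤ Real.exp (y ^ 2 / (2 * τ)) := by
      refine Real.exp_le_exp.2 ?_
      rw [le_div_iff₀ (by positivity), hz]
      nlinarith [sq_nonneg (τ * t - y)]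
    nlinarith [mul_le_mul_of_nonneg_left (show (1 : ℝ) ≤ z ^ 2 by nlinarith)
      (Real.exp_pos (y ^ 2 / (2 * τ))).le]

/-- A normal law with reduced variance and a small atom in the tail is sub-Gaussian. -/
theorem isSubGaussian_spike {p : unitInterval} {τ : ℝ≥0} {x y : ℝ} (hτ : 0 < τ)
    (h : 2 * (p * (y ^ 2 * Real.exp (y ^ 2 / (2 * τ)))) ≤ 1 - τ) :
    IsSubGaussian 1 (mixture p (gauss x τ) (point (x + y))) := by
  have hi : ∀ t : ℝ, Integrable (fun z => Real.exp (t * z)) (point (x + y) : Measure ℝ) :=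
    fun t => integrable_dirac (by simp)
  refine isSubGaussian_iff.2 fun t =>
    ⟨integrable_contaminated (integrable_exp_gauss x τ t) (hi t), ?_⟩
  rw [mean_mixture (integrable_id_gauss x τ) (integrable_id_point _), mean_gauss, mean_point]
  have e1 : ∫ z, Real.exp (t * z) ∂(mixture p (gauss x τ) (point (x + y)) : Measure ℝ) =
      (1 - p) * Real.exp (x * t + τ * t ^ 2 / 2) + p * Real.exp (t * (x + y)) := by
    refine (integral_contaminated (integrable_exp_gauss x τ t) (hi t)).trans ?_
    rw [integral_exp_gauss]
    congr 2
    exact integral_dirac _ _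
  have e2 : Real.exp (t * (x + y)) =
      Real.exp (x * t + τ * t ^ 2 / 2) * Real.exp (t * y - τ * t ^ 2 / 2) := by
    rw [← Real.exp_add]; congr 1; ring
  have e3 : Real.exp (t * ((1 - p) * x + p * (x + y)) + 1 ^ 2 * t ^ 2 / 2) =
      Real.exp (x * t + τ * t ^ 2 / 2) * Real.exp (p * (t * y) + (1 - τ) * t ^ 2 / 2) := by
    rw [← Real.exp_add]; congr 1; ring
  rw [e1, e2, e3]
  have h1 := exp_sub_one_sub_le (y := y) (t := t) (NNReal.coe_pos.2 hτ)
  have h2 := Real.add_one_le_exp (p * (t * y) + (1 - τ) * t ^ 2 / 2)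
  have h3 := mul_le_mul_of_nonneg_left h1 p.2.1
  have h4 := mul_le_mul_of_nonneg_right h (sq_nonneg t)
  -- The variance `1 - τ` held back from the normal part pays for the second-order effect of the
  -- atom.
  have h5 : (1 - p) + p * Real.exp (t * y - τ * t ^ 2 / 2) ≤
      Real.exp (p * (t * y) + (1 - τ) * t ^ 2 / 2) := by nlinarith
  have h6 := mul_le_mul_of_nonneg_left h5 (Real.exp_pos (x * t + τ * t ^ 2 / 2)).le
  linarith

variable {ε p : unitInterval}

/-- The weight `p` is chosen so that the component `R` of the true law and the adversarial law `Q`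
enter with the same mass `ε`; for `Q = P` an adversary playing `R` against `P` produces the same
observations. -/
theorem contaminated_mixture (hp : (1 - (ε : ℝ)) * p = ε) (P R Q : ProbabilityMeasure ℝ) :
    contaminated ε (mixture p P R) Q = ENNReal.ofReal (1 - 2 * (ε : ℝ)) • (P : Measure ℝ) +
      ENNReal.ofReal ε • ((Q : Measure ℝ) + (R : Measure ℝ)) := by
  have h1 : 0 ≤ 1 - (ε : ℝ) := sub_nonneg.2 ε.2.2
  rw [contaminated, mixture, ProbabilityMeasure.coe_mk, contaminated, smul_add, smul_smul,
    smul_smul, ← ENNReal.ofReal_mul h1, ← ENNReal.ofReal_mul h1, hp,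
    show (1 - (ε : ℝ)) * (1 - p) = 1 - 2 * ε by linarith, smul_add, add_assoc,
    add_comm (ENNReal.ofReal (ε : ℝ) • (R : Measure ℝ))]

theorem contaminated_eq_add (hε : (ε : ℝ) ≤ 1 / 2) (P R : ProbabilityMeasure ℝ) :
    contaminated ε P R = ENNReal.ofReal (1 - 2 * (ε : ℝ)) • (P : Measure ℝ) +
      ENNReal.ofReal ε • ((P : Measure ℝ) + (R : Measure ℝ)) := by
  rw [contaminated, smul_add, ← add_assoc, ← add_smul,
    ← ENNReal.ofReal_add (by linarith) ε.2.1]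
  congr 3; ring

/-- With a common part of mass `2 ε`, only the rest of the laws has to be told apart. -/
theorem KLBound.common (hε : (ε : ℝ) ≤ 1 / 2) {P P' : ProbabilityMeasure ℝ} {k : ℝ}
    (h : KLBound (P : Measure ℝ) P' k) (R : Measure ℝ) [IsFiniteMeasure R] :
    KLBound (ENNReal.ofReal (1 - 2 * (ε : ℝ)) • (P : Measure ℝ) + ENNReal.ofReal ε • R)
      (ENNReal.ofReal (1 - 2 * (ε : ℝ)) • (P' : Measure ℝ) + ENNReal.ofReal ε • R)
      ((1 - 2 * ε) * k) := by
  simpa using h.mix (KLBound.refl R) (by linarith : (0 : ℝ) ≤ 1 - 2 * ε) ε.2.1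

theorem exists_mixing_weight (hε : (ε : ℝ) ≤ 1 / 2) :
    ∃ p : unitInterval, (1 - (ε : ℝ)) * p = ε := by
  have h1 : 0 < 1 - (ε : ℝ) := by linarith
  exact ⟨⟨ε / (1 - ε), div_nonneg ε.2.1 h1.le, (div_le_one h1).2 (by linarith)⟩,
    mul_div_cancel₀ _ h1.ne'⟩

/-- A lower bound on the uncertainty, of the right order for small `ε`. -/
theorem mul_sqrt_le_uncertainty (ε : unitInterval) {σ : ℝ} (hε : (ε : ℝ) < 1 / 2) (hσ : 0 < σ) :
    σ * (ε * Real.sqrt (Real.log (1 / ε))) / 8 ≤ uncertainty ε σ := by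
  rcases ε.2.1.eq_or_lt with h0 | h0
  · rw [← h0]; simpa using uncertainty_nonneg
  obtain ⟨p, hp⟩ := exists_mixing_weight hε.le
  have hp0 : (0 : ℝ) ≤ p := p.2.1
  have hp2 : (p : ℝ) ≤ 2 * ε := by nlinarith
  have hpε : (ε : ℝ) ≤ p := by nlinarith
  set l := Real.log (1 / (ε : ℝ)) with hl
  have hl0 : 0 ≤ l := Real.log_nonneg (by rw [le_div_iff₀ h0]; linarith)
  -- The atom may sit at a distance of order `√(log (1/ε))`: here `exp (y²) = ε^(-1/16)`, which its
  -- mass of order `ε` more than compensates.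
  set y := Real.sqrt l / 4 with hy
  have hy2 : y ^ 2 = l / 16 := by rw [hy, div_pow, Real.sq_sqrt hl0]; norm_num
  have hτ : ((1 / 2 : ℝ≥0) : ℝ) = 1 / 2 := by norm_num
  set r := Real.sqrt (1 / (ε : ℝ)) with hr
  have hr2 : r ^ 2 = 1 / ε := Real.sq_sqrt (by positivity)
  have hr0 : 0 < r := Real.sqrt_pos.2 (by positivity)
  have hlr : l = 2 * Real.log r := by rw [hl, ← hr2, Real.log_pow]; norm_num
  have hlr' : l ≤ 2 * r := by rw [hlr]; linarith [Real.log_le_self hr0.le]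
  have hexp : Real.exp (y ^ 2 / (2 * (1 / 2 : ℝ))) ≤ r := by
    rw [hy2, ← Real.le_log_iff_exp_le hr0]
    linarith
  have hsg : IsSubGaussian 1 (mixture p (gauss 0 (1 / 2)) (point (0 + y))) := by
    refine isSubGaussian_spike (by norm_num) ?_
    rw [hτ]
    have h1 : y ^ 2 * Real.exp (y ^ 2 / (2 * (1 / 2 : ℝ))) ≤ (r / 8) * r := by
      refine mul_le_mul ?_ hexp (Real.exp_pos _).le (by positivity)
      rw [hy2]; linarith
    have h2 : (p : ℝ) * (y ^ 2 * Real.exp (y ^ 2 / (2 * (1 / 2 : ℝ)))) ≤ 2 * ε * ((r / 8) * r) :=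
      mul_le_mul hp2 h1 (by positivity) (by positivity)
    have h3 : 2 * (ε : ℝ) * ((r / 8) * r) = 1 / 4 := by
      have : r * r = 1 / ε := by rw [← hr2]; ring
      rw [show 2 * (ε : ℝ) * ((r / 8) * r) = ε * (r * r) / 4 by ring, this]
      field_simp
    linarith
  have hC : contaminated ε (gauss 0 (1 / 2)) (point (0 + y)) =
      contaminated ε (mixture p (gauss 0 (1 / 2)) (point (0 + y))) (gauss 0 (1 / 2)) := by
    rw [contaminated_mixture hp, contaminated_eq_add hε.le]
  have hg : IsSubGaussian 1 (gauss 0 (1 / 2)) := isSubGaussian_gauss (by norm_num)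
  have h1 := mean_sub_le_uncertainty (σ := σ) hε (hg.affine σ 0) (hsg.affine σ 0)
    (Q := affine σ 0 (point (0 + y))) (Q' := affine σ 0 (gauss 0 (1 / 2)))
    (by rw [contaminated_affine, contaminated_affine, hC])
  rw [mean_affine hg.integrable_id, mean_affine hsg.integrable_id,
    mean_mixture (integrable_id_gauss _ _) (integrable_id_point _), mean_gauss, mean_point] at h1
  have h2 : (ε : ℝ) * y ≤ p * y := mul_le_mul_of_nonneg_right hpε (by positivity)
  have h3 := mul_le_mul_of_nonneg_left h2 hσ.le
  rw [hy] at h1 h3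
  nlinarith

end Spike

/-! ### Raising an arm at a discount. -/

section Cheap

variable {ε : unitInterval}

/-- Some standard bandit arm, contaminated, can be confused at cost `k` with an arm whose mean is
larger by `x`. -/
def Confusable (ε : unitInterval) (x k : ℝ) : Prop :=
  ∃ P Q P' Q' : ProbabilityMeasure ℝ, IsSubGaussian 1 P ∧ mean P = 0 ∧ 0 < mean Q ∧
    IsSubGaussian 1 P' ∧ mean P' = x ∧ mean Q' = 0 ∧
    KLBound (contaminated ε P Q) (contaminated ε P' Q') k

/-- The adversary of one arm imitates the other arm. -/
theorem confusable_swap (hε : (ε : ℝ) ≤ 1 / 2) {x : ℝ} (hx : 0 < x) :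
    Confusable ε x ((1 - 2 * ε) * (x ^ 2 / 2)) := by
  refine ⟨gauss 0 1, gauss x 1, gauss x 1, gauss 0 1, isSubGaussian_gauss (by simp), mean_gauss _ _,
    by simpa using hx, isSubGaussian_gauss (by simp), mean_gauss _ _, mean_gauss _ _, ?_⟩
  rw [contaminated_eq_add hε, contaminated_eq_add hε, add_comm (gauss x 1 : Measure ℝ)]
  exact KLBound.common (P := gauss 0 1) (P' := gauss x 1) hε (KLBound.gaussian_one x) _

/-- The mean is raised by a shift and by an atom in the tail that the adversary imitates. -/
theorem confusable_spike (hε : (ε : ℝ) < 1 / 2) {ρ x y : ℝ} (hρ : ρ < 1) (hx : 0 ≤ x) (hy : 0 < y)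
    (h : 2 * (ε / (1 - ε) * (y ^ 2 * Real.exp (y ^ 2 / (2 * (1 - ρ))))) ≤ ρ) :
    Confusable ε (x + ε / (1 - ε) * y) ((1 - 2 * ε) * (x ^ 2 / (2 * (1 - ρ)))) := by
  obtain ⟨p, hp⟩ := exists_mixing_weight hε.le
  have h1 : 0 < 1 - (ε : ℝ) := by linarith
  have hp' : (ε : ℝ) / (1 - ε) = p := by rw [div_eq_iff h1.ne', mul_comm, hp]
  rw [hp'] at h ⊢
  have hρ0 : 0 ≤ ρ := le_trans (mul_nonneg two_pos.le (mul_nonneg p.2.1 (by positivity))) h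
  set τ : ℝ≥0 := ⟨1 - ρ, by linarith⟩ with hτ
  have hτc : (τ : ℝ) = 1 - ρ := rfl
  have hτ0 : 0 < τ := NNReal.coe_pos.1 (by rw [hτc]; linarith)
  refine ⟨gauss 0 τ, point (x + y), mixture p (gauss x τ) (point (x + y)), gauss 0 τ,
    isSubGaussian_gauss (by rw [hτc]; linarith), mean_gauss _ _, by rw [mean_point]; linarith,
    isSubGaussian_spike hτ0 (by rw [hτc]; linarith), ?_, mean_gauss _ _, ?_⟩
  · rw [mean_mixture (integrable_id_gauss _ _) (integrable_id_point _), mean_gauss, mean_point]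
    ring
  · rw [contaminated_mixture hp, contaminated_eq_add hε.le]
    have := KLBound.gaussian 0 x hτ0.ne'
    rw [sub_zero, hτc] at this
    exact KLBound.common (P := gauss 0 τ) (P' := gauss x τ) hε.le this _

/-- The adversary puts its samples far in the tail. -/
theorem confusable_tail (hε : (ε : ℝ) < 1) {M d : ℝ} (hM : 0 < M) :
    Confusable ε d ((1 - ε) * (d ^ 2 / 2 - d * (ε * M)) + ε ^ 2 * (Real.exp (M ^ 2) - 1)) := by
  refine ⟨gauss 0 1, gauss M 1, gauss d 1, gauss 0 1, isSubGaussian_gauss (by simp),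
    mean_gauss _ _, by simpa using hM, isSubGaussian_gauss (by simp), mean_gauss _ _,
    mean_gauss _ _, ?_⟩
  have h1 := KLBound.contaminated_gaussian ε hε M d
  have h0 := KLBound.contaminated_gaussian ε hε M 0
  -- Only the second law is a genuine mixture; the first one is split as `(1 - ε) C + ε C`.
  have h := h1.mix h0 (sub_nonneg.2 hε.le) ε.2.1
  rw [← add_smul, ← ENNReal.ofReal_add (sub_nonneg.2 hε.le) ε.2.1, sub_add_cancel,
    ENNReal.ofReal_one, one_smul] at h
  exact h.mono (by nlinarith)

theorem Confusable.mono {x k k' : ℝ} (h : Confusable ε x k) (hk : k ≤ k') : Confusable ε x k' := by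
  obtain ⟨P, Q, P', Q', h1, h2, h3, h4, h5, h6, h7⟩ := h
  exact ⟨P, Q, P', Q', h1, h2, h3, h4, h5, h6, h7.mono hk⟩

theorem mul_sqrt_two_mul_log_le {a r B : ℝ} (ha : 0 < a) (hB : 0 ≤ B)
    (h : a ^ 2 * (2 * Real.log r) ≤ B ^ 2) : a * Real.sqrt (2 * Real.log r) ≤ B := by
  rw [← Real.sqrt_sq ha.le, ← Real.sqrt_mul (sq_nonneg a)]
  exact (Real.sqrt_le_sqrt h).trans_eq (Real.sqrt_sq hB)

/-- For large `ε` the swap saves a factor `1 - 2ε ≤ 7/10`. This pays for stretching the shift from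
`X` to at most `8X/7`, as `(7/10)(8/7)² < (99/100)²`. -/
theorem confusable_of_large {u X E : ℝ} (hε : (ε : ℝ) < 1 / 2) (hε1 : 3 / 20 ≤ (ε : ℝ))
    (hE : 0 < E) (hEu : E / 8 ≤ u) (hX : 7 / 5 * u ≤ X) :
    ∃ x, X + 19 / 100 * u < x ∧ Confusable ε x ((X - 1 / 2000 * E) ^ 2 / 2) := by
  refine ⟨X + 1 / 5 * u, by linarith, (confusable_swap hε.le (by linarith)).mono ?_⟩
  have h1 : X + 1 / 5 * u ≤ 8 / 7 * X := by linarith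
  have h2 : (X + 1 / 5 * u) ^ 2 ≤ (8 / 7 * X) ^ 2 := by gcongr; linarith
  have h3 : 99 / 100 * X ≤ X - 1 / 2000 * E := by linarith
  have h4 : (99 / 100 * X) ^ 2 ≤ (X - 1 / 2000 * E) ^ 2 := by
    gcongr; linarith
  have h5 : (1 - 2 * (ε : ℝ)) * ((X + 1 / 5 * u) ^ 2 / 2) ≤ 7 / 10 * ((X + 1 / 5 * u) ^ 2 / 2) := by
    gcongr; linarith
  nlinarith

theorem confusable_of_medium {u X E : ℝ} (hε : (ε : ℝ) < 3 / 20) (hε1 : 1 / 1000 ≤ (ε : ℝ))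
    (hE : 0 < E) (hEu : E / 8 ≤ u)
    (hu : u ≤ ε / (1 - 2 * ε) * Real.sqrt (2 * Real.log ((1 - ε) / ε))) (hX : 7 / 5 * u ≤ X) :
    ∃ x, X + 19 / 100 * u < x ∧ Confusable ε x ((X - 1 / 2000 * E) ^ 2 / 2) := by
  have h0 : 0 < (ε : ℝ) := by linarith
  have h1 : 0 < 1 - (ε : ℝ) := by linarith
  have h2 : 0 < 1 - 2 * (ε : ℝ) := by linarith
  have hr : 0 < (1 - (ε : ℝ)) / ε := by positivity
  have hlog2 := Real.log_two_lt_d9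
  have hlog : 0 ≤ Real.log ((1 - (ε : ℝ)) / ε) :=
    Real.log_nonneg (by rw [le_div_iff₀ h0]; linarith)
  have hL : (1 - (ε : ℝ)) / (1 - 2 * ε) * Real.sqrt (2 * Real.log ((1 - ε) / ε)) ≤ 381 / 100 := by
    refine mul_sqrt_two_mul_log_le (by positivity) (by norm_num) ?_
    rcases le_total (ε : ℝ) (1 / 100) with h | h
    · have hl : Real.log ((1 - (ε : ℝ)) / ε) ≤ 10 * Real.log 2 := by
        rw [← Real.log_rpow two_pos]
        refine Real.log_le_log hr ?_
        rw [div_le_iff₀ h0]; norm_num; linarith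
      have ha : (1 - (ε : ℝ)) / (1 - 2 * ε) ≤ 102 / 100 := by
        rw [div_le_iff₀ h2]; linarith
      calc _ ≤ (102 / 100 : ℝ) ^ 2 * (2 * (10 * Real.log 2)) := by gcongr
        _ ≤ _ := by norm_num; linarith
    · have hl : Real.log ((1 - (ε : ℝ)) / ε) ≤ 7 * Real.log 2 := by
        rw [← Real.log_rpow two_pos]
        refine Real.log_le_log hr ?_
        rw [div_le_iff₀ h0]; norm_num; linarith
      have ha : (1 - (ε : ℝ)) / (1 - 2 * ε) ≤ 1215 / 1000 := by
        rw [div_le_iff₀ h2]; linarith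
      calc _ ≤ (1215 / 1000 : ℝ) ^ 2 * (2 * (7 * Real.log 2)) := by gcongr
        _ ≤ _ := by norm_num; linarith
  have hu' : u ≤ ε / (1 - ε) * (381 / 100) := by
    refine hu.trans ?_
    calc _ = ε / (1 - ε) * ((1 - (ε : ℝ)) / (1 - 2 * ε) *
          Real.sqrt (2 * Real.log ((1 - ε) / ε))) := by field_simp
      _ ≤ _ := by gcongr
  -- An atom at the fixed distance `37/50` is enough since `u ≤ 3.81 ε/(1 - ε)` and `0.194 · 3.81 <
  -- 37/50`. The choice `ρ = 2ε` makes the loss `1/(1 - ρ)` from the smaller variance cancel the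
  -- overlap factor `1 - 2ε`.
  refine ⟨X - 1 / 2000 * E + ε / (1 - ε) * (37 / 50), by linarith,
    (confusable_spike (ρ := 2 * ε) (by linarith) (by linarith) (by linarith) (by norm_num) ?_).mono
    (le_of_eq ?_)⟩
  · have he : Real.exp ((37 / 50 : ℝ) ^ 2 / (2 * (1 - 2 * ε))) ≤ 3 / 2 := by
      have hq : (37 / 50 : ℝ) ^ 2 / (2 * (1 - 2 * ε)) ≤ 2 / 5 := by
        rw [div_le_iff₀ (by positivity)]; linarith
      refine (Real.exp_le_exp.2 hq).trans ?_
      refine le_of_pow_le_pow_left₀ (n := 5) (by norm_num) (by norm_num) ?_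
      have h5 : Real.exp (2 / 5 : ℝ) ^ 5 = Real.exp 1 ^ 2 := by
        rw [← Real.exp_nat_mul, ← Real.exp_nat_mul]; norm_num
      rw [h5]
      calc Real.exp 1 ^ 2 ≤ (2.7182818286 : ℝ) ^ 2 := by gcongr; exact Real.exp_one_lt_d9.le
        _ ≤ _ := by norm_num
    have he2 : (37 / 50 : ℝ) ^ 2 * Real.exp ((37 / 50 : ℝ) ^ 2 / (2 * (1 - 2 * ε))) ≤ 1 - ε := by
      linarith
    calc _ ≤ 2 * ((ε : ℝ) / (1 - ε) * (1 - ε)) := by gcongr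
      _ = _ := by rw [div_mul_cancel₀ _ h1.ne']
  · field_simp

/-- For a small gap `X` an atom at distance `2L/5` raises the mean by about `2E/5`. The price is a
shift shortened by `X ρ`, and `X L ≤ 3 w⁴` keeps it below `9E/100`. -/
theorem confusable_of_small_of_le {X E w L : ℝ} (hε : (ε : ℝ) < 1 / 1000)
    (hw0 : 0 < w) (hw1 : w < 17 / 40) (hεw : (ε : ℝ) = w ^ 8) (hL0 : 0 < L)
    (hwL : Real.exp (L ^ 2 / 8) = w⁻¹) (hwl : w ^ 2 * L ^ 2 ≤ 2) (hE : E = ε * L)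
    (hX : 1 / 2000 * E ≤ X) (hXL : X * L ≤ 3 * w ^ 4) :
    ∃ x, X + 3 / 10 * E < x ∧ Confusable ε x ((X - 1 / 2000 * E) ^ 2 / 2) := by
  have h1 : 0 < 1 - (ε : ℝ) := by linarith
  have hε0 : 0 < (ε : ℝ) := by rw [hεw]; positivity
  have hE0 : 0 < E := by rw [hE]; positivity
  -- This is large enough for the atom, which needs order `ε L² w⁻¹ = w⁷ L²`, and small enough for
  -- the loss `X ρ`.
  set ρ := 3 / 100 * (w ^ 4 * L ^ 2) with hρ
  have hw2 : w ^ 2 ≤ 1 / 5 := by nlinarith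
  have hρ0 : 0 ≤ ρ := by rw [hρ]; positivity
  have hρ1 : ρ ≤ 3 / 250 := by
    have : w ^ 4 * L ^ 2 = w ^ 2 * (w ^ 2 * L ^ 2) := by ring
    rw [hρ, this]
    have := mul_le_mul hw2 hwl (by positivity) (by norm_num)
    linarith
  have hXc : 0 ≤ X - 1 / 2000 * E := by linarith
  refine ⟨(X - 1 / 2000 * E) * (1 - ρ) + ε / (1 - ε) * (2 / 5 * L), ?_,
    (confusable_spike (ρ := ρ) (by linarith) (by linarith) (mul_nonneg hXc (by linarith))
      (by positivity) ?_).mono ?_⟩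
  · have h3 : (ε : ℝ) ≤ ε / (1 - ε) := by
      rw [le_div_iff₀ h1]
      have : 0 ≤ (ε : ℝ) * ε := by positivity
      linarith
    have h4 : E * (2 / 5) ≤ ε / (1 - ε) * (2 / 5 * L) := by
      rw [hE, mul_assoc, mul_comm L]; gcongr
    have h5 : X * ρ ≤ 9 / 100 * E := by
      have h6 : X * ρ = 3 / 100 * (w ^ 4 * L * (X * L)) := by rw [hρ]; ring
      have h7 : 9 / 100 * E = 3 / 100 * (w ^ 4 * L * (3 * w ^ 4)) := by rw [hE, hεw]; ring
      rw [h6, h7]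
      gcongr
    have h7 : 0 ≤ E * ρ := by positivity
    have h8 : (X - 1 / 2000 * E) * (1 - ρ) = X - 1 / 2000 * E - X * ρ + 1 / 2000 * (E * ρ) := by ring
    linarith
  · have h3 : Real.exp ((2 / 5 * L) ^ 2 / (2 * (1 - ρ))) ≤ w⁻¹ := by
      rw [← hwL]
      refine Real.exp_le_exp.2 ?_
      rw [div_le_iff₀ (by linarith), mul_pow]
      have : L ^ 2 / 8 * (2 * (1 - 3 / 250)) ≤ L ^ 2 / 8 * (2 * (1 - ρ)) := by gcongr
      have : 0 ≤ L ^ 2 := by positivity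
      linarith
    have h4 : (ε : ℝ) / (1 - ε) ≤ 1002 / 1000 * w ^ 8 := by
      rw [← hεw, div_le_iff₀ h1]; nlinarith
    have h5 : w ^ 3 ≤ 77 / 1000 := by
      calc w ^ 3 ≤ (17 / 40) ^ 3 := by gcongr
        _ ≤ _ := by norm_num
    calc _ ≤ 2 * (1002 / 1000 * w ^ 8 * ((2 / 5 * L) ^ 2 * w⁻¹)) := by gcongr
      _ = (4008 / 12500 * w ^ 3) * (w ^ 4 * L ^ 2) := by
        field_simp; norm_num
      _ ≤ 3 / 100 * (w ^ 4 * L ^ 2) := by gcongr; linarith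
  · have h3 : ((X - 1 / 2000 * E) * (1 - ρ)) ^ 2 / (2 * (1 - ρ)) =
        (X - 1 / 2000 * E) ^ 2 / 2 * (1 - ρ) := by
      have : 1 - ρ ≠ 0 := by linarith
      field_simp
    rw [h3, mul_left_comm]
    have h5 : (1 - 2 * (ε : ℝ)) * (1 - ρ) ≤ 1 :=
      mul_le_one₀ (by linarith) (by linarith) (by linarith)
    exact mul_le_of_le_one_right (by positivity) h5

/-- For a larger gap, contamination at distance `M = L/√2` saves about `0.7 E d` on a shift `d`. The
chi-square penalty is below `ε² ε^(-1/2) = w¹²`, which is at most `E X / 3` by `hXL`; the balance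
pays for a raise by `0.29 E`. -/
theorem confusable_of_small_of_lt {X E w L : ℝ} (hε : (ε : ℝ) < 1 / 1000)
    (hw0 : 0 < w) (hεw : (ε : ℝ) = w ^ 8) (hL0 : 0 < L)
    (hwL : Real.exp (L ^ 2 / 8) = w⁻¹) (hE : E = ε * L)
    (hX : 1 / 2000 * E < X) (hXL : 3 * w ^ 4 < X * L) :
    ∃ x, X + 28 / 100 * E < x ∧ Confusable ε x ((X - 1 / 2000 * E) ^ 2 / 2) := by
  have h1 : 0 < 1 - (ε : ℝ) := by linarith
  have hε0 : 0 < (ε : ℝ) := by rw [hεw]; positivity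
  have hE0 : 0 < E := by rw [hE]; positivity
  have hs : Real.sqrt (L ^ 2 / 2) ^ 2 = L ^ 2 / 2 := Real.sq_sqrt (by positivity)
  set M := Real.sqrt (L ^ 2 / 2) with hM
  have hM0 : 0 < M := Real.sqrt_pos.2 (by positivity)
  have hML : 7 / 10 * L ≤ M := by
    refine Real.le_sqrt_of_sq_le ?_
    have : 0 ≤ L ^ 2 := by positivity
    rw [mul_pow]; linarith
  refine ⟨X - 1 / 2000 * E + 29 / 100 * E, by linarith,
    (confusable_tail (by linarith) hM0).mono ?_⟩
  set X' := X - 1 / 2000 * E with hX'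
  have hexp : (ε : ℝ) ^ 2 * (Real.exp (M ^ 2) - 1) ≤ w ^ 12 := by
    have h3 : Real.exp (M ^ 2) = (w ^ 4)⁻¹ := by
      rw [hs, ← inv_pow, ← hwL, ← Real.exp_nat_mul]; congr 1; push_cast; ring
    rw [h3, hεw]
    have h4 : (w ^ 8) ^ 2 * ((w ^ 4)⁻¹ - 1) = w ^ 12 - w ^ 16 := by field_simp
    rw [h4]
    have : 0 < w ^ 16 := by positivity
    linarith
  have hEX : 3 * w ^ 12 ≤ E * X := by
    have h3 : E * X = w ^ 8 * (X * L) := by rw [hE, hεw]; ring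
    have h4 : 3 * w ^ 12 = w ^ 8 * (3 * w ^ 4) := by ring
    rw [h3, h4]
    gcongr
  have hX'0 : 0 < X' := by linarith
  have hEX' : E * X = E * X' + 1 / 2000 * E ^ 2 := by rw [hX']; ring
  have hd0 : 0 < X' + 29 / 100 * E := by linarith
  have h3 : (X' + 29 / 100 * E) * (7 / 10 * E) ≤ (X' + 29 / 100 * E) * (ε * M) := by
    refine mul_le_mul_of_nonneg_left ?_ hd0.le
    rw [hE, mul_left_comm]; gcongr
  have h4 : (1 - (ε : ℝ)) * ((X' + 29 / 100 * E) * (7 / 10 * E)) ≤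
      (1 - (ε : ℝ)) * ((X' + 29 / 100 * E) * (ε * M)) := by gcongr
  have h5 : 999 / 1000 * ((X' + 29 / 100 * E) * (7 / 10 * E)) ≤
      (1 - (ε : ℝ)) * ((X' + 29 / 100 * E) * (7 / 10 * E)) := by gcongr; linarith
  have h6 : (1 - (ε : ℝ)) * ((X' + 29 / 100 * E) ^ 2 / 2) ≤ (X' + 29 / 100 * E) ^ 2 / 2 :=
    mul_le_of_le_one_left (by positivity) (by linarith)
  have h7 : 0 < E * X' := by positivity
  have h8 : 0 < E ^ 2 := by positivity
  have h9 : (X' + 29 / 100 * E) ^ 2 / 2 =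
      X' ^ 2 / 2 + 29 / 100 * (E * X') + 841 / 20000 * E ^ 2 := by ring
  have h10 : (X' + 29 / 100 * E) * (7 / 10 * E) =
      7 / 10 * (E * X') + 203 / 1000 * E ^ 2 := by ring
  rw [mul_sub]
  linarith

theorem confusable_of_small {u X E : ℝ} (hε : (ε : ℝ) < 1 / 1000) (hε0 : 0 < (ε : ℝ))
    (hE : E = ε * Real.sqrt (Real.log (1 / (ε : ℝ)))) (hEu : E / 8 ≤ u)
    (hu : u ≤ ε / (1 - 2 * ε) * Real.sqrt (2 * Real.log ((1 - ε) / ε))) (hX : 7 / 5 * u ≤ X) :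
    ∃ x, X + 19 / 100 * u < x ∧ Confusable ε x ((X - 1 / 2000 * E) ^ 2 / 2) := by
  have h1 : 0 < 1 - (ε : ℝ) := by linarith
  have h2 : 0 < 1 - 2 * (ε : ℝ) := by linarith
  set l := Real.log (1 / (ε : ℝ)) with hl
  have hl1 : 6 < l := by
    rw [hl, Real.lt_log_iff_exp_lt (by positivity)]
    have h3 : Real.exp 6 < 1000 := by
      have := Real.exp_one_lt_d9
      have h4 : Real.exp 6 = Real.exp 1 ^ 6 := by rw [← Real.exp_nat_mul]; norm_num
      rw [h4]
      calc Real.exp 1 ^ 6 < (2.7182818286 : ℝ) ^ 6 := by gcongr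
        _ < 1000 := by norm_num
    exact h3.trans (by rw [lt_div_iff₀ hε0]; linarith)
  -- Thus `w = ε^(1/8)`, so the powers of `ε` in both cases become integer powers of `w`.
  set w := Real.exp (-(l / 8)) with hw
  have hw0 : 0 < w := Real.exp_pos _
  have hεl : (ε : ℝ) = Real.exp (-l) := by
    rw [hl, Real.log_div one_ne_zero hε0.ne', Real.log_one, zero_sub, neg_neg, Real.exp_log hε0]
  have hεw : (ε : ℝ) = w ^ 8 := by
    rw [hεl, hw, ← Real.exp_nat_mul]; congr 1; push_cast; ring
  have hw1 : w < 17 / 40 := by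
    refine lt_of_pow_lt_pow_left₀ 8 (by norm_num) ?_
    rw [← hεw]; exact hε.trans_le (by norm_num)
  have hlw : l = -(8 * Real.log w) := by rw [hw, Real.log_exp]; ring
  have hwl : w ^ 2 * l ≤ 2 := by
    have h3 : -Real.log w ≤ w⁻¹ - 1 := by
      rw [← Real.log_inv]; exact Real.log_le_sub_one_of_pos (inv_pos.2 hw0)
    have h4 : w ^ 2 * l ≤ w ^ 2 * (8 * (w⁻¹ - 1)) := by gcongr; linarith
    have h5 : w ^ 2 * (8 * (w⁻¹ - 1)) = 8 * (w - w ^ 2) := by field_simp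
    linarith [sq_nonneg (w - 1 / 2)]
  set L := Real.sqrt l with hL
  have hL2 : L ^ 2 = l := Real.sq_sqrt (by linarith)
  have hL0 : 0 < L := Real.sqrt_pos.2 (by linarith)
  have hE0 : 0 < E := by rw [hE]; positivity
  have hwL : Real.exp (L ^ 2 / 8) = w⁻¹ := by rw [hL2, hw, ← Real.exp_neg, neg_neg]
  have huE : u ≤ 1418 / 1000 * E := by
    have h3 : Real.sqrt (2 * Real.log ((1 - ε) / ε)) ≤ 14149 / 10000 * L := by
      rw [Real.sqrt_le_left (by positivity), mul_pow, hL2]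
      have : Real.log ((1 - ε) / ε) ≤ l := by
        rw [hl]; refine Real.log_le_log (by positivity) ?_
        gcongr; linarith
      linarith
    have h4 : (ε : ℝ) / (1 - 2 * ε) ≤ 1002005 / 1000000 * ε := by
      rw [div_le_iff₀ h2]; nlinarith
    refine hu.trans ((mul_le_mul h4 h3 (Real.sqrt_nonneg _) (by positivity)).trans ?_)
    rw [hE]
    have := mul_pos hε0 hL0
    linarith
  have hX0 : 1 / 2000 * E < X := by linarith
  rw [← hL2] at hwl
  rcases le_or_gt (X * L) (3 * w ^ 4) with hXL | hXL
  · obtain ⟨x, hx, h⟩ := confusable_of_small_of_le hε hw0 hw1 hεw hL0 hwL hwl hE hX0.le hXL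
    exact ⟨x, by linarith, h⟩
  · obtain ⟨x, hx, h⟩ := confusable_of_small_of_lt hε hw0 hεw hL0 hwL hE hX0 hXL
    exact ⟨x, by linarith, h⟩

theorem exists_confusable {u X : ℝ} (hε : (ε : ℝ) < 1 / 2) (hX0 : 0 < X) (hX : 7 / 5 * u ≤ X)
    (hu0 : (ε : ℝ) = 0 → u = 0)
    (hEu : ε * Real.sqrt (Real.log (1 / (ε : ℝ))) / 8 ≤ u)
    (hu : 0 < (ε : ℝ) → (ε : ℝ) ≤ 1 / 4 →
      u ≤ ε / (1 - 2 * ε) * Real.sqrt (2 * Real.log ((1 - ε) / ε))) :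
    ∃ P Q : ProbabilityMeasure ℝ, IsSubGaussian 1 P ∧ mean P = 0 ∧ 0 < mean Q ∧
      ∀ η : ℝ, 0 < η → ∃ P' Q' : ProbabilityMeasure ℝ, IsSubGaussian 1 P' ∧
        X + 19 / 100 * u < mean P' ∧ mean Q' = 0 ∧
        KLBound (contaminated ε P Q) (contaminated ε P' Q')
          ((X - 1 / 2000 * (ε * Real.sqrt (Real.log (1 / (ε : ℝ))))) ^ 2 / 2 * (1 + η)) := by
  rcases ε.2.1.eq_or_lt with h0 | h0
  · have h1 : 0 < mean (gauss 1 1) := by simp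
    -- Without contamination there is no discount, and the strict inequality for the mean has to be
    -- bought by `η`. The base pair is fixed before `η`, since the instance must not depend on it.
    refine ⟨gauss 0 1, gauss 1 1, isSubGaussian_gauss (by simp), mean_gauss _ _, h1,
      fun η hη => ⟨gauss (X * Real.sqrt (1 + η)) 1, gauss 0 1, isSubGaussian_gauss (by simp), ?_,
        mean_gauss _ _, ?_⟩⟩
    · rw [hu0 h0.symm, mean_gauss, mul_zero, add_zero]
      exact lt_mul_of_one_lt_right hX0 (Real.lt_sqrt_of_sq_lt (by linarith))
    · have := KLBound.gaussian_one (X * Real.sqrt (1 + η))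
      rw [mul_pow, Real.sq_sqrt (by linarith)] at this
      simp only [contaminated, ← h0]
      simpa [gauss, mul_div_right_comm] using this
  · set E := ε * Real.sqrt (Real.log (1 / (ε : ℝ))) with hE
    have hE0 : 0 < E :=
      mul_pos h0 (Real.sqrt_pos.2 (Real.log_pos (by rw [lt_div_iff₀ h0]; linarith)))
    have key : ∃ x, X + 19 / 100 * u < x ∧ Confusable ε x ((X - 1 / 2000 * E) ^ 2 / 2) := by
      rcases lt_or_ge (ε : ℝ) (1 / 1000) with h | h
      · exact confusable_of_small h h0 hE hEu (hu h0 (by linarith)) hX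
      rcases lt_or_ge (ε : ℝ) (3 / 20) with h' | h'
      · exact confusable_of_medium h' h hE0 hEu (hu h0 (by linarith)) hX
      · exact confusable_of_large hε h' hE0 hEu hX
    obtain ⟨x, hx, P, Q, P', Q', h1, h2, h3, h4, h5, h6, h7⟩ := key
    exact ⟨P, Q, h1, h2, h3, fun η hη => ⟨P', Q', h4, h5 ▸ hx, h6, h7.mono
      (le_mul_of_one_le_right (by positivity) (by linarith))⟩⟩

/-- An arm and an adversary that is cheap to confuse with an arm of larger mean. -/
theorem exists_raised {σ x : ℝ} (hε : (ε : ℝ) < 1 / 2) (hσ : 0 < σ) (m : ℝ) (hx0 : 0 < x)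
    (hx : 7 / 5 * uncertainty ε σ ≤ x) :
    ∃ P Q : ProbabilityMeasure ℝ, IsSubGaussian σ P ∧ mean P = m ∧ Q ≠ P ∧
      ∀ η : ℝ, 0 < η → ∃ P' Q' : ProbabilityMeasure ℝ, IsSubGaussian σ P' ∧
        m + x + 19 / 100 * uncertainty ε σ < mean P' ∧ Q' ≠ P' ∧
        KLBound (contaminated ε P Q) (contaminated ε P' Q')
          ((x - 1 / 2000 * (σ * ε * Real.sqrt (Real.log (1 / (ε : ℝ))))) ^ 2 / (2 * σ ^ 2) *
            (1 + η)) := by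
  set u := uncertainty ε σ / σ with hu
  have hUu : uncertainty ε σ = σ * u := (mul_div_cancel₀ _ hσ.ne').symm
  have hxσ : σ * (x / σ) = x := mul_div_cancel₀ _ hσ.ne'
  have hu' : 7 / 5 * u ≤ x / σ := by
    rw [le_div_iff₀ hσ, mul_assoc, mul_comm u, ← hUu]; exact hx
  have hu0 : 0 ≤ u := div_nonneg uncertainty_nonneg hσ.le
  obtain ⟨P, Q, h1, h2, h3, h4⟩ := exists_confusable (u := u) (X := x / σ) hε (by positivity) hu'
    (fun h => by rw [hu, uncertainty_of_eq_zero h, zero_div])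
    (by rw [hu, le_div_iff₀ hσ]; have := mul_sqrt_le_uncertainty ε hε hσ; linarith)
    (fun h h' => by rw [hu, div_le_iff₀ hσ, mul_comm]; exact uncertainty_le_mul_sqrt h h' hσ)
  refine ⟨affine σ m P, affine σ m Q, h1.affine σ m, by
    rw [mean_affine h1.integrable_id, h2, mul_zero, zero_add], fun h => ?_, fun η hη => ?_⟩
  · have := affine_injective hσ.ne' m h
    rw [this, h2] at h3
    exact h3.false
  · obtain ⟨P', Q', h5, h6, h7, h8⟩ := h4 η hη
    refine ⟨affine σ m P', affine σ m Q', h5.affine σ m, ?_, fun h => ?_, ?_⟩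
    · rw [mean_affine h5.integrable_id, hUu]
      have := mul_lt_mul_of_pos_left h6 hσ
      rw [mul_add, hxσ] at this
      linarith
    · have := affine_injective hσ.ne' m h
      rw [this] at h7
      have : 0 ≤ x / σ := by positivity
      linarith
    · rw [contaminated_affine, contaminated_affine]
      refine (h8.map (by fun_prop)).mono (le_of_eq ?_)
      field_simp

end Cheap

/-! ### Lowering the best arm, with adversaries distinct from the true laws. -/

section Lowered

variable {ε : unitInterval} {σ : ℝ}

/-- A normal law dominates a multiple of a normal law with smaller variance. -/
theorem smul_gaussianReal_le (m : ℝ) {v : ℝ≥0} (hv : v ≠ 0) {q : ℝ} (hq : 0 < q) (hq1 : q ≤ 1) :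
    ENNReal.ofReal q • gaussianReal m (Real.toNNReal (q ^ 2) * v) ≤ gaussianReal m v := by
  have hq2 : (Real.toNNReal (q ^ 2) : ℝ) = q ^ 2 := Real.coe_toNNReal _ (sq_nonneg q)
  have hv0 : 0 < (v : ℝ) := NNReal.coe_pos.2 (pos_iff_ne_zero.2 hv)
  have hw : Real.toNNReal (q ^ 2) * v ≠ 0 :=
    mul_ne_zero (by rw [Ne, Real.toNNReal_eq_zero, not_le]; positivity) hv
  rw [gaussianReal_of_var_ne_zero _ hv, gaussianReal_of_var_ne_zero _ hw,
    ← withDensity_smul _ (measurable_gaussianPDF _ _)]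
  refine withDensity_mono (Eventually.of_forall fun x => ?_)
  simp only [Pi.smul_apply, smul_eq_mul, gaussianPDF]
  rw [← ENNReal.ofReal_mul hq.le]
  refine ENNReal.ofReal_le_ofReal ?_
  simp only [gaussianPDFReal, NNReal.coe_mul, hq2]
  rw [show 2 * Real.pi * (q ^ 2 * v) = q ^ 2 * (2 * Real.pi * v) by ring,
    Real.sqrt_mul (sq_nonneg q), Real.sqrt_sq hq.le, mul_inv, ← mul_assoc, ← mul_assoc,
    mul_inv_cancel₀ hq.ne', one_mul]
  have : -(x - m) ^ 2 / (2 * (q ^ 2 * v)) ≤ -(x - m) ^ 2 / (2 * v) := by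
    rw [neg_div, neg_div, neg_le_neg_iff]
    gcongr
    exact mul_le_of_le_one_left hv0.le (pow_le_one₀ hq.le hq1)
  gcongr

theorem exists_contaminated_eq {P R : ProbabilityMeasure ℝ} (hε : 0 < (ε : ℝ))
    (h : ENNReal.ofReal (1 - (ε : ℝ)) • (R : Measure ℝ) ≤ P) :
    ∃ Q : ProbabilityMeasure ℝ, contaminated ε R Q = P := by
  have hf : IsFiniteMeasure (ENNReal.ofReal (1 - (ε : ℝ)) • (R : Measure ℝ)) :=
    Measure.smul_finite _ ENNReal.ofReal_ne_top
  set D := (P : Measure ℝ) - ENNReal.ofReal (1 - (ε : ℝ)) • (R : Measure ℝ) with hD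
  have hadd := Measure.sub_add_cancel_of_le h
  rw [← hD] at hadd
  have h0 : ENNReal.ofReal (ε : ℝ) ≠ 0 := by rwa [Ne, ENNReal.ofReal_eq_zero, not_le]
  have hc : ENNReal.ofReal (ε : ℝ) * (ENNReal.ofReal (ε : ℝ))⁻¹ = 1 :=
    ENNReal.mul_inv_cancel h0 ENNReal.ofReal_ne_top
  have huniv : D Set.univ = ENNReal.ofReal (ε : ℝ) := by
    have h1 := congrArg (fun μ : Measure ℝ => μ Set.univ) hadd
    simp only [Measure.add_apply, Measure.smul_apply, measure_univ, smul_eq_mul, mul_one] at h1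
    have h2 : ENNReal.ofReal (ε : ℝ) + ENNReal.ofReal (1 - (ε : ℝ)) = 1 := by
      rw [← ENNReal.ofReal_add ε.2.1 (sub_nonneg.2 ε.2.2), add_sub_cancel, ENNReal.ofReal_one]
    exact (ENNReal.add_left_inj ENNReal.ofReal_ne_top).1 (h1.trans h2.symm)
  refine ⟨⟨(ENNReal.ofReal (ε : ℝ))⁻¹ • D, ⟨?_⟩⟩, ?_⟩
  · rw [Measure.smul_apply, huniv, smul_eq_mul, mul_comm, hc]
  · change ENNReal.ofReal (1 - (ε : ℝ)) • (R : Measure ℝ) +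
      ENNReal.ofReal (ε : ℝ) • ((ENNReal.ofReal (ε : ℝ))⁻¹ • D) = P
    rw [smul_smul, hc, one_smul, add_comm, hadd]

theorem contaminated_self (ε : unitInterval) (P : ProbabilityMeasure ℝ) :
    contaminated ε P P = P := by
  rw [contaminated, ← add_smul, ← ENNReal.ofReal_add (sub_nonneg.2 ε.2.2) ε.2.1, sub_add_cancel,
    ENNReal.ofReal_one, one_smul]

/-- A smoothed law can be replaced such that the adversary does not use the true law. -/
theorem exists_ne_of_smooth (hε : (ε : ℝ) < 1) {P : ProbabilityMeasure ℝ}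
    (hP : IsSubGaussian σ P) {r m : ℝ} {v : ℝ≥0} (hv0 : v ≠ 0) (hv : r ^ 2 * σ ^ 2 + v ≤ σ ^ 2)
    (Q : ProbabilityMeasure ℝ) :
    ∃ P' Q' : ProbabilityMeasure ℝ, IsSubGaussian σ P' ∧ mean P' = r * mean P + m ∧ Q' ≠ P' ∧
      contaminated ε P' Q' = contaminated ε (smooth r m v P) Q := by
  by_cases hQ : Q = smooth r m v P
  swap
  · exact ⟨smooth r m v P, Q, hP.smooth hv, mean_smooth hP.integrable_id, hQ, rfl⟩
  rw [hQ, contaminated_self]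
  rcases ε.2.1.eq_or_lt with h0 | h0
  · refine ⟨smooth r m v P, affine 1 1 (smooth r m v P), hP.smooth hv,
      mean_smooth hP.integrable_id, fun h => ?_, by simp [contaminated, ← h0]⟩
    have h1 := congrArg mean h
    rw [mean_affine (hP.smooth hv).integrable_id] at h1
    linarith
  · have hq : 0 < 1 - (ε : ℝ) := sub_pos.2 hε
    have hq2 : (Real.toNNReal ((1 - (ε : ℝ)) ^ 2) : ℝ) = (1 - ε) ^ 2 :=
      Real.coe_toNNReal _ (sq_nonneg _)
    have hvpos : 0 < (v : ℝ) := NNReal.coe_pos.2 (pos_iff_ne_zero.2 hv0)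
    -- If the adversary plays the true law, nothing is contaminated. The noise is then narrowed by
    -- the factor `1 - ε`: a fraction `1 - ε` of the narrower law fits under the old one, and the
    -- normalized remainder is the new adversary. The two differ because their exponential moments
    -- at 1 do.
    set w : ℝ≥0 := Real.toNNReal ((1 - (ε : ℝ)) ^ 2) * v with hw
    have hwv : (w : ℝ) < v := by
      rw [hw, NNReal.coe_mul, hq2]
      exact mul_lt_of_lt_one_left hvpos (pow_lt_one₀ hq.le (by linarith) two_ne_zero)
    have hle : ENNReal.ofReal (1 - (ε : ℝ)) • (smooth r m w P : Measure ℝ) ≤ smooth r m v P := by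
      have hs : SFinite (ENNReal.ofReal (1 - (ε : ℝ)) • gaussianReal m w) := inferInstance
      rw [smooth_coe, smooth_coe, ← Measure.map_smul, ← Measure.prod_smul_right]
      refine Measure.map_mono ?_ (by fun_prop)
      exact Measure.prod_mono le_rfl (smul_gaussianReal_le m hv0 hq (by linarith))
    obtain ⟨Q', hQ'⟩ := exists_contaminated_eq h0 hle
    refine ⟨smooth r m w P, Q', hP.smooth (by linarith), mean_smooth hP.integrable_id,
      fun h => ?_, hQ'⟩
    rw [h, contaminated_self] at hQ'
    have h1 := (integrable_exp_smooth (r := r) (m := m) (v := w) hP 1).2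
    rw [hQ', (integrable_exp_smooth (r := r) (m := m) (v := v) hP 1).2] at h1
    have h2 : 0 < ∫ x, Real.exp (1 * r * x) ∂(P : Measure ℝ) :=
      integral_exp_pos ((isSubGaussian_iff.1 hP (1 * r)).1)
    have h3 := Real.exp_injective (mul_left_cancel₀ h2.ne' h1)
    linarith

/-- An arm and an adversary that cannot be told apart from an arm with a mean that is smaller by
almost twice the uncertainty, and that can be moved further down at the usual cost. -/
theorem exists_lowered (hε : (ε : ℝ) < 1) (hσ : 0 < σ) (m : ℝ) :
    ∃ P Q : ProbabilityMeasure ℝ, IsSubGaussian σ P ∧ mean P = m ∧ Q ≠ P ∧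
      ∀ y : ℝ, ∃ P' Q' : ProbabilityMeasure ℝ, IsSubGaussian σ P' ∧
        mean P' ≤ m - 181 / 100 * uncertainty ε σ - y ∧ Q' ≠ P' ∧
        KLBound (contaminated ε P Q) (contaminated ε P' Q')
          (y ^ 2 / (2 * ((21 / 50) ^ 2 * σ ^ 2))) := by
  obtain ⟨P, Q, P', Q', hP, hP', hC, hm⟩ :=
    exists_mean_sub_ge (ε := ε) (σ := σ) (499 / 500) (by norm_num)
  set v : ℝ≥0 := Real.toNNReal ((21 / 50) ^ 2 * σ ^ 2) with hv
  have hvc : (v : ℝ) = (21 / 50) ^ 2 * σ ^ 2 := Real.coe_toNNReal _ (by positivity)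
  have hv0 : v ≠ 0 := by
    rw [hv, Ne, Real.toNNReal_eq_zero, not_le]; positivity
  have hvσ : (907 / 1000) ^ 2 * σ ^ 2 + v ≤ σ ^ 2 := by
    rw [hvc]; nlinarith [sq_nonneg σ]
  -- The constants satisfy `0.907² + 0.42² ≤ 1`, so the smoothed law stays `σ`-sub-Gaussian, and `2
  -- · 0.907 · (499/500) ≥ 1.81`.
  set d := m - 907 / 1000 * mean P with hd
  obtain ⟨P₁, Q₁, h1, h2, h3, h4⟩ := exists_ne_of_smooth hε hP (m := d) hv0 hvσ
    (smooth (907 / 1000) d v Q)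
  refine ⟨P₁, Q₁, h1, by rw [h2, hd]; ring, h3, fun y => ?_⟩
  obtain ⟨P₂, Q₂, h5, h6, h7, h8⟩ := exists_ne_of_smooth hε hP' (m := d - y) hv0 hvσ
    (smooth (907 / 1000) (d - y) v Q')
  refine ⟨P₂, Q₂, h5, ?_, h7, ?_⟩
  · have := uncertainty_nonneg (ε := ε) (σ := σ)
    rw [h6, hd]; linarith
  · have : IsProbabilityMeasure ((contaminated ε P' Q').map fun x => 907 / 1000 * x) :=
      Measure.isProbabilityMeasure_map (by fun_prop)
    rw [h4, h8, contaminated_smooth, contaminated_smooth, hC]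
    refine (KLBound.conv_gaussian _ d (d - y) hv0).mono (le_of_eq ?_)
    rw [hvc]; ring

end Lowered

/-! ### Assembling the hard instance, and the limit `δ → 0`. -/

section Bandit

variable {K : ℕ} {ε : unitInterval} {σ : ℝ}

/-- The information bound for an alternative environment that differs in two arms. -/
theorem Procedure.information_le_of_two (π : Procedure K) {U δ : ℝ} (hδ : 0 < δ) (hδ1 : δ < 1)
    (hπ : π.IsPAC ε σ U δ) {P Q : Fin K → ProbabilityMeasure ℝ} (hP : ∀ i, IsSubGaussian σ (P i))
    (hQ : ∀ i, Q i ≠ P i) {a i : Fin K} (hi : i ≠ a)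
    (ha : ∀ j, j ≠ a → mean (P j) + U < mean (P a) - U)
    {Pa Qa Pi Qi : ProbabilityMeasure ℝ} (hPa : IsSubGaussian σ Pa) (hQa : Qa ≠ Pa)
    (hPi : IsSubGaussian σ Pi) (hQi : Qi ≠ Pi) (hm : mean Pa + U < mean Pi - U) {ka ki : ℝ}
    (hka : KLBound (contaminated ε (P a) (Q a)) (contaminated ε Pa Qa) ka)
    (hki : KLBound (contaminated ε (P i) (Q i)) (contaminated ε Pi Qi) ki)
    (hT : π.expectedTime ε P (fun j _ => Q j) ≠ ⊤) :
    (1 - δ) * Real.log (1 / δ) - 1 ≤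
      (π.expectedPulls ε P (fun j _ => Q j) a).toReal * ka +
        (π.expectedPulls ε P (fun j _ => Q j) i).toReal * ki := by
  set P' := Function.update (Function.update P a Pa) i Pi with hP'
  set Q' := Function.update (Function.update Q a Qa) i Qi with hQ'
  set k : Fin K → ℝ := Function.update (Function.update (fun _ => 0) a ka) i ki with hk
  have e1 : P' i = Pi := by simp [hP']
  have e2 : Q' i = Qi := by simp [hQ']
  have e3 : P' a = Pa := by simp [hP', hi.symm]
  have e4 : Q' a = Qa := by simp [hQ', hi.symm]
  have e5 : k i = ki := by simp [hk]
  have e6 : k a = ka := by simp [hk, hi.symm]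
  have e7 : ∀ j, j ≠ i → j ≠ a → P' j = P j ∧ Q' j = Q j ∧ k j = 0 := fun j h h' => by
    simp [hP', hQ', hk, h, h']
  have hall (p : Fin K → Prop) (h1 : p i) (h2 : p a) (h3 : ∀ j, j ≠ i → j ≠ a → p j) : ∀ j, p j :=
    fun j => by
      by_cases h : j = i
      · exact h ▸ h1
      by_cases h' : j = a
      · exact h' ▸ h2
      exact h3 j h h'
  have hKL : ∀ j, KLBound (contaminated ε (P j) (Q j)) (contaminated ε (P' j) (Q' j)) (k j) := by
    refine hall _ (by rwa [e1, e2, e5]) (by rwa [e3, e4, e6]) fun j h h' => ?_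
    obtain ⟨h1, h2, h3⟩ := e7 j h h'
    rw [h1, h2, h3]
    exact KLBound.refl _
  have hbase := hπ P (fun j _ => Q j) hP fun j _ => hQ j
  have halt := hπ P' (fun j _ => Q' j)
    (hall _ (by rwa [e1]) (by rwa [e3]) fun j h h' => by rw [(e7 j h h').1]; exact hP j)
    (fun j _ => hall (fun j => Q' j ≠ P' j) (by rwa [e1, e2]) (by rwa [e3, e4])
      (fun j h h' => by rw [(e7 j h h').1, (e7 j h h').2.1]; exact hQ j) j)
  have := π.information_le ε (k := k) (fun j => by
      obtain ⟨ℓ, h1, h2, h3, h4⟩ := hKL j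
      exact ⟨ℓ, h1, fun _ => ⟨h2, h3, h4⟩⟩) hδ hδ1 hbase halt
    (fun j hj => ⟨a, ha j hj⟩) ⟨i, by rwa [e1, e3]⟩ hT
  refine this.trans (le_of_eq ?_)
  rw [Finset.sum_eq_add a i hi.symm (fun j _ h => by rw [(e7 j h.2 h.1).2.2, mul_zero])
    (fun h => absurd (Finset.mem_univ _) h) (fun h => absurd (Finset.mem_univ _) h), e5, e6]

theorem le_of_forall_mul_one_add_le {f c : ℝ} (h : ∀ η : ℝ, 0 < η → f ≤ c * (1 + η)) : f ≤ c := by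
  have : Tendsto (fun η : ℝ => c * (1 + η)) (𝓝[>] 0) (𝓝 (c * (1 + 0))) :=
    ((continuous_const.mul (continuous_const.add continuous_id)).tendsto 0).mono_left
      nhdsWithin_le_nhds
  rw [add_zero, mul_one] at this
  exact ge_of_tendsto this (eventually_nhdsWithin_of_forall fun η hη => h η hη)

/-- The complexity of the instance. -/
noncomputable def complexity (μ : Fin K → ℝ) (a b : Fin K) (σ e : ℝ) : ℝ :=
  ∑ i : Fin K, (Real.sqrt 2 * σ / (max (μ a - μ i) (μ a - μ b) - e)) ^ 2

theorem mul_complexity_le {μ N : Fin K → ℝ} {a b : Fin K} {e f : ℝ} (hσ : 0 < σ) (hba : b ≠ a)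
    (hb : ∀ i, i ≠ a → μ i ≤ μ b) (heb : e ≤ 1 / 500 * (μ a - μ b))
    (hab : μ b < μ a) (hf : 0 ≤ f)
    (hN : ∀ i, i ≠ a → i ≠ b → f ≤ N i * ((μ a - μ i - e) ^ 2 / (2 * σ ^ 2)))
    (hNab : f ≤ (N a + N b) * ((50 / 71 * (μ a - μ b)) ^ 2 / (2 * σ ^ 2))) :
    f * complexity μ a b σ e ≤ ∑ i, N i := by
  have hsq (x : ℝ) : (Real.sqrt 2 * σ / x) ^ 2 = 2 * σ ^ 2 / x ^ 2 := by
    rw [div_pow, mul_pow, Real.sq_sqrt zero_le_two]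
  have hΔ : 0 < μ a - μ b := by linarith
  set t : Fin K → ℝ := fun i => f * (Real.sqrt 2 * σ / (max (μ a - μ i) (μ a - μ b) - e)) ^ 2
    with ht
  have h1 : ∀ i, i ≠ a → i ≠ b → t i ≤ N i := fun i hia hib => by
    have h2 := hb i hia
    have h3 : 0 < μ a - μ i - e := by linarith
    simp only [ht]
    rw [max_eq_left (by linarith), hsq, mul_div_assoc', div_le_iff₀ (by positivity)]
    have h4 := hN i hia hib
    rw [mul_div_assoc', le_div_iff₀ (by positivity)] at h4
    exact h4
  have h2 : t a + t b ≤ N a + N b := by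
    have h3 : 0 < μ a - μ b - e := by linarith
    have h4 := hNab
    rw [mul_div_assoc', le_div_iff₀ (by positivity)] at h4
    simp only [ht]
    rw [sub_self, max_eq_right hΔ.le, max_self, hsq, ← mul_add, ← two_mul, mul_div_assoc',
      mul_div_assoc', div_le_iff₀ (by positivity)]
    have hN0 : 0 ≤ N a + N b := by
      by_contra hc
      push Not at hc
      have h5 : 0 < (50 / 71 * (μ a - μ b)) ^ 2 := by positivity
      have h6 : 0 ≤ f * (2 * σ ^ 2) := by positivity
      nlinarith
    -- This is where one bound on the joint pulls of `a` and `b` covers two equal terms: `2 (50/71)²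
    -- ≤ (499/500)²`.
    have h5 : 2 * (50 / 71 * (μ a - μ b)) ^ 2 ≤ (μ a - μ b - e) ^ 2 := by
      have h6 : (499 / 500 * (μ a - μ b)) ^ 2 ≤ (μ a - μ b - e) ^ 2 := by
        gcongr; linarith
      have h7 : 0 < (μ a - μ b) ^ 2 := by positivity
      linarith
    have := mul_le_mul_of_nonneg_left h5 hN0
    linarith
  have h3 (g : Fin K → ℝ) : ∑ i, g i = g a + g b + ∑ i ∈ (Finset.univ.erase a).erase b, g i := by
    rw [← Finset.add_sum_erase _ _ (Finset.mem_univ a), ← Finset.add_sum_erase (Finset.univ.erase a)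
      _ (Finset.mem_erase.2 ⟨hba, Finset.mem_univ b⟩), add_assoc]
  rw [complexity, Finset.mul_sum, h3, h3 N]
  refine add_le_add h2 (Finset.sum_le_sum fun i hi => ?_)
  simp only [Finset.mem_erase, Finset.mem_univ, and_true] at hi
  exact h1 i hi.2 hi.1

/-- A hard instance: the complexity bound at a fixed confidence level. -/
theorem exists_instance (hε : (ε : ℝ) < 1 / 2) (hσ : 0 < σ) (μ : Fin K → ℝ) (a b : Fin K)
    (ha : ∀ i, i ≠ a → μ i + uncertainty ε σ < μ a - uncertainty ε σ) (hba : b ≠ a)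
    (hb : ∀ i, i ≠ a → μ i ≤ μ b) :
    ∃ P : Fin K → ProbabilityMeasure ℝ, (∀ i, IsSubGaussian σ (P i)) ∧ (∀ i, mean (P i) = μ i) ∧
      ∃ Q : Fin K → ProbabilityMeasure ℝ, (∀ i, Q i ≠ P i) ∧
        ∀ (π : Procedure K) (δ : ℝ), 0 < δ → δ < 1 → 0 ≤ (1 - δ) * Real.log (1 / δ) - 1 →
          π.IsPAC ε σ (uncertainty ε σ) δ →
          ENNReal.ofReal (((1 - δ) * Real.log (1 / δ) - 1) * complexity μ a b σ
            (1 / 2000 * (σ * ε * Real.sqrt (Real.log (1 / (ε : ℝ)))))) ≤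
            π.expectedTime ε P fun i _ => Q i := by
  set U := uncertainty ε σ with hU
  have hU0 : 0 ≤ U := uncertainty_nonneg
  set e := 1 / 2000 * (σ * ε * Real.sqrt (Real.log (1 / (ε : ℝ)))) with he
  have he0 : 0 ≤ e :=
    mul_nonneg (by norm_num) (mul_nonneg (mul_nonneg hσ.le ε.2.1) (Real.sqrt_nonneg _))
  have heU : e ≤ 1 / 250 * U := by
    have := mul_sqrt_le_uncertainty ε hε hσ
    rw [← hU] at this
    rw [he]; linarith
  have hab := ha b hba
  -- Chosen so that `z + (21/50) z` is the whole gap; moreover the gap exceeds `2U`, so `z` exceeds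
  -- `(100/71) U`, more than the `7/5 U` that raising requires.
  set z := 50 / 71 * (μ a - μ b) with hz
  set x : Fin K → ℝ := fun i => if i = b then z else μ a - μ i with hx
  have hxb : x b = z := by simp [hx]
  have hxi : ∀ i, i ≠ b → x i = μ a - μ i := fun i hi => by simp [hx, hi]
  have hz0 : 0 < z := by rw [hz]; linarith
  have hx0 : ∀ i, i ≠ a → 0 < x i ∧ 7 / 5 * U ≤ x i := fun i hi => by
    have := ha i hi
    by_cases hib : i = b
    · rw [hib, hxb]; exact ⟨hz0, by rw [hz]; linarith⟩
    · rw [hxi i hib]; constructor <;> linarith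
  obtain ⟨Pa, Qa, ha1, ha2, ha3, ha4⟩ := exists_lowered (σ := σ) (by linarith : (ε : ℝ) < 1) hσ (μ a)
  have hraise : ∀ i, ∃ P Q : ProbabilityMeasure ℝ, IsSubGaussian σ P ∧ mean P = μ i ∧ Q ≠ P ∧
      (i = a → P = Pa ∧ Q = Qa) ∧ (i ≠ a → ∀ η : ℝ, 0 < η → ∃ P' Q' : ProbabilityMeasure ℝ,
        IsSubGaussian σ P' ∧ μ i + x i + 19 / 100 * U < mean P' ∧ Q' ≠ P' ∧
        KLBound (contaminated ε P Q) (contaminated ε P' Q')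
          ((x i - e) ^ 2 / (2 * σ ^ 2) * (1 + η))) := fun i => by
    by_cases hia : i = a
    · exact ⟨Pa, Qa, ha1, hia ▸ ha2, ha3, fun _ => ⟨rfl, rfl⟩, fun h => absurd hia h⟩
    · obtain ⟨P, Q, h1, h2, h3, h4⟩ := exists_raised hε hσ (μ i) (hx0 i hia).1 (hx0 i hia).2
      exact ⟨P, Q, h1, h2, h3, fun h => absurd h hia, fun _ => h4⟩
  choose P Q hP hm hQ hPa halt using hraise
  refine ⟨P, hP, hm, Q, hQ, fun π δ hδ hδ1 hf hπ => ?_⟩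
  by_cases hT : π.expectedTime ε P (fun i _ => Q i) = ⊤
  · rw [hT]; exact le_top
  set N := fun i => (π.expectedPulls ε P (fun i _ => Q i) i).toReal with hN
  have hsum : π.expectedTime ε P (fun i _ => Q i) = ENNReal.ofReal (∑ i, N i) := by
    have h := hT
    rw [π.expectedTime_eq_sum] at h ⊢
    rw [← ENNReal.toReal_sum (ENNReal.sum_ne_top.1 h), ENNReal.ofReal_toReal h]
  rw [hsum]
  refine ENNReal.ofReal_le_ofReal (mul_complexity_le hσ hba hb (by linarith) (by linarith) hf
    (fun i hia hib => ?_) ?_)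
  · refine le_of_forall_mul_one_add_le fun η hη => ?_
    obtain ⟨P₁, Q₁, h1, h2, h3, h4⟩ := halt i hia η hη
    -- With no further decrease the contaminated law of `a` does not change, so pulls of `a` carry
    -- no information.
    obtain ⟨P₂, Q₂, h5, h6, h7, h8⟩ := ha4 0
    rw [← (hPa a rfl).1, ← (hPa a rfl).2] at h8
    rw [hxi i hib] at h2 h4
    have := π.information_le_of_two hδ hδ1 hπ hP hQ hia (by simpa [hm] using ha) h5 h7 h1 h3
      (by rw [← hU] at h6; linarith) h8 h4 hT
    rw [mul_assoc]
    simpa using this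
  · refine le_of_forall_mul_one_add_le fun η hη => ?_
    obtain ⟨P₁, Q₁, h1, h2, h3, h4⟩ := halt b hba η hη
    -- The noise has standard deviation `(21/50) σ`, so this decrease costs exactly `z² / (2σ²)`.
    obtain ⟨P₂, Q₂, h5, h6, h7, h8⟩ := ha4 (21 / 50 * z)
    rw [← (hPa a rfl).1, ← (hPa a rfl).2] at h8
    rw [hxb] at h2 h4
    have hk : (21 / 50 * z) ^ 2 / (2 * ((21 / 50) ^ 2 * σ ^ 2)) ≤ z ^ 2 / (2 * σ ^ 2) * (1 + η) := by
      have h9 : (21 / 50 * z) ^ 2 / (2 * ((21 / 50) ^ 2 * σ ^ 2)) = z ^ 2 / (2 * σ ^ 2) := by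
        field_simp
      rw [h9]
      exact le_mul_of_one_le_right (by positivity) (by linarith)
    have hk' : (z - e) ^ 2 / (2 * σ ^ 2) * (1 + η) ≤ z ^ 2 / (2 * σ ^ 2) * (1 + η) := by
      gcongr
      · rw [hz]; linarith
      · linarith
    have := π.information_le_of_two hδ hδ1 hπ hP hQ hba (by simpa [hm] using ha) h5 h7 h1 h3
      (by rw [← hU] at h6; rw [hz] at h2 h6; linarith) (h8.mono hk) (h4.mono hk') hT
    rw [add_mul, add_mul, mul_assoc, mul_assoc]
    exact this

theorem tendsto_info_div_log :
    Tendsto (fun δ : ℝ => ((1 - δ) * Real.log (1 / δ) - 1) / Real.log (1 / δ)) (𝓝[>] 0) (𝓝 1) := by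
  have hlog : Tendsto (fun δ : ℝ => Real.log (1 / δ)) (𝓝[>] 0) atTop := by
    simp only [one_div]
    exact Real.tendsto_log_atTop.comp tendsto_inv_nhdsGT_zero
  have h1 : Tendsto (fun δ : ℝ => (1 - δ) - (Real.log (1 / δ))⁻¹) (𝓝[>] 0) (𝓝 (1 - 0 - 0)) :=
    ((tendsto_const_nhds.sub (tendsto_id.mono_left nhdsWithin_le_nhds))).sub
      hlog.inv_tendsto_atTop
  rw [sub_zero, sub_zero] at h1
  refine h1.congr' ?_
  filter_upwards [hlog.eventually_gt_atTop 0] with δ hδ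
  field_simp

theorem le_liminf_div_log {S : ℝ} {T : ℝ → ENNReal}
    (hT : ∀ δ : ℝ, 0 < δ → δ < 1 → 0 ≤ (1 - δ) * Real.log (1 / δ) - 1 →
      ENNReal.ofReal (((1 - δ) * Real.log (1 / δ) - 1) * S) ≤ T δ) :
    ENNReal.ofReal S ≤
      liminf (fun δ : ℝ => T δ / ENNReal.ofReal (Real.log (1 / δ))) (𝓝[>] (0 : ℝ)) := by
  have h1 := ENNReal.tendsto_ofReal (tendsto_info_div_log.mul_const S)
  rw [one_mul] at h1
  rw [← h1.liminf_eq]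
  refine liminf_le_liminf ?_
  have hlt : ∀ᶠ δ : ℝ in 𝓝[>] 0, δ < 1 := nhdsWithin_le_nhds (eventually_lt_nhds one_pos)
  filter_upwards [hlt, self_mem_nhdsWithin, tendsto_info_div_log.eventually_const_lt one_half_lt_one]
    with δ h2 h3 h4
  have h3' : 0 < δ := h3
  have hlog : 0 < Real.log (1 / δ) := Real.log_pos (by rw [lt_div_iff₀ h3']; linarith)
  rw [lt_div_iff₀ hlog] at h4
  have := hT δ h3 h2 (by linarith [mul_pos (one_half_pos (α := ℝ)) hlog])
  rw [div_mul_eq_mul_div, ENNReal.ofReal_div_of_pos hlog]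
  gcongr

end Bandit

end CBAI

theorem corollary1 :
    ∃ c : ℝ, 0 < c ∧
      (∀ (ε : unitInterval) (σ : ℝ), (ε : ℝ) < 1 / 2 → 0 < σ →
        c * (σ * ε * Real.sqrt (Real.log (1 / (ε : ℝ)))) ≤ CBAI.uncertainty ε σ) ∧
      ∀ (K : ℕ) (ε : unitInterval) (σ : ℝ), (ε : ℝ) < 1 / 2 → 0 < σ →
        -- the means, the best arm `a` and the second-best arm `b`
        ∀ (μ : Fin K → ℝ) (a b : Fin K),
          (∀ i, i ≠ a → μ i + CBAI.uncertainty ε σ < μ a - CBAI.uncertainty ε σ) →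
          b ≠ a → (∀ i, i ≠ a → μ i ≤ μ b) →
          ∃ P : Fin K → ProbabilityMeasure ℝ,
            (∀ i, CBAI.IsSubGaussian σ (P i)) ∧ (∀ i, CBAI.mean (P i) = μ i) ∧
            ∃ Q : Fin K → ℕ → ProbabilityMeasure ℝ,
              CBAI.IsAdversary P Q ∧
              -- every family of procedures, one for each confidence level `δ`
              ∀ π : ℝ → CBAI.Procedure K,
                (∀ δ : ℝ, 0 < δ → δ < 1 →
                  (π δ).IsPAC ε σ (CBAI.uncertainty ε σ) δ) →
                ENNReal.ofReal
                    (∑ i : Fin K,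
                      (Real.sqrt 2 * σ /
                        (max (μ a - μ i) (μ a - μ b) -
                          c * (σ * ε * Real.sqrt (Real.log (1 / (ε : ℝ)))))) ^ 2)
                  ≤ liminf
                      (fun δ : ℝ =>
                        (π δ).expectedTime ε P Q / ENNReal.ofReal (Real.log (1 / δ)))
                      (𝓝[>] (0 : ℝ)) := by
  refine ⟨1 / 2000, by norm_num, fun ε σ hε hσ => ?_, fun K ε σ hε hσ μ a b ha hba hb => ?_⟩
  · have h1 := CBAI.mul_sqrt_le_uncertainty ε hε hσ
    have h2 := CBAI.uncertainty_nonneg (ε := ε) (σ := σ)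
    linarith
  · obtain ⟨P, hP, hm, Q, hQ, h⟩ := CBAI.exists_instance hε hσ μ a b ha hba hb
    refine ⟨P, hP, hm, fun i _ => Q i, fun i _ => hQ i, fun π hπ => ?_⟩
    exact CBAI.le_liminf_div_log fun δ hδ hδ1 hf => h (π δ) δ hδ hδ1 hf (hπ δ hδ hδ1)
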